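/- Let $r\in\mathbb N$ and let $p\ge 1$ be an integer. Let $U$ be an open neighbourhood of $0$ in $\mathbb R^{1+r}$ and $A:U\to\mathbb R^r$ a real analytic function with $A(0,0)=0$. Let $\varepsilon>0$ and let $H=(H_1,\dots,H_r):[-\varepsilon,\varepsilon]\to\mathbb R^r$ be a $C^\infty$ function with $H(0)=0$ such that $(x,H(x))\in U$ and $$x^{p+1}H'(x)=A(x,H(x))\qquad\text{for all }x\in[-\varepsilon,\varepsilon]. \tag{1}$$ For a $C^\infty$ function $u$ near $0\in\mathbb R$ and an integer $k\ge 0$ put $T_ku(x)=x^{-k}\bigl(u(x)-\sum_{i=0}^{k}\frac{u^{(i)}(0)}{i!}x^i\bigr)$ for $x\ne 0$ and $T_ku(0)=0$. Let $\mathcal S_H$ (the simple functions relative to $H$) be the set of all germs at $0\in\mathbb R$ of functions $$x\mapsto f\bigl(x,T_kH(P_1(x)),\dots,T_kH(P_n(x))\bigr),$$ where $n,k\ge 0$ are integers, $f$ is a real function that is analytic near $0\in\mathbb R^{1+rn}$, $P_1,\dots,P_n$ are real polynomials with $P_l(0)=0$, and $T_k$ is applied to each component of $H$. Let $\mathcal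 A_H=(\mathcal A_H^m)_{m\in\mathbb N}$ be the smallest collection of subalgebras $\mathcal A^m$ of the algebras of germs of real $C^\infty$ functions at $0\in\mathbb R^m$ such that: (A1) $\mathcal A^m$ contains the germs of all functions of $m$ variables analytic at $0$, for every $m$, and the germs of $H_1,\dots,H_r$ at $0$ belong to $\mathcal A^1$; (A2) if $\phi\in\mathcal A^m$ and $\phi_1,\dots,\phi_m\in\mathcal A^n$ with $\phi_1(0)=\dots=\phi_m(0)=0$, then $\phi(\phi_1,\dots,\phi_m)\in\mathcal A^n$; (A3) if $\phi\in\mathcal A^{m+1}$, $\phi(0)=0$ and $\frac{\partial\phi}{\partial x_{m+1}}(0)\neq 0$, then there is $\bar\phi\in\mathcal A^m$ with $\bar\phi(0)=0$ such that the germ of $\phi(\mathbf x,\bar\phi(\mathbf x))$ at $0\in\mathbb R^m$ is zero; (A4) if $m\ge1$, $\phi\in\mathcal A^m$ and the germ of $(x_2,\dots,x_m)\mapsto\phi(0,x_2,\dots,x_m)$ is zero, then there is $\bar\phi\in\mathcal A^m$ with $\phi(\mathbf x)=x_1\bar\phi(\mathbf x)$. Assume that $\mathcal S_H$ is quasi-analytic,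 that is, every $\varphi\in\mathcal S_H$ whose Taylor series at $0$ vanishes is the zero germ. Then $\mathcal A_H$ is quasi-analytic in every number of variables: for every $m\ge1$, if the Taylor series at $0$ of $\phi\in\mathcal A_H^m$ vanishes, then $\phi=0$. -/

import Mathlib

open Filter Topology
open scoped ContDiff

/-- Germs at the origin of real functions of `m` real variables. -/
abbrev OriginGerm (m : ℕ) : Type := Filter.Germ (𝓝 (0 : Fin m → ℝ)) ℝ

/-- `φ` is the germ of a function that is `C^∞` on a (single) neighbourhood of the origin. -/
def IsSmoothGerm {E : Type*} [NormedAddCommGroup E] [NormedSpace ℝ E]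
    (φ : Filter.Germ (𝓝 (0 : E)) ℝ) : Prop :=
  ∃ f : E → ℝ, (f : Filter.Germ (𝓝 (0 : E)) ℝ) = φ ∧ ∃ U ∈ 𝓝 (0 : E), ContDiffOn ℝ ∞ f U

/-- The Taylor series of the germ `φ` at the origin vanishes: all derivatives, of order zero and
higher, of a representative are zero at the origin. -/
def TaylorVanishes {E : Type*} [NormedAddCommGroup E] [NormedSpace ℝ E]
    (φ : Filter.Germ (𝓝 (0 : E)) ℝ) : Prop :=
  ∃ f : E → ℝ, (f : Filter.Germ (𝓝 (0 : E)) ℝ) = φ ∧ ∀ n : ℕ, iteratedFDeriv ℝ n f 0 = 0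

/-- A set of germs at the origin is quasi-analytic if its only possible element with vanishing
Taylor series is the zero germ. -/
def QuasiAnalytic {E : Type*} [NormedAddCommGroup E] [NormedSpace ℝ E]
    (S : Set (Filter.Germ (𝓝 (0 : E)) ℝ)) : Prop :=
  ∀ φ ∈ S, TaylorVanishes φ → φ = 0

/-- The `k`-jet `J_k u (x) = ∑_{i ≤ k} u^{(i)}(0) / i! * x^i` at the origin. -/
noncomputable def jet (k : ℕ) (u : ℝ → ℝ) (x : ℝ) : ℝ :=
  ∑ i ∈ Finset.range (k + 1), iteratedDeriv i u 0 / (Nat.factorial i : ℝ) * x ^ i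

/-- `T_k u (x) = (u(x) - J_k u (x)) / x^k`. At `x = 0` the formula gives the value `0`, which is
that of the continuous extension, since `J_k u` contains the term of degree `k`. -/
noncomputable def jetQuotient (k : ℕ) (u : ℝ → ℝ) (x : ℝ) : ℝ :=
  (u x - jet k u x) / x ^ k

/-- The set `S_H` of simple functions relative to `H`: the germs at `0 ∈ ℝ` of functions
`x ↦ f (x, T_k H (P_1 x), …, T_k H (P_n x))` with `f` analytic at the origin and polynomials `P_l`
such that `P_l 0 = 0`. -/
def simpleGerms {r : ℕ} (H : ℝ → Fin r → ℝ) : Set (Filter.Germ (𝓝 (0 : ℝ)) ℝ) :=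
  {φ | ∃ (n k : ℕ) (f : ℝ × (Fin n → Fin r → ℝ) → ℝ) (P : Fin n → Polynomial ℝ),
    AnalyticAt ℝ f 0 ∧ (∀ l, (P l).eval 0 = 0) ∧
    φ = ((fun x : ℝ => f (x, fun l j => jetQuotient k (fun t => H t j) ((P l).eval x)) :
      ℝ → ℝ) : Filter.Germ (𝓝 (0 : ℝ)) ℝ)}

/-- The collections `B = (B m)` of algebras of `C^∞` germs at the origin that contain the analytic
germs and the components of `H` and are stable by composition, by implicit equations and by
monomial division. The subrings `B m` are subalgebras over `ℝ`, as the constants are analytic. -/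
structure IsAdmissibleClass {r : ℕ} (H : ℝ → Fin r → ℝ)
    (B : ∀ m : ℕ, Subring (OriginGerm m)) : Prop where
  smooth : ∀ (m : ℕ), ∀ φ ∈ B m, IsSmoothGerm φ
  analytic : ∀ (m : ℕ) (f : (Fin m → ℝ) → ℝ), AnalyticAt ℝ f 0 → (f : OriginGerm m) ∈ B m
  component : ∀ j : Fin r, ((fun x : Fin 1 → ℝ => H (x 0) j : (Fin 1 → ℝ) → ℝ) : OriginGerm 1) ∈ B 1
  comp : ∀ (m n : ℕ) (f : (Fin m → ℝ) → ℝ) (g : Fin m → (Fin n → ℝ) → ℝ),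
    (f : OriginGerm m) ∈ B m → (∀ i, (g i : OriginGerm n) ∈ B n) → (∀ i, g i 0 = 0) →
    ((fun x => f (fun i => g i x) : (Fin n → ℝ) → ℝ) : OriginGerm n) ∈ B n
  implicit : ∀ (m : ℕ) (f : (Fin (m + 1) → ℝ) → ℝ), (f : OriginGerm (m + 1)) ∈ B (m + 1) →
    f 0 = 0 → fderiv ℝ f 0 (Pi.single (Fin.last m) 1) ≠ 0 →
    ∃ g : (Fin m → ℝ) → ℝ, (g : OriginGerm m) ∈ B m ∧ g 0 = 0 ∧
      ∀ᶠ x in 𝓝 (0 : Fin m → ℝ), f (Fin.snoc x (g x) : Fin (m + 1) → ℝ) = 0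
  division : ∀ (m : ℕ) (f : (Fin (m + 1) → ℝ) → ℝ), (f : OriginGerm (m + 1)) ∈ B (m + 1) →
    (∀ᶠ y in 𝓝 (0 : Fin m → ℝ), f (Fin.cons 0 y : Fin (m + 1) → ℝ) = 0) →
    ∃ g : (Fin (m + 1) → ℝ) → ℝ, (g : OriginGerm (m + 1)) ∈ B (m + 1) ∧
      ∀ᶠ x in 𝓝 (0 : Fin (m + 1) → ℝ), f x = x 0 * g x

/-- The class `A_H = (A_H m)`: the smallest admissible collection, i.e. the intersection (taken for
each number `m` of variables) of all admissible collections. -/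
noncomputable def classA {r : ℕ} (H : ℝ → Fin r → ℝ) : ∀ m : ℕ, Subring (OriginGerm m) :=
  sInf {B | IsAdmissibleClass H B}

/-! The class `A_H` is the smallest admissible one, so it suffices to exhibit an admissible class
`arcClass` whose members satisfy an identity theorem. Its members must be simple along simple arcs:
then the restriction of `f` to a line through the origin is a simple function at each of its points,
hence is there either zero or equivalent to a nonzero monomial, by quasi-analyticity of `S_H`. The
set where the restriction vanishes locally is therefore open and closed, and it contains the origin
if the Taylor series of `f` vanishes (`ArcSimpleAt.eventually_eq_zero`).

Simplicity of `f ∘ σ` alone does not survive division: if `f = y_i g` and `σ_i = 0`, the values of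
`f` on the arc say nothing about `g`. The property is therefore enriched (`CurveApprox`). One blows
up along the arc, `z = a + P(x) + x^N w`, where the arc itself is `w = w₀(x)`, and asks that `x^d
f(z)` agree with a simple function of `x` with analytic parameters `w`, up to `O(|w -
w₀(x)|^(k+1))`, for every `k`. A division costs one order in `k`, which is harmless because all
orders are available.

Implicit equations raise a second difficulty: to treat a solution `h` of `f(z, h(z)) = 0` along a
simple arc `γ`, one needs `f` along `(γ, h ∘ γ)`, which is not yet known to be simple. Hence there
are two modes: exact estimates along simple arcs (`c = 0`), and estimates modulo flat functions
along all smooth arcs (`c = 1`). The second mode yields a simple `u` with `h ∘ γ - u` flat; then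
`f(γ, u)` is simple and flat, hence zero by hypothesis, and uniqueness gives `u = h ∘ γ`. The first
mode is now available.

The differential equation enters only through `exists_analytic_flow`: `H(z + z^(p+1) s)` is analytic
in `z`, `s` and `H(z)`. Along an arc equivalent to `s x^d`, a blow-up of order `N > d(p+1)` thus
turns `H` into a simple function with parameters; along a flat arc a Taylor polynomial suffices.

The stability properties are `CurveApprox.comp`, `CurveApprox.implicit` and `CurveApprox.div`; the
last two feed `ArcSimpleAt.implicit` and `ArcSimpleAt.div_coord`. -/

/-! ### Analytic superposition operators on spaces of continuous functions. -/

section Superposition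

variable {K : Type*} [TopologicalSpace K] [CompactSpace K]
  {E F : Type*} [NormedAddCommGroup E] [NormedSpace ℝ E] [NormedAddCommGroup F] [NormedSpace ℝ F]

/-- A continuous multilinear map acts pointwise on continuous functions. -/
noncomputable def pointwiseMultilinear {n : ℕ} (p : ContinuousMultilinearMap ℝ (fun _ : Fin n => E) F) :
    ContinuousMultilinearMap ℝ (fun _ : Fin n => C(K, E)) C(K, F) :=
  MultilinearMap.mkContinuous
    { toFun := fun v => ⟨fun t => p fun i => v i t, by fun_prop⟩
      map_update_add' := by
        intro _ v i x y
        ext t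
        have h : ∀ z : C(K, E), (fun j => (Function.update v i z) j t) =
            Function.update (fun j => v j t) i (z t) := by
          intro z; ext j; by_cases hj : j = i
          · subst hj; simp
          · simp [hj]
        simp [h]
      map_update_smul' := by
        intro _ v i c x
        ext t
        have h : ∀ z : C(K, E), (fun j => (Function.update v i z) j t) =
            Function.update (fun j => v j t) i (z t) := by
          intro z; ext j; by_cases hj : j = i
          · subst hj; simp
          · simp [hj]
        simp [h] } ‖p‖ (by
      intro v
      rw [ContinuousMap.norm_le _ (by positivity)]
      intro t
      refine (p.le_opNorm _).trans ?_
      gcongr with i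
      exact (v i).norm_coe_le_norm t)

theorem norm_pointwiseMultilinear_le {n : ℕ}
    (p : ContinuousMultilinearMap ℝ (fun _ : Fin n => E) F) :
    ‖(pointwiseMultilinear p : ContinuousMultilinearMap ℝ (fun _ : Fin n => C(K, E)) C(K, F))‖ ≤
      ‖p‖ :=
  MultilinearMap.mkContinuous_norm_le _ (norm_nonneg _) _

/-- The superposition operator `u ↦ f ∘ u` on continuous functions is analytic at `0` if `f` is. -/
theorem AnalyticAt.exists_superposition [CompleteSpace F] {f : E → F} (hf : AnalyticAt ℝ f 0) :
    ∃ Φ : C(K, E) → C(K, F), AnalyticAt ℝ Φ 0 ∧ ∀ᶠ u in 𝓝 0, ∀ t, Φ u t = f (u t) := by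
  obtain ⟨p, r, hp⟩ := hf
  -- The norms of the terms do not grow, so the radius does not shrink; evaluation at `t` is
  -- continuous and linear, and maps the sum of `q` at `u` to the sum of `p` at `u t`.
  let q : FormalMultilinearSeries ℝ C(K, E) C(K, F) := fun n => pointwiseMultilinear (p n)
  have hr : p.radius ≤ q.radius :=
    FormalMultilinearSeries.radius_le_of_le (fun n => norm_pointwiseMultilinear_le (p n))
  have hq0 : 0 < q.radius := (hp.r_pos.trans_le hp.r_le).trans_le hr
  have hq := q.hasFPowerSeriesOnBall hq0
  refine ⟨q.sum, ⟨q, _, hq⟩, ?_⟩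
  filter_upwards [Metric.eball_mem_nhds (0 : C(K, E)) hp.r_pos] with u hu t
  have hu' : u ∈ Metric.eball (0 : C(K, E)) q.radius :=
    Metric.eball_subset_eball (hp.r_le.trans hr) hu
  have h1 := hq.hasSum hu'
  have h2 := h1.mapL (ContinuousMap.evalCLM ℝ t)
  have hut : u t ∈ Metric.eball (0 : E) r := by
    rw [Metric.mem_eball, edist_zero_right] at hu ⊢
    refine lt_of_le_of_lt ?_ hu
    rw [enorm_le_iff_norm_le]
    exact u.norm_coe_le_norm t
  have h3 := hp.hasSum hut
  simp only [zero_add] at h2 h3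
  exact h2.unique h3

end Superposition

/-! ### Hadamard's lemma, in the analytic and in the finitely differentiable category. -/

section Hadamard

/-- Fundamental theorem of calculus on the segment from `z - r • e` (at `t = 0`) to `z` (at `t =
1`). The quotient by `r` is an integral that makes sense for `r = 0` too. -/
theorem sub_eq_mul_integral_fderiv {X : Type*} [NormedAddCommGroup X] [NormedSpace ℝ X]
    {f : X → ℝ} (z e : X) (r : ℝ)
    (hf : ∀ t ∈ Set.Icc (0 : ℝ) 1, ContDiffAt ℝ 1 f (z - ((1 - t) * r) • e)) :
    f z - f (z - r • e) = r * ∫ t in (0 : ℝ)..1, fderiv ℝ f (z - ((1 - t) * r) • e) e := by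
  have hd : ∀ t ∈ Set.uIcc (0 : ℝ) 1, HasDerivAt (fun t : ℝ => f (z - ((1 - t) * r) • e))
      (r * fderiv ℝ f (z - ((1 - t) * r) • e) e) t := by
    intro t ht
    rw [Set.uIcc_of_le zero_le_one] at ht
    have h1 : HasDerivAt (fun t : ℝ => z - ((1 - t) * r) • e) (r • e) t := by
      have : HasDerivAt (fun t : ℝ => (1 - t) * r) (-r) t := by
        simpa using ((hasDerivAt_id t).const_sub 1).mul_const r
      simpa using (this.smul_const e).const_sub z
    have h2 := ((hf t ht).differentiableAt one_ne_zero).hasFDerivAt.comp_hasDerivAt t h1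
    exact h2.congr_deriv (by simp)
  have hc : ContinuousOn (fun t : ℝ => r * fderiv ℝ f (z - ((1 - t) * r) • e) e)
      (Set.uIcc 0 1) := by
    intro t ht
    rw [Set.uIcc_of_le zero_le_one] at ht
    have h1 : ContinuousAt (fderiv ℝ f) (z - ((1 - t) * r) • e) :=
      (ContDiffAt.fderiv_right (m := 0) (hf t ht) (by simp)).continuousAt
    have h2 : ContinuousAt (fun t : ℝ => fderiv ℝ f (z - ((1 - t) * r) • e)) t :=
      ContinuousAt.comp (f := fun t : ℝ => z - ((1 - t) * r) • e) h1 (by fun_prop)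
    exact (continuousAt_const.mul (h2.clm_apply continuousAt_const)).continuousWithinAt
  have := intervalIntegral.integral_eq_sub_of_hasDerivAt hd hc.intervalIntegrable
  rw [intervalIntegral.integral_const_mul] at this
  rw [this]; simp

/-- The primitive of a continuous function on the unit interval that vanishes at `0`. -/
noncomputable def unitPrimitive (F : Type*) [NormedAddCommGroup F] [NormedSpace ℝ F] :
    C(unitInterval, F) →L[ℝ] C(unitInterval, F) :=
  LinearMap.mkContinuous
    { toFun := fun u => ⟨fun t => ∫ τ in (0 : ℝ)..t, u (Set.projIcc 0 1 zero_le_one τ), by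
        have h : Continuous fun τ : ℝ => u (Set.projIcc 0 1 zero_le_one τ) := by fun_prop
        exact (intervalIntegral.continuous_primitive (fun a b => h.intervalIntegrable a b) 0).comp
          continuous_subtype_val⟩
      map_add' := by
        intro u v
        ext t
        have h : ∀ u : C(unitInterval, F),
            Continuous fun τ : ℝ => u (Set.projIcc 0 1 zero_le_one τ) := by intro u; fun_prop
        simpa using intervalIntegral.integral_add ((h u).intervalIntegrable 0 t)
          ((h v).intervalIntegrable 0 t)
      map_smul' := by
        intro c u
        ext t
        simp [intervalIntegral.integral_smul] } 1 (by
      intro u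
      rw [ContinuousMap.norm_le _ (by positivity)]
      intro t
      have h := intervalIntegral.norm_integral_le_of_norm_le_const (a := 0) (b := (t : ℝ))
        (f := fun τ : ℝ => u (Set.projIcc 0 1 zero_le_one τ)) (C := ‖u‖)
        (fun x _ => u.norm_coe_le_norm _)
      refine h.trans ?_
      rw [sub_zero, abs_of_nonneg t.2.1, one_mul]
      exact mul_le_of_le_one_right (norm_nonneg _) t.2.2)

theorem unitPrimitive_apply {F : Type*} [NormedAddCommGroup F] [NormedSpace ℝ F]
    (u : C(unitInterval, F)) (t : unitInterval) :
    unitPrimitive F u t = ∫ τ in (0 : ℝ)..t, u (Set.projIcc 0 1 zero_le_one τ) := rfl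

/-- Hadamard's lemma for analytic functions. -/
theorem AnalyticAt.exists_slope {X : Type*} [NormedAddCommGroup X] [NormedSpace ℝ X]
    {f : X → ℝ} (hf : AnalyticAt ℝ f 0) (l : X →L[ℝ] ℝ) (e : X) :
    ∃ g : X → ℝ, AnalyticAt ℝ g 0 ∧ ∀ᶠ z in 𝓝 (0 : X), f z - f (z - l z • e) = l z * g z := by
  have hd : AnalyticAt ℝ (fun z => fderiv ℝ f z e) 0 :=
    ((ContinuousLinearMap.apply ℝ ℝ e).analyticAt _).comp hf.fderiv
  obtain ⟨Φ, hΦ, hΦe⟩ := hd.exists_superposition (K := unitInterval)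
  let L : X →L[ℝ] C(unitInterval, X) := LinearMap.mkContinuous
    { toFun := fun z => ⟨fun t => z - ((1 - (t : ℝ)) * l z) • e, by fun_prop⟩
      map_add' := by intro x y; ext t; simp [mul_add, add_smul]; abel
      map_smul' := by
        intro c x; ext t
        simp only [map_smul, smul_eq_mul, ContinuousMap.coe_mk, RingHom.id_apply,
          ContinuousMap.coe_smul, Pi.smul_apply, smul_sub, smul_smul]
        congr 2; ring } (1 + ‖l‖ * ‖e‖) (by
      intro z
      rw [ContinuousMap.norm_le _ (by positivity)]
      intro t
      refine (norm_sub_le _ _).trans ?_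
      rw [norm_smul, norm_mul]
      have h1 : ‖(1 - (t : ℝ))‖ ≤ 1 := by
        rw [Real.norm_eq_abs, abs_le]; constructor <;> linarith [t.2.1, t.2.2]
      have h2 := l.le_opNorm z
      calc ‖z‖ + ‖1 - (t : ℝ)‖ * ‖l z‖ * ‖e‖ ≤ ‖z‖ + 1 * (‖l‖ * ‖z‖) * ‖e‖ := by gcongr
        _ = _ := by ring)
  have hL : ∀ z t, L z t = z - ((1 - (t : ℝ)) * l z) • e := fun z t => rfl
  -- This is the integral of `fderiv ℝ f` along the segment. Written as a linear map after the
  -- superposition operator after the linear map `L`, it is visibly analytic in `z`.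
  let g : X → ℝ := fun z => unitPrimitive ℝ (Φ (L z)) 1
  refine ⟨g, ?_, ?_⟩
  · have h1 : AnalyticAt ℝ (fun z => Φ (L z)) 0 := by
      refine AnalyticAt.comp (g := Φ) (f := L) ?_ (L.analyticAt 0)
      simpa using hΦ
    exact (((ContinuousMap.evalCLM ℝ (1 : unitInterval)).comp
      (unitPrimitive ℝ)).analyticAt _).comp h1
  · have hL0 : Tendsto L (𝓝 0) (𝓝 0) := by simpa using L.continuous.tendsto 0
    obtain ⟨r, hr, hrf⟩ := Metric.eventually_nhds_iff_ball.1 hf.eventually_analyticAt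
    filter_upwards [hL0.eventually hΦe, hL0.eventually (Metric.ball_mem_nhds _ hr)] with z hz hzr
    rw [sub_eq_mul_integral_fderiv]
    · change _ = _ * unitPrimitive ℝ (Φ (L z)) 1
      rw [unitPrimitive_apply]
      congr 1
      simp only [Set.Icc.coe_one]
      refine intervalIntegral.integral_congr fun t ht => ?_
      rw [Set.uIcc_of_le zero_le_one] at ht
      simp only [hz, hL, Set.projIcc_of_mem zero_le_one ht]
    · intro t ht
      refine (hrf _ ?_).contDiffAt
      have h1 := (L z).norm_coe_le_norm ⟨t, ht⟩
      rw [dist_zero_right] at hzr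
      rw [mem_ball_zero_iff]
      exact lt_of_le_of_lt h1 hzr

/-- Differentiation under the integral sign. The target `F` is quantified inside the induction
because the derivative takes values in `X →L[ℝ] F`. -/
theorem contDiff_integral_of_contDiff {X : Type} [NormedAddCommGroup X] [NormedSpace ℝ X]
    [FiniteDimensional ℝ X] (n : ℕ) : ∀ {F : Type} [NormedAddCommGroup F] [NormedSpace ℝ F]
    [CompleteSpace F]
    {Φ : X × ℝ → F}, ContDiff ℝ n Φ → ContDiff ℝ n fun z => ∫ t in (0 : ℝ)..1, Φ (z, t) := by
  induction n with
  | zero =>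
    intro F _ _ _ Φ hΦ
    rw [Nat.cast_zero, contDiff_zero] at hΦ ⊢
    exact intervalIntegral.continuous_parametric_intervalIntegral_of_continuous'
      (f := fun z t => Φ (z, t)) hΦ 0 1
  | succ n ih =>
    intro F _ _ _ Φ hΦ
    have hc : Continuous Φ := hΦ.continuous
    let D : X × ℝ → (X →L[ℝ] F) := fun q => (fderiv ℝ Φ q).comp (.inl ℝ X ℝ)
    have hD : ContDiff ℝ n D := by
      have : ContDiff ℝ n (fderiv ℝ Φ) := hΦ.fderiv_right (by norm_cast)
      exact this.clm_comp contDiff_const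
    have hD' : ∀ z t, HasFDerivAt (fun z => Φ (z, t)) (D (z, t)) z := by
      intro z t
      have h1 : HasFDerivAt Φ (fderiv ℝ Φ (z, t)) (z, t) :=
        (hΦ.differentiable (by simp) _).hasFDerivAt
      exact h1.comp z (hasFDerivAt_prodMk_left z t)
    rw [show ((n + 1 : ℕ) : ℕ∞ω) = (n : ℕ∞ω) + 1 by norm_cast, contDiff_succ_iff_hasFDerivAt]
    · refine ⟨_, ih hD, fun z₀ => ?_⟩
      obtain ⟨C, hC⟩ := ((isCompact_closedBall z₀ 1).prod
        (isCompact_Icc (a := (0 : ℝ)) (b := 1))).exists_bound_of_continuousOn hD.continuous.continuousOn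
      refine (intervalIntegral.hasFDerivAt_integral_of_dominated_of_fderiv_le
        (F := fun z t => Φ (z, t)) (F' := fun z t => D (z, t)) (bound := fun _ => C)
        (s := Metric.closedBall z₀ 1) (Metric.closedBall_mem_nhds _ one_pos) ?_ ?_ ?_ ?_ ?_ ?_)
      · exact Eventually.of_forall fun z =>
          (show Continuous fun t => Φ (z, t) by fun_prop).aestronglyMeasurable
      · exact (show Continuous fun t => Φ (z₀, t) by fun_prop).intervalIntegrable _ _
      · have := hD.continuous
        exact (show Continuous fun t => D (z₀, t) by fun_prop).aestronglyMeasurable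
      · refine Eventually.of_forall fun t ht z hz => hC _ ⟨hz, ?_⟩
        rw [Set.uIoc_of_le zero_le_one] at ht
        exact Set.Ioc_subset_Icc_self ht
      · exact intervalIntegrable_const
      · exact Eventually.of_forall fun t _ z _ => hD' z t

/-- Hadamard's lemma for functions of class `C^(n+1)`. -/
theorem ContDiff.exists_slope {X : Type} [NormedAddCommGroup X] [NormedSpace ℝ X]
    [FiniteDimensional ℝ X] {f : X → ℝ} (l : X →L[ℝ] ℝ) (e : X) (hf : ContDiff ℝ 1 f) :
    ∃ g : X → ℝ, (∀ n : ℕ, ContDiff ℝ (n + 1) f → ContDiff ℝ n g) ∧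
      ∀ z, f z - f (z - l z • e) = l z * g z := by
  refine ⟨fun z => ∫ t in (0 : ℝ)..1, fderiv ℝ f (z - ((1 - t) * l z) • e) e, fun n hn => ?_,
    fun z => sub_eq_mul_integral_fderiv z e (l z) fun t _ => hf.contDiffAt⟩
  refine contDiff_integral_of_contDiff n
    (Φ := fun q : X × ℝ => fderiv ℝ f (q.1 - ((1 - q.2) * l q.1) • e) e) ?_
  have h1 : ContDiff ℝ n (fderiv ℝ f) := hn.fderiv_right le_rfl
  exact (h1.comp (by fun_prop)).clm_apply contDiff_const

/-- A function of class `C^n` near the origin coincides there with a globally `C^n` function. -/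
theorem ContDiffOn.exists_contDiff_eventuallyEq {X : Type*} [NormedAddCommGroup X] [NormedSpace ℝ X]
    [FiniteDimensional ℝ X] {n : ℕ∞} {f : X → ℝ} {U : Set X} (hU : U ∈ 𝓝 0)
    (hf : ContDiffOn ℝ n f U) : ∃ g : X → ℝ, ContDiff ℝ n g ∧ g =ᶠ[𝓝 0] f := by
  obtain ⟨r, hr, hrU⟩ := Metric.mem_nhds_iff.1 hU
  let b : ContDiffBump (0 : X) := ⟨r / 4, r / 2, by positivity, by linarith⟩
  refine ⟨fun x => b x * f x, ?_, ?_⟩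
  · rw [contDiff_iff_contDiffAt]
    intro x
    by_cases hx : x ∈ Metric.ball (0 : X) r
    · exact b.contDiffAt.mul (hf.contDiffAt (mem_of_superset (Metric.isOpen_ball.mem_nhds hx) hrU))
    · have hx' : x ∈ (Metric.closedBall (0 : X) (r / 2))ᶜ := by
        simp only [Metric.mem_ball, not_lt, Set.mem_compl_iff, Metric.mem_closedBall, not_le] at *
        linarith
      refine contDiffAt_const (c := (0 : ℝ)) |>.congr_of_eventuallyEq ?_
      filter_upwards [Metric.isClosed_closedBall.isOpen_compl.mem_nhds hx'] with y hy
      rw [b.zero_of_le_dist, zero_mul]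
      simpa [b] using le_of_lt (by simpa using hy : r / 2 < ‖y‖)
  · filter_upwards [b.eventuallyEq_one] with x hx
    rw [hx]; simp

end Hadamard

/-! ### Smooth germs in one variable: jets, flatness, monomial equivalents. -/

section OneVariable

theorem ContDiffAt.exists_contDiff_eventuallyEq {u : ℝ → ℝ} {n : ℕ} (hu : ContDiffAt ℝ n u 0) :
    ∃ g : ℝ → ℝ, ContDiff ℝ n g ∧ g =ᶠ[𝓝 0] u := by
  obtain ⟨U, hU, hUu⟩ := hu.contDiffOn le_rfl (by simp)
  exact ContDiffOn.exists_contDiff_eventuallyEq (n := n) (by simpa using hU) hUu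

theorem ContDiffAt.sub_jet_isLittleO {u : ℝ → ℝ} (hu : ContDiffAt ℝ ∞ u 0) (k : ℕ) :
    (fun x => u x - jet k u x) =o[𝓝 0] fun x => x ^ k := by
  obtain ⟨g, hg, hgu⟩ := (contDiffAt_infty.1 hu k).exists_contDiff_eventuallyEq
  have h := taylor_isLittleO_univ (x₀ := 0) hg
  simp only [sub_zero] at h
  refine h.congr' ?_ EventuallyEq.rfl
  filter_upwards [hgu] with x hx
  rw [hx, taylor_within_apply, jet]
  congr 1
  refine Finset.sum_congr rfl fun i _ => ?_
  rw [iteratedDerivWithin_univ, hgu.iteratedDeriv_eq, sub_zero, smul_eq_mul]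
  ring

/-- Hadamard's lemma loses one derivative, so each finite order `n` is obtained from a
representative of class `C^(n+1)`. -/
theorem ContDiffAt.dslope_zero {u : ℝ → ℝ} (hu : ContDiffAt ℝ ∞ u 0) :
    ContDiffAt ℝ ∞ (dslope u 0) 0 := by
  rw [contDiffAt_infty]
  intro n
  obtain ⟨g, hg, hgu⟩ := (contDiffAt_infty.1 hu (n + 1)).exists_contDiff_eventuallyEq
  obtain ⟨q, hq, hgq⟩ := (hg.of_le (by norm_cast; omega)).exists_slope
    (ContinuousLinearMap.id ℝ ℝ) 1
  have hqn := hq n (by exact_mod_cast hg)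
  simp only [ContinuousLinearMap.coe_id', id_eq, smul_eq_mul, mul_one, sub_self] at hgq
  have hd : HasDerivAt g (q 0) 0 := by
    rw [hasDerivAt_iff_tendsto_slope]
    refine (hqn.continuous.tendsto 0).mono_left nhdsWithin_le_nhds |>.congr' ?_
    filter_upwards [self_mem_nhdsWithin] with z hz
    have hz : z ≠ 0 := hz
    rw [slope_def_field, hgq, sub_zero, mul_div_cancel_left₀ _ hz]
  refine hqn.contDiffAt.congr_of_eventuallyEq ?_
  filter_upwards [hgu] with z hz
  by_cases h0 : z = 0
  · subst h0
    rw [dslope_same, ← hgu.deriv_eq, hd.deriv]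
  · rw [dslope_of_ne _ h0, slope_def_field, ← hz, ← hgu.eq_of_nhds, hgq, sub_zero,
      mul_div_cancel_left₀ _ h0]

theorem jet_eq_of_forall_lt_eq_zero {u : ℝ → ℝ} {k : ℕ} (h : ∀ i < k, iteratedDeriv i u 0 = 0)
    (x : ℝ) : jet k u x = iteratedDeriv k u 0 / (Nat.factorial k : ℝ) * x ^ k := by
  rw [jet, Finset.sum_range_succ, Finset.sum_eq_zero, zero_add]
  intro i hi
  rw [h i (Finset.mem_range.1 hi)]; simp

theorem ContDiffAt.tendsto_div_pow {u : ℝ → ℝ} (hu : ContDiffAt ℝ ∞ u 0) {k : ℕ}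
    (h : ∀ i < k, iteratedDeriv i u 0 = 0) :
    Tendsto (fun x => u x / x ^ k) (𝓝[≠] 0)
      (𝓝 (iteratedDeriv k u 0 / (Nat.factorial k : ℝ))) := by
  have h1 := ((hu.sub_jet_isLittleO k).mono (nhdsWithin_le_nhds (s := {0}ᶜ))).tendsto_div_nhds_zero
  have h2 := h1.add_const (iteratedDeriv k u 0 / (Nat.factorial k : ℝ))
  rw [zero_add] at h2
  refine h2.congr' ?_
  filter_upwards [self_mem_nhdsWithin] with x hx
  have hx : x ≠ 0 := hx
  rw [jet_eq_of_forall_lt_eq_zero h]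
  field_simp
  ring

theorem ContDiffAt.isBigO_pow_iff {u : ℝ → ℝ} (hu : ContDiffAt ℝ ∞ u 0) :
    (∀ n : ℕ, u =O[𝓝[≠] 0] fun x => x ^ n) ↔ ∀ n : ℕ, iteratedDeriv n u 0 = 0 := by
  constructor
  · intro h n
    induction n using Nat.strong_induction_on with
    | _ n ih =>
    have h1 := hu.tendsto_div_pow ih
    have h2 : Tendsto (fun x => u x / x ^ n) (𝓝[≠] 0) (𝓝 0) := by
      refine Asymptotics.IsLittleO.tendsto_div_nhds_zero ((h (n + 1)).trans_isLittleO ?_)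
      have h3 : (fun x : ℝ => x ^ (n + 1)) =o[𝓝 0] fun x : ℝ => x ^ n :=
        Asymptotics.isLittleO_pow_pow (by omega)
      exact h3.mono nhdsWithin_le_nhds
    have := tendsto_nhds_unique h1 h2
    have hn : (Nat.factorial n : ℝ) ≠ 0 := by positivity
    field_simp at this
    simpa using this
  · intro h n
    have h1 := ((hu.sub_jet_isLittleO n).mono (nhdsWithin_le_nhds (s := {0}ᶜ))).isBigO
    refine h1.congr_left fun x => ?_
    rw [jet_eq_of_forall_lt_eq_zero fun i _ => h i, h n]; simp

/-- A smooth germ is either flat or equivalent to a monomial. -/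
theorem ContDiffAt.flat_or_exists_tendsto {u : ℝ → ℝ} (hu : ContDiffAt ℝ ∞ u 0) :
    (∀ n : ℕ, iteratedDeriv n u 0 = 0) ∨
      ∃ (d : ℕ) (s : ℝ), s ≠ 0 ∧ Tendsto (fun x => u x / x ^ d) (𝓝[≠] 0) (𝓝 s) := by
  by_cases h : ∀ n : ℕ, iteratedDeriv n u 0 = 0
  · exact Or.inl h
  · push Not at h
    classical
    refine Or.inr ⟨Nat.find h, _, ?_, hu.tendsto_div_pow fun i hi => not_not.1 (Nat.find_min h hi)⟩
    exact div_ne_zero (Nat.find_spec h) (by positivity)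

/-- As long as a factor `x` remains on the right, the value of the polynomial at `0` is a limit
equal to `0`, so `X` can be split off once more. -/
theorem Polynomial.exists_eq_X_pow_mul_of_eventuallyEq (N : ℕ) : ∀ {P : Polynomial ℝ} {w : ℝ → ℝ}
    {s : ℝ}, (∀ᶠ x in 𝓝[≠] (0 : ℝ), P.eval x = x ^ N * w x) → Tendsto w (𝓝[≠] 0) (𝓝 s) →
    ∃ R : Polynomial ℝ, P = Polynomial.X ^ N * R ∧ R.eval 0 = s := by
  have key : ∀ {P : Polynomial ℝ} {w : ℝ → ℝ} {s : ℝ},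
      (∀ᶠ x in 𝓝[≠] (0 : ℝ), P.eval x = w x) → Tendsto w (𝓝[≠] 0) (𝓝 s) → P.eval 0 = s := by
    intro P w s h hw
    have h1 : Tendsto (fun x => P.eval x) (𝓝[≠] (0 : ℝ)) (𝓝 (P.eval 0)) :=
      (P.continuous.tendsto 0).mono_left nhdsWithin_le_nhds
    exact tendsto_nhds_unique (h1.congr' h) hw
  induction N with
  | zero =>
    intro P w s h hw
    exact ⟨P, by simp, key (by simpa using h) hw⟩
  | succ N ih =>
    intro P w s h hw
    have hx : Tendsto (fun x : ℝ => x) (𝓝[≠] 0) (𝓝 0) := tendsto_id.mono_left nhdsWithin_le_nhds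
    obtain ⟨R, hR, hR0⟩ := ih (w := fun x => x * w x) (s := 0)
      (by filter_upwards [h] with x hx; rw [hx]; ring) (by simpa using hx.mul hw)
    obtain ⟨Q, hQ⟩ := (Polynomial.X_dvd_iff (f := R)).2
      (by rw [Polynomial.coeff_zero_eq_eval_zero, hR0])
    refine ⟨Q, by rw [hR, hQ]; ring, key (w := w) ?_ hw⟩
    filter_upwards [h, self_mem_nhdsWithin] with x hx hx0
    have hx0 : x ≠ 0 := hx0
    rw [hR, hQ] at hx
    simp only [Polynomial.eval_mul, Polynomial.eval_pow, Polynomial.eval_X] at hx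
    have : x ^ (N + 1) * Q.eval x = x ^ (N + 1) * w x := by rw [← hx]; ring
    exact mul_left_cancel₀ (pow_ne_zero _ hx0) this

end OneVariable

/-! ### Finite differences: bounding a value by values at shifted points. -/

section Differences

/-- One difference of step `h` is `h` times a slope by Hadamard's lemma, at the cost of one
derivative. The slope depends on `h`, so the induction needs functions that depend on the step. -/
theorem ContDiff.exists_fwdDiff_eq {X : Type} [NormedAddCommGroup X] [NormedSpace ℝ X]
    [FiniteDimensional ℝ X] (e : X) (k : ℕ) : ∀ {f : X × ℝ → ℝ}, ContDiff ℝ k f →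
    ∃ q : X × ℝ → ℝ, Continuous q ∧
      ∀ z h, (fwdDiff (h • e))^[k] (fun z => f (z, h)) z = h ^ k * q (z, h) := by
  induction k with
  | zero => intro f hf; exact ⟨f, hf.continuous, by simp⟩
  | succ k ih =>
    intro f hf
    have hF : ContDiff ℝ (k + 1 : ℕ) fun v : (X × ℝ) × ℝ => f (v.1.1 + v.2 • e, v.1.2) :=
      hf.comp (by fun_prop)
    obtain ⟨g, hg, hfg⟩ := (hF.of_le (m := 1) (by norm_cast; omega)).exists_slope
      (ContinuousLinearMap.snd ℝ (X × ℝ) ℝ) (((0 : X × ℝ), (1 : ℝ)))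
    obtain ⟨q, hq, hgq⟩ := ih (f := fun v => g (v, v.2))
      ((hg k (by exact_mod_cast hF)).comp (by fun_prop))
    refine ⟨q, hq, fun z h => ?_⟩
    have h1 : fwdDiff (h • e) (fun z => f (z, h)) = h • fun z => g ((z, h), h) := by
      ext z
      have := hfg ((z, h), h)
      simp at this
      simpa [fwdDiff] using this
    rw [Function.iterate_succ_apply, h1, fwdDiff_iter_const_smul, Pi.smul_apply, hgq, smul_eq_mul]
    ring

/-- A smooth function is bounded at a point by a power of the step `h` plus its values at the
next points of an arithmetic progression of step `h`. -/
theorem ContDiff.exists_abs_le_sum_shift {X : Type} [NormedAddCommGroup X] [NormedSpace ℝ X]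
    [FiniteDimensional ℝ X] (e : X) (k : ℕ) {f : X → ℝ} (hf : ContDiff ℝ k f) :
    ∃ C, ∀ᶠ v in 𝓝 (0 : X × ℝ), ∀ B, 0 ≤ B →
      (∀ j : ℕ, 1 ≤ j → j ≤ k → |f (v.1 + ((j : ℝ) * v.2) • e)| ≤ B) →
      |f v.1| ≤ C * |v.2| ^ k + 2 ^ k * B := by
  obtain ⟨q, hq, hfq⟩ := ContDiff.exists_fwdDiff_eq e k (f := fun v => f v.1) (hf.comp contDiff_fst)
  refine ⟨|q 0| + 1, ?_⟩
  have h1 : ∀ᶠ v in 𝓝 (0 : X × ℝ), |q v| < |q 0| + 1 :=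
    (hq.abs.tendsto 0).eventually (gt_mem_nhds (by linarith))
  filter_upwards [h1] with ⟨z, h⟩ hv B hB0 hB
  have h2 := hfq z h
  -- In the binomial expansion of the `k`-th difference the unshifted value has coefficient
  -- `(-1)^k`; the coefficients of the others have absolute values summing to at most `2^k`.
  rw [fwdDiff_iter_eq_sum_shift, Finset.sum_range_succ'] at h2
  simp only [zero_smul, add_zero, Nat.choose_zero_right, Nat.cast_one, mul_one, Nat.sub_zero,
    zsmul_eq_mul, Int.cast_pow, Int.cast_neg, Int.cast_one, Int.cast_mul, Int.cast_natCast] at h2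
  set S := ∑ x ∈ Finset.range k,
    (-1 : ℝ) ^ (k - (x + 1)) * (k.choose (x + 1)) * f (z + (x + 1) • h • e) with hS
  have h3 : |S| ≤ 2 ^ k * B := by
    calc |S| ≤ ∑ x ∈ Finset.range k, (k.choose (x + 1) : ℝ) * B := by
          refine (Finset.abs_sum_le_sum_abs _ _).trans (Finset.sum_le_sum fun i hi => ?_)
          rw [abs_mul, abs_mul, abs_pow, abs_neg, abs_one, one_pow, one_mul, Nat.abs_cast]
          gcongr
          have := hB (i + 1) (by omega) (by have := Finset.mem_range.1 hi; omega)
          rwa [mul_smul, Nat.cast_smul_eq_nsmul ℝ] at this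
      _ = (∑ x ∈ Finset.range k, (k.choose (x + 1) : ℝ)) * B := by rw [Finset.sum_mul]
      _ ≤ 2 ^ k * B := by
          gcongr
          have := Finset.sum_range_succ' (fun x => (k.choose x : ℝ)) k
          have h4 : ∑ x ∈ Finset.range (k + 1), (k.choose x : ℝ) = 2 ^ k := by
            exact_mod_cast Nat.sum_range_choose k
          rw [h4] at this
          simp at this
          linarith
  have h5 : |f z| = |(-1 : ℝ) ^ k * f z| := by simp [abs_mul]
  have h6 : (-1 : ℝ) ^ k * f z = h ^ k * q (z, h) - S := by rw [← h2]; ring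
  rw [h5, h6]
  calc |h ^ k * q (z, h) - S| ≤ |h ^ k * q (z, h)| + |S| := abs_sub _ _
    _ ≤ (|q 0| + 1) * |h| ^ k + 2 ^ k * B := by
      rw [abs_mul, abs_pow, mul_comm]
      gcongr

theorem ContDiffAt.exists_abs_le_sum_shift {X : Type} [NormedAddCommGroup X] [NormedSpace ℝ X]
    [FiniteDimensional ℝ X] (e : X) (k : ℕ) {f : X → ℝ} (hf : ContDiffAt ℝ k f 0) :
    ∃ C, ∀ᶠ v in 𝓝 (0 : X × ℝ), ∀ B, 0 ≤ B →
      (∀ j : ℕ, 1 ≤ j → j ≤ k → |f (v.1 + ((j : ℝ) * v.2) • e)| ≤ B) →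
      |f v.1| ≤ C * |v.2| ^ k + 2 ^ k * B := by
  obtain ⟨U, hU, hUf⟩ := hf.contDiffOn le_rfl (by simp)
  obtain ⟨g, hg, hgf⟩ := ContDiffOn.exists_contDiff_eventuallyEq (n := k) (by simpa using hU) hUf
  obtain ⟨C, hC⟩ := ContDiff.exists_abs_le_sum_shift e k (f := g) hg
  refine ⟨C, ?_⟩
  have h1 : ∀ j : ℕ, ∀ᶠ v in 𝓝 (0 : X × ℝ),
      g (v.1 + ((j : ℝ) * v.2) • e) = f (v.1 + ((j : ℝ) * v.2) • e) := fun j =>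
    (Continuous.tendsto' (by fun_prop) _ _ (by simp)).eventually hgf
  have h2 := (Finset.eventually_all (Finset.range (k + 1))).2 fun j _ => h1 j
  filter_upwards [hC, h2] with v hv hv2 B hB0 hB
  have h0 := hv2 0 (by simp)
  simp only [Nat.cast_zero, zero_mul, zero_smul, add_zero] at h0
  rw [← h0]
  refine hv B hB0 fun j hj hjk => ?_
  rw [hv2 j (Finset.mem_range.2 (by omega))]
  exact hB j hj hjk

end Differences

/-! ### Implicit functions and a lower Lipschitz bound in the unknown. -/

section Implicit

/-- The implicit function theorem for one scalar equation in one scalar unknown. -/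
theorem ContDiffAt.exists_implicit {X : Type*} [NormedAddCommGroup X] [NormedSpace ℝ X]
    [CompleteSpace X] {n : ℕ∞ω} (hn : n ≠ 0) {f : X × ℝ → ℝ} {u : X × ℝ} (hf : ContDiffAt ℝ n f u)
    (h0 : f u = 0) (hd : fderiv ℝ f u (0, 1) ≠ 0) :
    ∃ h : X → ℝ, ContDiffAt ℝ n h u.1 ∧ h u.1 = u.2 ∧ (∀ᶠ x in 𝓝 u.1, f (x, h x) = 0) ∧
      ∀ᶠ v in 𝓝 u, f v = 0 → h v.1 = v.2 := by
  have hinv : (fderiv ℝ f u ∘L .inr ℝ X ℝ).IsInvertible := by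
    refine ContinuousLinearMap.IsInvertible.of_inverse
      (g := (fderiv ℝ f u (0, 1))⁻¹ • ContinuousLinearMap.id ℝ ℝ) ?_ ?_
    · ext; simp [hd]
    · ext; simp [hd]
  refine ⟨hf.implicitFunction hn hinv, hf.contDiffAt_implicitFunction hn hinv,
    hf.implicitFunction_apply_self hn hinv, ?_, ?_⟩
  · simpa [h0] using hf.eventually_apply_implicitFunction hn hinv
  · filter_upwards [hf.eventually_apply_eq_iff_implicitFunction hn hinv] with v hv hv0
    exact hv.1 (hv0.trans h0.symm)

/-- Strict differentiability makes the increment in the last variable comparable to its linear part.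
This later converts a small residual of an equation into closeness to its solution. -/
theorem HasStrictFDerivAt.exists_le_abs_sub {X : Type*} [NormedAddCommGroup X] [NormedSpace ℝ X]
    {f : X × ℝ → ℝ} {u : X × ℝ} {f' : X × ℝ →L[ℝ] ℝ} (hf : HasStrictFDerivAt f f' u)
    (hd : f' (0, 1) ≠ 0) :
    ∃ c > 0, ∀ᶠ v in 𝓝 (u.1, u.2, u.2), c * |v.2.1 - v.2.2| ≤ |f (v.1, v.2.1) - f (v.1, v.2.2)| := by
  have hc : 0 < |f' (0, 1)| / 2 := by positivity
  refine ⟨_, hc, ?_⟩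
  have h1 := hf.isLittleO.def hc
  have h2 : Tendsto (fun v : X × ℝ × ℝ => ((v.1, v.2.1), (v.1, v.2.2))) (𝓝 (u.1, u.2, u.2))
      (𝓝 (u, u)) :=
    (show Continuous fun v : X × ℝ × ℝ => ((v.1, v.2.1), (v.1, v.2.2)) by fun_prop).tendsto' _ _ rfl
  filter_upwards [h2.eventually h1] with v hv
  have h3 : ((v.1, v.2.1) : X × ℝ) - (v.1, v.2.2) = (v.2.1 - v.2.2) • ((0 : X), (1 : ℝ)) := by
    ext <;> simp
  simp only [h3, map_smul, smul_eq_mul, norm_smul, Real.norm_eq_abs, Prod.norm_mk, norm_zero,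
    abs_one] at hv
  have h4 : |(v.2.1 - v.2.2) * f' (0, 1)| - |f (v.1, v.2.1) - f (v.1, v.2.2)| ≤
      |f (v.1, v.2.1) - f (v.1, v.2.2) - (v.2.1 - v.2.2) * f' (0, 1)| := by
    rw [abs_sub_comm (f (v.1, v.2.1) - f (v.1, v.2.2))]
    exact abs_sub_abs_le_abs_sub _ _
  rw [abs_mul] at h4
  simp at hv
  nlinarith

end Implicit

/-! ### The differential equation: analytic dependence of `H(z + z^(p+1) s)` on `z`, `s`, `H(z)`. -/

section Flow

/-- The right-hand side of the equation satisfied by `s ↦ H (z + z^(p+1) s)`. -/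
noncomputable def rescaledField {r : ℕ} (p : ℕ) (A : ℝ × (Fin r → ℝ) → Fin r → ℝ)
    (q : ℝ × ℝ × (Fin r → ℝ)) : Fin r → ℝ :=
  ((1 + q.1 ^ p * q.2.1) ^ (p + 1))⁻¹ • A (q.1 + q.1 ^ (p + 1) * q.2.1, q.2.2)

theorem analyticAt_rescaledField {r p : ℕ} {A : ℝ × (Fin r → ℝ) → Fin r → ℝ}
    (hA : AnalyticAt ℝ A 0) : AnalyticAt ℝ (rescaledField p A) 0 := by
  have h1 : AnalyticAt ℝ (fun q : ℝ × ℝ × (Fin r → ℝ) => ((1 + q.1 ^ p * q.2.1) ^ (p + 1))⁻¹) 0 := by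
    refine AnalyticAt.inv (show ContDiff ℝ ω fun q : ℝ × ℝ × (Fin r → ℝ) =>
      (1 + q.1 ^ p * q.2.1) ^ (p + 1) by fun_prop).contDiffAt.analyticAt ?_
   
    simp
  refine h1.smul (AnalyticAt.comp_of_eq (g := A)
    (f := fun q : ℝ × ℝ × (Fin r → ℝ) => (q.1 + q.1 ^ (p + 1) * q.2.1, q.2.2)) hA
    (ContDiff.contDiffAt (n := ω) (by fun_prop)).analyticAt ?_)
  simp

/-- The curve `t ↦ (z, s t, η + u t)`, linear in `(z, s, η, u)`. -/
noncomputable def flowCurve (V : Type*) [NormedAddCommGroup V] [NormedSpace ℝ V] :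
    (ℝ × ℝ × V) × C(unitInterval, V) →L[ℝ] C(unitInterval, ℝ × ℝ × V) :=
  LinearMap.mkContinuous
    { toFun := fun v => ⟨fun t => (v.1.1, v.1.2.1 * t, v.1.2.2 + v.2 t), by fun_prop⟩
      map_add' := by
        intro v w; ext t <;> simp
        · ring
        · abel
      map_smul' := by
        intro c v; ext t <;> simp
        · ring } 2 (by
      intro v
      rw [ContinuousMap.norm_le _ (by positivity)]
      intro t
      have h1 : ‖v.1‖ ≤ ‖v‖ := norm_fst_le v
      have h2 : ‖v.2‖ ≤ ‖v‖ := norm_snd_le v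
      have h3 : ‖v.1.1‖ ≤ ‖v.1‖ := norm_fst_le v.1
      have h4 : ‖v.1.2‖ ≤ ‖v.1‖ := norm_snd_le v.1
      have h5 : ‖v.1.2.1‖ ≤ ‖v.1.2‖ := norm_fst_le v.1.2
      have h6 : ‖v.1.2.2‖ ≤ ‖v.1.2‖ := norm_snd_le v.1.2
      have h7 : ‖v.2 t‖ ≤ ‖v.2‖ := v.2.norm_coe_le_norm t
      have h8 : ‖(t : ℝ)‖ ≤ 1 := by rw [Real.norm_of_nonneg t.2.1]; exact t.2.2
      have h9 : 0 ≤ ‖v‖ := norm_nonneg v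
      refine norm_prod_le_iff.2 ⟨?_, norm_prod_le_iff.2 ⟨?_, ?_⟩⟩ <;>
        simp only [LinearMap.coe_mk, AddHom.coe_mk, ContinuousMap.coe_mk]
      · linarith
      · rw [norm_mul]
        have := mul_le_mul_of_nonneg_left h8 (norm_nonneg v.1.2.1)
        linarith
      · refine (norm_add_le _ _).trans (by linarith))

theorem flowCurve_apply {V : Type*} [NormedAddCommGroup V] [NormedSpace ℝ V]
    (v : (ℝ × ℝ × V) × C(unitInterval, V)) (t : unitInterval) :
    flowCurve V v t = (v.1.1, v.1.2.1 * t, v.1.2.2 + v.2 t) := rfl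

/-- If `x^(p+1) H' = A(x, H)`, then `H (z + z^(p+1) s)` is an analytic function of `z`, `s` and
`H z`. -/
theorem exists_analytic_flow {r p : ℕ} {A : ℝ × (Fin r → ℝ) → Fin r → ℝ}
    (hA : AnalyticAt ℝ A 0) {H H' : ℝ → Fin r → ℝ} (hH0 : H 0 = 0)
    (hd : ∀ᶠ x in 𝓝 (0 : ℝ), HasDerivAt H (H' x) x)
    (hode : ∀ᶠ x in 𝓝 (0 : ℝ), x ^ (p + 1) • H' x = A (x, H x)) :
    ∃ F : ℝ × ℝ × (Fin r → ℝ) → Fin r → ℝ, AnalyticAt ℝ F 0 ∧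
      ∀ᶠ q in 𝓝 (0 : ℝ × ℝ), H (q.1 + q.1 ^ (p + 1) * q.2) = F (q.1, q.2, H q.1) := by
  obtain ⟨Φ, hΦ, hΦe⟩ := (analyticAt_rescaledField (p := p) hA).exists_superposition (K := unitInterval)
  let Ψ : (ℝ × ℝ × (Fin r → ℝ)) × C(unitInterval, (Fin r → ℝ)) → C(unitInterval, (Fin r → ℝ)) :=
    fun v => unitPrimitive (Fin r → ℝ) (Φ (flowCurve (Fin r → ℝ) v))
  have hΨ : AnalyticAt ℝ Ψ 0 := by
    have h1 : AnalyticAt ℝ (fun v => Φ (flowCurve (Fin r → ℝ) v)) 0 :=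
      AnalyticAt.comp_of_eq (g := Φ) (f := flowCurve (Fin r → ℝ)) hΦ ((flowCurve (Fin r → ℝ)).analyticAt 0) (map_zero _)
    exact ((unitPrimitive (Fin r → ℝ)).analyticAt _).comp h1
  -- With `η = H(z)`, the path `u(t) = H(z + z^(p+1) s t) - η` solves the integral equation `u = s ∫
  -- field(z, sτ, η + u(τ)) dτ`, that is `G = 0`. Since `s = 0` at the base point, the derivative of
  -- `G` in `u` is there the identity, and the analytic implicit function theorem applies.
  let G : (ℝ × ℝ × (Fin r → ℝ)) × C(unitInterval, (Fin r → ℝ)) → C(unitInterval, (Fin r → ℝ)) := fun v => v.2 - v.1.2.1 • Ψ v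
  have hG : ContDiffAt ℝ ω G 0 := by
    refine AnalyticAt.contDiffAt ?_
    exact analyticAt_snd.sub (AnalyticAt.smul
      (show ContDiff ℝ ω fun v : (ℝ × ℝ × (Fin r → ℝ)) × C(unitInterval, (Fin r → ℝ)) =>
        v.1.2.1 by fun_prop).contDiffAt.analyticAt hΨ)
  have hG0 : G 0 = 0 := by simp [G]
  have hinv : (fderiv ℝ G 0 ∘L .inr ℝ (ℝ × ℝ × (Fin r → ℝ)) C(unitInterval, (Fin r → ℝ))).IsInvertible := by
    have h1 : HasFDerivAt G _ 0 := (hasFDerivAt_snd (𝕜 := ℝ)).sub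
      ((((ContinuousLinearMap.fst ℝ ℝ (Fin r → ℝ)).comp (ContinuousLinearMap.snd ℝ ℝ (ℝ × (Fin r → ℝ)))).comp
        (ContinuousLinearMap.fst ℝ (ℝ × ℝ × (Fin r → ℝ)) C(unitInterval, (Fin r → ℝ)))).hasFDerivAt.smul
        hΨ.differentiableAt.hasFDerivAt)
    rw [h1.fderiv]
    refine ContinuousLinearMap.IsInvertible.of_inverse (g := ContinuousLinearMap.id ℝ _) ?_ ?_
    · ext; simp
    · ext; simp
  let u₀ := hG.implicitFunction (by simp) hinv
  have hu₀ : ContDiffAt ℝ ω u₀ 0 := hG.contDiffAt_implicitFunction (by simp) hinv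
  have hu₀u := hG.eventually_apply_eq_iff_implicitFunction (by simp) hinv
  refine ⟨fun q => q.2.2 + u₀ q 1, ?_, ?_⟩
  · have h1 := ((ContinuousMap.evalCLM ℝ (1 : unitInterval)).analyticAt (u₀ 0)).comp hu₀.analyticAt
    exact AnalyticAt.add (show ContDiff ℝ ω fun q : ℝ × ℝ × (Fin r → ℝ) => q.2.2 by
      fun_prop).contDiffAt.analyticAt h1
  have hL0 : Tendsto (flowCurve (Fin r → ℝ)) (𝓝 0) (𝓝 0) := by
    simpa using (flowCurve (Fin r → ℝ)).continuous.tendsto 0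
  obtain ⟨ρ, hρ, hρG⟩ := Metric.eventually_nhds_iff_ball.1 (hu₀u.and (hL0.eventually hΦe))
  have hHc : ContinuousAt H 0 := hd.self_of_nhds.continuousAt
  have hsmall : ∀ᶠ x in 𝓝 (0 : ℝ), ‖H x‖ < ρ / 4 := by
    have := hHc.norm.tendsto
    rw [hH0, norm_zero] at this
    exact this.eventually (gt_mem_nhds (by positivity))
  obtain ⟨δ, hδ, hδH⟩ := Metric.eventually_nhds_iff_ball.1 (hd.and (hode.and hsmall))
  have hδ' : ∀ᶠ q in 𝓝 (0 : ℝ × ℝ), ∀ t : ℝ, t ∈ Set.Icc (0 : ℝ) 1 →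
      q.1 + q.1 ^ (p + 1) * (q.2 * t) ∈ Metric.ball (0 : ℝ) δ ∧ 0 < 1 + q.1 ^ p * (q.2 * t) := by
    have h1 : Tendsto (fun q : ℝ × ℝ => |q.1| + |q.1| ^ (p + 1) * |q.2|) (𝓝 0) (𝓝 0) :=
      Continuous.tendsto' (by fun_prop) _ _ (by simp)
    have h2 : Tendsto (fun q : ℝ × ℝ => |q.1| ^ p * |q.2|) (𝓝 0) (𝓝 0) :=
      Continuous.tendsto' (by fun_prop) _ _ (by simp)
    filter_upwards [h1.eventually (gt_mem_nhds hδ), h2.eventually (gt_mem_nhds one_pos)]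
      with q hq1 hq2 t ht
    have h3 : |q.2 * t| ≤ |q.2| := by
      rw [abs_mul, abs_of_nonneg ht.1]
      exact mul_le_of_le_one_right (abs_nonneg _) ht.2
    constructor
    · rw [mem_ball_zero_iff, Real.norm_eq_abs]
      refine ((abs_add_le _ _).trans ?_).trans_lt hq1
      rw [abs_mul, abs_pow]; gcongr
    · have h4 : |q.1 ^ p * (q.2 * t)| ≤ |q.1| ^ p * |q.2| := by
        rw [abs_mul, abs_pow]; gcongr
      have := (abs_le.1 h4).1
      linarith
  have hzs : ∀ᶠ q in 𝓝 (0 : ℝ × ℝ), ‖q‖ < ρ := by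
    have : Tendsto (fun q : ℝ × ℝ => ‖q‖) (𝓝 0) (𝓝 0) := Continuous.tendsto' (by fun_prop) _ _ (by simp)
    exact this.eventually (gt_mem_nhds hρ)
  filter_upwards [hδ', hzs] with q hq hqρ
  obtain ⟨z, s⟩ := q
  simp only at hq ⊢
  let y : ℝ → (Fin r → ℝ) := fun t => H (z + z ^ (p + 1) * (s * t))
  have hz : z ∈ Metric.ball (0 : ℝ) δ := by simpa using (hq 0 (by simp)).1
  have hy : ∀ t ∈ Set.Icc (0 : ℝ) 1, HasDerivAt y (s • rescaledField p A (z, s * t, y t)) t := by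
    intro t ht
    obtain ⟨hb, hpos⟩ := hq t ht
    obtain ⟨hd1, ho1, -⟩ := hδH _ hb
    have h1 : HasDerivAt (fun t : ℝ => z + z ^ (p + 1) * (s * t)) (z ^ (p + 1) * s) t := by
      simpa using ((((hasDerivAt_id t).const_mul s).const_mul (z ^ (p + 1))).const_add z)
    refine (HasDerivAt.scomp t hd1 h1).congr_deriv ?_
    have h2 : (1 + z ^ p * (s * t)) ^ (p + 1) ≠ 0 := pow_ne_zero _ hpos.ne'
    simp only [rescaledField, y]
    rw [← ho1, mul_comm (z ^ (p + 1)) s, mul_smul]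
    congr 1
    rw [smul_smul]
    congr 1
    -- The singular factor of the equation at the moved point is `z^(p+1)` times a unit, and
    -- `z^(p+1)` cancels against the speed of the path. The rescaled equation is regular even at `z
    -- = 0`.
    rw [show z + z ^ (p + 1) * (s * t) = z * (1 + z ^ p * (s * t)) by ring, mul_pow,
      mul_left_comm, inv_mul_cancel₀ h2, mul_one]
  let u : C(unitInterval, (Fin r → ℝ)) := ⟨fun t => y t - H z, by
    refine Continuous.sub ?_ continuous_const
    rw [continuous_iff_continuousAt]
    intro t
    exact (hy t t.2).continuousAt.comp continuous_subtype_val.continuousAt⟩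
  have hu : ∀ t, u t = y t - H z := fun t => rfl
  have hun : ‖u‖ ≤ ρ / 2 := by
    rw [ContinuousMap.norm_le _ (by positivity)]
    intro t
    have h1 := (hδH _ (hq t t.2).1).2.2
    have h2 := (hδH _ hz).2.2
    refine (norm_sub_le _ _).trans ?_
    simp only [y]
    linarith
  have hv : (((z, s, H z), u) : (ℝ × ℝ × (Fin r → ℝ)) × C(unitInterval, (Fin r → ℝ))) ∈ Metric.ball 0 ρ := by
    rw [mem_ball_zero_iff]
    have h2 := (hδH _ hz).2.2
    simp only [Prod.norm_mk, max_lt_iff] at hqρ ⊢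
    exact ⟨⟨hqρ.1, hqρ.2, by linarith⟩, by linarith⟩
  obtain ⟨hv1, hv2⟩ := hρG _ hv
  have hGv : G ((z, s, H z), u) = 0 := by
    ext1 t
    have hΦt : ∀ τ : unitInterval, Φ (flowCurve (Fin r → ℝ) ((z, s, H z), u)) τ =
        rescaledField p A (z, s * τ, y τ) := by
      intro τ
      rw [hv2, flowCurve_apply]
      simp [hu]
    have hint := intervalIntegral.integral_eq_sub_of_hasDerivAt (a := 0) (b := (t : ℝ)) (f := y)
      (f' := fun τ => s • Φ (flowCurve (Fin r → ℝ) ((z, s, H z), u)) (Set.projIcc 0 1 zero_le_one τ)) (by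
        intro τ hτ
        rw [Set.uIcc_of_le t.2.1] at hτ
        have hτ' : τ ∈ Set.Icc (0 : ℝ) 1 := ⟨hτ.1, hτ.2.trans t.2.2⟩
        rw [Set.projIcc_of_mem zero_le_one hτ', hΦt]
        exact hy τ hτ')
      (Continuous.intervalIntegrable (by fun_prop) _ _)
    rw [intervalIntegral.integral_smul] at hint
    simp only [G, Ψ, ContinuousMap.sub_apply, ContinuousMap.smul_apply, unitPrimitive_apply, hint,
      hu, ContinuousMap.zero_apply]
    simp [y]
  have h1 := hv1.1 (by rw [hGv, hG0])
  change H (z + z ^ (p + 1) * s) = H z + hG.implicitFunction (by simp) hinv (z, s, H z) 1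
  simp only at h1
  rw [h1, hu]
  simp [y]

end Flow

theorem ContDiffAt.comp_of_eq {E F G : Type*} [NormedAddCommGroup E] [NormedSpace ℝ E]
    [NormedAddCommGroup F] [NormedSpace ℝ F] [NormedAddCommGroup G] [NormedSpace ℝ G]
    {n : ℕ∞ω} {g : F → G} {f : E → F} {x : E} {y : F} (hg : ContDiffAt ℝ n g y)
    (hf : ContDiffAt ℝ n f x) (hy : f x = y) : ContDiffAt ℝ n (fun x => g (f x)) x := by
  subst hy
  exact hg.comp x hf

theorem contDiff_polynomial_eval (P : Polynomial ℝ) {n : ℕ∞ω} :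
    ContDiff ℝ n fun x : ℝ => P.eval x := by
  simpa using P.contDiff_aeval (𝕜 := ℝ) n

/-! ### The operators `T_k`. -/

section JetQuotient

theorem jetQuotient_zero_right (k : ℕ) (u : ℝ → ℝ) : jetQuotient k u 0 = 0 := by
  cases k with
  | zero => simp [jetQuotient, jet]
  | succ k => simp [jetQuotient]

theorem jetQuotient_zero_left (u : ℝ → ℝ) (x : ℝ) : jetQuotient 0 u x = u x - u 0 := by
  simp [jetQuotient, jet]

/-- `T_k` and `T_(k+1)` differ by one Taylor term. This identity is what lets a factor `x` be
extracted from simple functions without leaving them, by raising `k`. -/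
theorem jetQuotient_eq_mul (k : ℕ) (u : ℝ → ℝ) (x : ℝ) : jetQuotient k u x =
    x * (jetQuotient (k + 1) u x + iteratedDeriv (k + 1) u 0 / (Nat.factorial (k + 1) : ℝ)) := by
  by_cases hx : x = 0
  · subst hx; simp [jetQuotient_zero_right]
  · rw [jetQuotient, jetQuotient, jet, jet, Finset.sum_range_succ _ (k + 1)]
    field_simp
    ring

theorem tendsto_jetQuotient {u : ℝ → ℝ} (hu : ContDiffAt ℝ ∞ u 0) (k : ℕ) :
    Tendsto (jetQuotient k u) (𝓝 0) (𝓝 0) :=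
  (hu.sub_jet_isLittleO k).tendsto_div_nhds_zero

theorem contDiffAt_jetQuotient {u : ℝ → ℝ} (hu : ContDiffAt ℝ ∞ u 0) (k : ℕ) :
    ContDiffAt ℝ ∞ (jetQuotient k u) 0 := by
  induction k with
  | zero =>
    rw [show jetQuotient 0 u = fun x => u x - u 0 from funext (jetQuotient_zero_left u)]
    exact hu.sub contDiffAt_const
  | succ k ih =>
    set c := iteratedDeriv (k + 1) u 0 / (Nat.factorial (k + 1) : ℝ)
    have h1 : dslope (jetQuotient k u) 0 = fun x => jetQuotient (k + 1) u x + c := by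
      have hne : ∀ x : ℝ, x ≠ 0 → slope (jetQuotient k u) 0 x = jetQuotient (k + 1) u x + c := by
        intro x hx
        rw [slope_def_field, jetQuotient_zero_right, jetQuotient_eq_mul, sub_zero, sub_zero,
          mul_div_cancel_left₀ _ hx]
      ext x
      by_cases hx : x = 0
      · subst hx
        rw [dslope_same, jetQuotient_zero_right, zero_add]
        refine HasDerivAt.deriv ?_
        rw [hasDerivAt_iff_tendsto_slope]
        have h2 := ((tendsto_jetQuotient hu (k + 1)).add_const c).mono_left
          (nhdsWithin_le_nhds (s := {0}ᶜ))
        rw [zero_add] at h2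
        refine h2.congr' ?_
        filter_upwards [self_mem_nhdsWithin] with x hx
        exact (hne x hx).symm
      · rw [dslope_of_ne _ hx, hne x hx]
    have h2 := ih.dslope_zero
    rw [h1] at h2
    simpa using h2.sub (contDiffAt_const (c := c))

end JetQuotient

/-! ### Simple functions with analytic parameters: algebra, composition, division by `x`. -/

section Simple

variable {r : ℕ} {H : ℝ → Fin r → ℝ}

/-- The functions `T_k H_j ∘ P` with `P` a polynomial vanishing at `0`. -/
def IsJetAtom (H : ℝ → Fin r → ℝ) (y : ℝ → ℝ) : Prop :=
  ∃ (k : ℕ) (j : Fin r) (P : Polynomial ℝ), P.eval 0 = 0 ∧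
    y = fun x => jetQuotient k (fun t => H t j) (P.eval x)

theorem IsJetAtom.apply_zero {y : ℝ → ℝ} (hy : IsJetAtom H y) : y 0 = 0 := by
  obtain ⟨k, j, P, hP, rfl⟩ := hy
  simp only [hP, jetQuotient_zero_right]

theorem IsJetAtom.contDiffAt (hH : ∀ j, ContDiffAt ℝ ∞ (fun t => H t j) 0) {y : ℝ → ℝ}
    (hy : IsJetAtom H y) : ContDiffAt ℝ ∞ y 0 := by
  obtain ⟨k, j, P, hP, rfl⟩ := hy
  refine ContDiffAt.comp (g := jetQuotient k fun t => H t j) (f := fun x => P.eval x) 0 ?_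
    (contDiff_polynomial_eval P).contDiffAt
  rw [hP]
  exact contDiffAt_jetQuotient (hH j) k

theorem IsJetAtom.exists_eq_mul {y : ℝ → ℝ} (hy : IsJetAtom H y) :
    ∃ (y' : ℝ → ℝ) (Q : Polynomial ℝ) (c : ℝ), IsJetAtom H y' ∧
      ∀ x, y x = x * (Q.eval x * (y' x + c)) := by
  obtain ⟨k, j, P, hP, rfl⟩ := hy
  obtain ⟨Q, hQ⟩ := (Polynomial.X_dvd_iff (f := P)).2
    (by rw [Polynomial.coeff_zero_eq_eval_zero, hP])
  refine ⟨_, Q, iteratedDeriv (k + 1) (fun t => H t j) 0 / (Nat.factorial (k + 1) : ℝ),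
    ⟨k + 1, j, P, hP, rfl⟩, fun x => ?_⟩
  have hx : P.eval x = x * Q.eval x := by rw [hQ, Polynomial.eval_mul, Polynomial.eval_X]
  change jetQuotient k (fun t => H t j) (P.eval x) = _
  rw [jetQuotient_eq_mul, ← mul_assoc, ← hx]

/-- Simple functions with parameters: analytic functions of `x`, of the parameters `w` and of
finitely many atoms. -/
def IsSimple (H : ℝ → Fin r → ℝ) {m : ℕ} (g : ℝ × (Fin m → ℝ) → ℝ) : Prop :=
  ∃ (ι : Type) (_ : Fintype ι) (y : ι → ℝ → ℝ) (F : (ℝ × (Fin m → ℝ)) × (ι → ℝ) → ℝ),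
    (∀ i, IsJetAtom H (y i)) ∧ ContDiffAt ℝ ω F 0 ∧ g = fun q => F (q, fun i => y i q.1)

variable {m n : ℕ}

theorem IsSimple.of_contDiffAt {g : ℝ × (Fin m → ℝ) → ℝ} (hg : ContDiffAt ℝ ω g 0) :
    IsSimple H g :=
  ⟨Empty, inferInstance, fun i => i.elim, fun v => g v.1, fun i => i.elim,
    ContDiffAt.comp (g := g) 0 hg contDiffAt_fst, rfl⟩

theorem IsJetAtom.isSimple {y : ℝ → ℝ} (hy : IsJetAtom H y) :
    IsSimple H fun q : ℝ × (Fin m → ℝ) => y q.1 :=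
  ⟨Unit, inferInstance, fun _ => y, fun v => v.2 (), fun _ => hy, by fun_prop, rfl⟩

theorem IsSimple.comp {g : ℝ × (Fin n → ℝ) → ℝ} (hg : IsSimple H g)
    {v : Fin n → ℝ × (Fin m → ℝ) → ℝ} (hv : ∀ i, IsSimple H (v i)) (hv0 : ∀ i, v i 0 = 0) :
    IsSimple H fun q => g (q.1, fun i => v i q) := by
  obtain ⟨ι, _, y, F, hy, hF, rfl⟩ := hg
  choose κ _ z G hz hG hvG using hv
  refine ⟨ι ⊕ Σ i, κ i, inferInstance, Sum.elim y fun a => z a.1 a.2,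
    fun q => F ((q.1.1, fun i => G i (q.1, fun a => q.2 (.inr ⟨i, a⟩))), fun b => q.2 (.inl b)),
    ?_, ?_, ?_⟩
  · rintro (b | a)
    · exact hy b
    · exact hz _ _
  · have hG0 : ∀ i, G i 0 = 0 := by
      intro i
      have := hv0 i
      rw [hvG] at this
      simp only [Prod.fst_zero, (hz i _).apply_zero] at this
      exact this
    refine ContDiffAt.comp_of_eq (g := F) (f := fun q : (ℝ × (Fin m → ℝ)) × (ι ⊕ (Σ i, κ i) → ℝ) =>
      ((q.1.1, fun i => G i (q.1, fun a => q.2 (.inr ⟨i, a⟩))), fun b => q.2 (.inl b)))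
      (y := 0) hF ?_ ?_
    · refine ContDiffAt.prodMk (ContDiffAt.prodMk (by fun_prop) ?_) (by fun_prop)
      refine contDiffAt_pi.2 fun i => ?_
      exact ContDiffAt.comp_of_eq (g := G i)
        (f := fun q : (ℝ × (Fin m → ℝ)) × (ι ⊕ (Σ i, κ i) → ℝ) =>
          (q.1, fun a => q.2 (.inr ⟨i, a⟩))) (y := 0) (hG i) (by fun_prop) rfl
    · ext i
      · rfl
      · exact hG0 i
      · rfl
  · ext q
    simp [hvG]

theorem IsSimple.sub_const {g : ℝ × (Fin m → ℝ) → ℝ} (hg : IsSimple H g) (c : ℝ) :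
    IsSimple H fun q => g q - c := by
  obtain ⟨ι, _, y, F, hy, hF, rfl⟩ := hg
  exact ⟨ι, inferInstance, y, fun q => F q - c, hy, hF.sub contDiffAt_const, rfl⟩

theorem IsSimple.contDiffAt_comp {v : Fin n → ℝ × (Fin m → ℝ) → ℝ} (hv : ∀ i, IsSimple H (v i))
    {F : (Fin n → ℝ) → ℝ} (hF : ContDiffAt ℝ ω F fun i => v i 0) :
    IsSimple H fun q => F fun i => v i q := by
  have h1 : IsSimple H fun q : ℝ × (Fin n → ℝ) => F fun i => q.2 i + v i 0 := by
    refine IsSimple.of_contDiffAt ?_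
    refine ContDiffAt.comp_of_eq (g := F) (f := fun q : ℝ × (Fin n → ℝ) => fun i => q.2 i + v i 0)
      hF (by fun_prop) ?_
    simp
  simpa using h1.comp (fun i => (hv i).sub_const (v i 0)) (fun i => sub_self _)

theorem IsSimple.contDiffAt_comp₂ {v₁ v₂ : ℝ × (Fin m → ℝ) → ℝ} (h₁ : IsSimple H v₁)
    (h₂ : IsSimple H v₂) {F : ℝ × ℝ → ℝ} (hF : ContDiffAt ℝ ω F (v₁ 0, v₂ 0)) :
    IsSimple H fun q => F (v₁ q, v₂ q) := by
  have := IsSimple.contDiffAt_comp (H := H) (v := ![v₁, v₂]) (F := fun y => F (y 0, y 1))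
    (by simp [Fin.forall_fin_two, h₁, h₂])
    (ContDiffAt.comp_of_eq (g := F) (f := fun y : Fin 2 → ℝ => (y 0, y 1)) hF (by fun_prop)
      (by simp))
  simpa using this

theorem IsSimple.add {v₁ v₂ : ℝ × (Fin m → ℝ) → ℝ} (h₁ : IsSimple H v₁) (h₂ : IsSimple H v₂) :
    IsSimple H fun q => v₁ q + v₂ q :=
  h₁.contDiffAt_comp₂ h₂ (F := fun y => y.1 + y.2) (by fun_prop)

theorem IsSimple.sub {v₁ v₂ : ℝ × (Fin m → ℝ) → ℝ} (h₁ : IsSimple H v₁) (h₂ : IsSimple H v₂) :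
    IsSimple H fun q => v₁ q - v₂ q :=
  h₁.contDiffAt_comp₂ h₂ (F := fun y => y.1 - y.2) (by fun_prop)

theorem IsSimple.mul {v₁ v₂ : ℝ × (Fin m → ℝ) → ℝ} (h₁ : IsSimple H v₁) (h₂ : IsSimple H v₂) :
    IsSimple H fun q => v₁ q * v₂ q :=
  h₁.contDiffAt_comp₂ h₂ (F := fun y => y.1 * y.2) (by fun_prop)

theorem IsSimple.div {v₁ v₂ : ℝ × (Fin m → ℝ) → ℝ} (h₁ : IsSimple H v₁) (h₂ : IsSimple H v₂)
    (h0 : v₂ 0 ≠ 0) : IsSimple H fun q => v₁ q / v₂ q :=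
  h₁.contDiffAt_comp₂ h₂ (F := fun y => y.1 / y.2) (ContDiffAt.div (by fun_prop) (by fun_prop) h0)

theorem IsSimple.poly (P : Polynomial ℝ) : IsSimple H fun q : ℝ × (Fin m → ℝ) => P.eval q.1 :=
  IsSimple.of_contDiffAt ((contDiff_polynomial_eval P).contDiffAt.comp _ contDiffAt_fst)

theorem IsSimple.contDiffAt (hH : ∀ j, ContDiffAt ℝ ∞ (fun t => H t j) 0)
    {g : ℝ × (Fin m → ℝ) → ℝ} (hg : IsSimple H g) : ContDiffAt ℝ ∞ g 0 := by
  obtain ⟨ι, _, y, F, hy, hF, rfl⟩ := hg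
  refine ContDiffAt.comp_of_eq (g := F) (f := fun q : ℝ × (Fin m → ℝ) => (q, fun i => y i q.1))
    (y := 0) (hF.of_le le_top) ?_ ?_
  · refine contDiffAt_id.prodMk (contDiffAt_pi.2 fun i => ?_)
    exact ContDiffAt.comp_of_eq (g := y i) (y := 0) ((hy i).contDiffAt hH) contDiffAt_fst rfl
  · ext i
    · rfl
    · rfl
    · exact (hy i).apply_zero

theorem tendsto_atoms (hH : ∀ j, ContDiffAt ℝ ∞ (fun t => H t j) 0) {ι : Type} [Fintype ι]
    {y : ι → ℝ → ℝ} (hy : ∀ i, IsJetAtom H (y i)) :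
    Tendsto (fun q : ℝ × (Fin m → ℝ) => (q, fun i => y i q.1)) (𝓝 0) (𝓝 0) := by
  refine tendsto_id.prodMk_nhds (tendsto_pi_nhds.2 fun i => ?_)
  have h1 : Tendsto (y i) (𝓝 0) (𝓝 0) := by
    simpa only [(hy i).apply_zero] using ((hy i).contDiffAt hH).continuousAt.tendsto
  exact h1.comp (continuous_fst.tendsto' _ _ rfl)

theorem IsSimple.exists_eq_mul (hH : ∀ j, ContDiffAt ℝ ∞ (fun t => H t j) 0)
    {g : ℝ × (Fin m → ℝ) → ℝ} (hg : IsSimple H g)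
    (h0 : ∀ᶠ w in 𝓝 (0 : Fin m → ℝ), Tendsto (fun x => g (x, w)) (𝓝[≠] 0) (𝓝 0)) :
    ∃ g', IsSimple H g' ∧ ∀ᶠ q in 𝓝 0, g q = q.1 * g' q := by
  obtain ⟨ι, _, y, F, hy, hF, rfl⟩ := hg
  choose y' Q c hy' hyy' using fun i => (hy i).exists_eq_mul
  -- Each atom is replaced by `x Q_i(x) (y'_i + c_i)` in terms of a new atom. After this
  -- substitution the outer function at `x = 0` becomes `F((0, w), 0)`, whatever the new atoms are;
  -- it vanishes by `h0`, and Hadamard's lemma in `x` divides by `x`.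
  let φ : (ℝ × (Fin m → ℝ)) × (ι → ℝ) → (ℝ × (Fin m → ℝ)) × (ι → ℝ) :=
    fun v => (v.1, fun i => v.1.1 * ((Q i).eval v.1.1 * (v.2 i + c i)))
  have hφ : ContDiffAt ℝ ω φ 0 := by
    refine ContDiffAt.prodMk (by fun_prop) (contDiffAt_pi.2 fun i => ?_)
    refine ContDiffAt.mul (by fun_prop) (ContDiffAt.mul ?_ (by fun_prop))
    exact (contDiff_polynomial_eval (Q i)).contDiffAt.comp _ (by fun_prop)
  have hφ0 : φ 0 = 0 := by ext <;> simp [φ]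
  obtain ⟨G, hG, hFG⟩ := (ContDiffAt.comp_of_eq (g := F) (f := φ) hF hφ hφ0).analyticAt.exists_slope
    ((ContinuousLinearMap.fst ℝ ℝ (Fin m → ℝ)).comp (ContinuousLinearMap.fst ℝ _ (ι → ℝ)))
    ((1, 0), 0)
  have hF0 : ∀ᶠ w in 𝓝 (0 : Fin m → ℝ), F ((0, w), 0) = 0 := by
    have hFc : ∀ᶠ v in 𝓝 0, ContinuousAt F v :=
      hF.analyticAt.eventually_analyticAt.mono fun v hv => hv.continuousAt
    have h1 : Tendsto (fun w : Fin m → ℝ => (((0, w), 0) : (ℝ × (Fin m → ℝ)) × (ι → ℝ))) (𝓝 0)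
        (𝓝 0) := Continuous.tendsto' (by fun_prop) _ _ rfl
    filter_upwards [h0, h1.eventually hFc] with w hw hcw
    have h2 : Tendsto (fun x => (((x, w), fun i => y i x) : (ℝ × (Fin m → ℝ)) × (ι → ℝ)))
        (𝓝[≠] 0) (𝓝 ((0, w), 0)) := by
      refine Tendsto.mono_left ?_ nhdsWithin_le_nhds
      refine (Continuous.tendsto' (by fun_prop) _ _ rfl).prodMk_nhds (tendsto_pi_nhds.2 fun i => ?_)
      have h3 := ((hy i).contDiffAt hH).continuousAt.tendsto
      rwa [(hy i).apply_zero] at h3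
    exact tendsto_nhds_unique (hcw.tendsto.comp h2) hw
  refine ⟨_, ⟨ι, inferInstance, y', G, hy', hG.contDiffAt, rfl⟩, ?_⟩
  have h3 : Tendsto (fun q : ℝ × (Fin m → ℝ) => q.2) (𝓝 0) (𝓝 0) :=
    Continuous.tendsto' (by fun_prop) _ _ rfl
  filter_upwards [(tendsto_atoms hH hy').eventually hFG, h3.eventually hF0] with q hq hq0
  have e1 : φ (q, fun i => y' i q.1) = (q, fun i => y i q.1) := by
    simp only [φ, hyy']
  have e2 : φ ((q, fun i => y' i q.1) - q.1 • ((1, 0), 0)) = ((0, q.2), 0) := by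
    ext <;> simp [φ]
  simp only [Function.comp_def, ContinuousLinearMap.coe_comp, ContinuousLinearMap.coe_fst',
    e1, e2, hq0, sub_zero] at hq
  exact hq

/-- A bound by `|x|^L` forces the limit at `x = 0` to vanish for all small `w`, so one factor `x`
after another can be divided out. -/
theorem IsSimple.exists_eq_pow_mul (hH : ∀ j, ContDiffAt ℝ ∞ (fun t => H t j) 0) (L : ℕ) :
    ∀ {g : ℝ × (Fin m → ℝ) → ℝ}, IsSimple H g →
    (∃ C, ∀ᶠ q in 𝓝[≠] (0 : ℝ) ×ˢ 𝓝 (0 : Fin m → ℝ), |g q| ≤ C * |q.1| ^ L) →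
    ∃ g', IsSimple H g' ∧ ∀ᶠ q in 𝓝 0, g q = q.1 ^ L * g' q := by
  have hle : 𝓝[≠] (0 : ℝ) ×ˢ 𝓝 (0 : Fin m → ℝ) ≤ 𝓝 0 := by
    rw [show (0 : ℝ × (Fin m → ℝ)) = (0, 0) from rfl, nhds_prod_eq]
    exact prod_mono nhdsWithin_le_nhds le_rfl
  induction L with
  | zero => intro g hg _; exact ⟨g, hg, by simp⟩
  | succ L ih =>
    rintro g hg ⟨C, hC⟩
    obtain ⟨g₁, hg₁, h1⟩ := hg.exists_eq_mul hH (by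
      have h2 := (eventually_swap_iff.1 hC).curry
      filter_upwards [h2] with w hw
      refine squeeze_zero_norm' (a := fun x => C * |x| ^ (L + 1)) hw ?_
      exact (Continuous.tendsto' (by fun_prop) _ _ (by simp)).mono_left nhdsWithin_le_nhds)
    obtain ⟨g₂, hg₂, h2⟩ := ih hg₁ ⟨C, by
      have h3 : ∀ᶠ q in 𝓝[≠] (0 : ℝ) ×ˢ 𝓝 (0 : Fin m → ℝ), q.1 ≠ 0 :=
        (eventually_mem_nhdsWithin (s := {0}ᶜ)).prod_inl _
      filter_upwards [hC, hle h1, h3] with q hq hq1 hq0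
      rw [hq1, abs_mul, pow_succ] at hq
      have : 0 < |q.1| := abs_pos.2 hq0
      exact le_of_mul_le_mul_left (by linarith) this⟩
    refine ⟨g₂, hg₂, ?_⟩
    filter_upwards [h1, h2] with q hq1 hq2
    rw [hq1, hq2]; ring

theorem IsSimple.exists_slope (hH : ∀ j, ContDiffAt ℝ ∞ (fun t => H t j) 0)
    {g : ℝ × (Fin m → ℝ) → ℝ} (hg : IsSimple H g) (i : Fin m) :
    ∃ g', IsSimple H g' ∧
      ∀ᶠ q in 𝓝 0, g q - g (q.1, Function.update q.2 i 0) = q.2 i * g' q := by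
  obtain ⟨ι, _, y, F, hy, hF, rfl⟩ := hg
  obtain ⟨G, hG, hFG⟩ := hF.analyticAt.exists_slope
    (((ContinuousLinearMap.proj i).comp (ContinuousLinearMap.snd ℝ ℝ (Fin m → ℝ))).comp
      (ContinuousLinearMap.fst ℝ _ (ι → ℝ))) ((0, Pi.single i 1), 0)
  refine ⟨_, ⟨ι, inferInstance, y, G, hy, hG.contDiffAt, rfl⟩, ?_⟩
  filter_upwards [(tendsto_atoms hH hy).eventually hFG] with q hq
  have e1 : ((q, fun a => y a q.1) : (ℝ × (Fin m → ℝ)) × (ι → ℝ)) -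
      q.2 i • ((0, Pi.single i 1), 0) = ((q.1, Function.update q.2 i 0), fun a => y a q.1) := by
    ext a
    · simp
    · by_cases ha : a = i
      · subst ha; simp
      · simp [ha]
    · simp
  rw [← e1]
  exact hq

end Simple

/-! ### Implicit equations among simple functions. -/

section SimpleImplicit

variable {r : ℕ} {H : ℝ → Fin r → ℝ} {m n : ℕ}

theorem contDiff_snoc {k : ℕ∞ω} : ContDiff ℝ k fun v : (Fin m → ℝ) × ℝ =>
    (Fin.snoc v.1 v.2 : Fin (m + 1) → ℝ) := by
  rw [contDiff_pi]
  intro i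
  refine Fin.lastCases ?_ (fun j => ?_) i
  · simpa using contDiff_snd
  · simpa [Function.comp_def] using (contDiff_apply ℝ ℝ j).comp (contDiff_fst (F := ℝ))

theorem snoc_zero_eq_smul_single (t : ℝ) :
    (Fin.snoc (0 : Fin m → ℝ) t : Fin (m + 1) → ℝ) = t • Pi.single (Fin.last m) 1 := by
  ext i
  refine Fin.lastCases ?_ (fun j => ?_) i
  · simp
  · simp [Fin.castSucc_ne_last]

/-- The analytic implicit function theorem for simple functions with parameters. -/
theorem IsSimple.exists_implicit (hH : ∀ j, ContDiffAt ℝ ∞ (fun t => H t j) 0)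
    {g : ℝ × (Fin (m + 1) → ℝ) → ℝ} (hg : IsSimple H g) (l : (Fin (m + 1) → ℝ) →L[ℝ] ℝ)
    (hl : ∀ᶠ w in 𝓝 (0 : Fin (m + 1) → ℝ), Tendsto (fun x => g (x, w)) (𝓝[≠] 0) (𝓝 (l w)))
    (hne : l (Pi.single (Fin.last m) 1) ≠ 0) :
    ∃ h : ℝ × (Fin m → ℝ) → ℝ, IsSimple H h ∧ h 0 = 0 ∧
      (∀ᶠ q in 𝓝 0, g (q.1, Fin.snoc q.2 (h q)) = 0) ∧
      ∃ c > 0, ∀ᶠ v in 𝓝 (0 : (ℝ × (Fin m → ℝ)) × ℝ × ℝ), c * |v.2.1 - v.2.2| ≤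
        |g (v.1.1, Fin.snoc v.1.2 v.2.1) - g (v.1.1, Fin.snoc v.1.2 v.2.2)| := by
  obtain ⟨ι, _, y, F, hy, hF, rfl⟩ := hg
  -- All atoms vanish at `x = 0`, so the prescribed limit determines `F` on this slice. Its
  -- derivative in the last parameter at the origin is then read off from `l`, while the atoms are
  -- treated as independent variables.
  have hF0 : ∀ᶠ w in 𝓝 (0 : Fin (m + 1) → ℝ), F ((0, w), 0) = l w := by
    have hFc : ∀ᶠ v in 𝓝 0, ContinuousAt F v :=
      hF.analyticAt.eventually_analyticAt.mono fun v hv => hv.continuousAt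
    have h1 : Tendsto (fun w : Fin (m + 1) → ℝ => (((0, w), 0) : (ℝ × (Fin (m + 1) → ℝ)) × (ι → ℝ)))
        (𝓝 0) (𝓝 0) := Continuous.tendsto' (by fun_prop) _ _ rfl
    filter_upwards [hl, h1.eventually hFc] with w hw hcw
    have h2 : Tendsto (fun x => (((x, w), fun i => y i x) : (ℝ × (Fin (m + 1) → ℝ)) × (ι → ℝ)))
        (𝓝[≠] 0) (𝓝 ((0, w), 0)) := by
      refine Tendsto.mono_left ?_ nhdsWithin_le_nhds
      refine (Continuous.tendsto' (by fun_prop) _ _ rfl).prodMk_nhds (tendsto_pi_nhds.2 fun i => ?_)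
      have h3 := ((hy i).contDiffAt hH).continuousAt.tendsto
      rwa [(hy i).apply_zero] at h3
    exact tendsto_nhds_unique (hcw.tendsto.comp h2) hw
  let G : ((ℝ × (Fin m → ℝ)) × (ι → ℝ)) × ℝ → ℝ :=
    fun v => F ((v.1.1.1, Fin.snoc v.1.1.2 v.2), v.1.2)
  have hG : ContDiffAt ℝ ω G 0 := by
    refine ContDiffAt.comp_of_eq (g := F) (f := fun v : ((ℝ × (Fin m → ℝ)) × (ι → ℝ)) × ℝ =>
      (((v.1.1.1, Fin.snoc v.1.1.2 v.2), v.1.2) : (ℝ × (Fin (m + 1) → ℝ)) × (ι → ℝ))) hF ?_ ?_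
    · refine ContDiffAt.prodMk (ContDiffAt.prodMk (by fun_prop) ?_) (by fun_prop)
      exact (contDiff_snoc.comp (f := fun v : ((ℝ × (Fin m → ℝ)) × (ι → ℝ)) × ℝ =>
        (v.1.1.2, v.2)) (by fun_prop)).contDiffAt
    · have := snoc_zero_eq_smul_single (m := m) 0
      rw [zero_smul] at this
      simp [this]
  have hline : ∀ᶠ t in 𝓝 (0 : ℝ), G (0, t) = t * l (Pi.single (Fin.last m) 1) := by
    have h1 : Tendsto (fun t : ℝ => (Fin.snoc (0 : Fin m → ℝ) t : Fin (m + 1) → ℝ)) (𝓝 0) (𝓝 0) := by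
      simp only [snoc_zero_eq_smul_single]
      exact Continuous.tendsto' (by fun_prop) _ _ (by simp)
    filter_upwards [h1.eventually hF0] with t ht
    change F ((0, Fin.snoc (0 : Fin m → ℝ) t), 0) = _
    rw [ht, snoc_zero_eq_smul_single, map_smul, smul_eq_mul]
  have hG0 : G 0 = 0 := hline.self_of_nhds.trans (zero_mul _)
  have hGd : fderiv ℝ G 0 (0, 1) ≠ 0 := by
    have h1 : HasDerivAt (fun t : ℝ => ((0, t) : ((ℝ × (Fin m → ℝ)) × (ι → ℝ)) × ℝ)) (0, 1) 0 :=
      (hasDerivAt_const _ _).prodMk (hasDerivAt_id _)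
    have h2 : HasDerivAt (fun t : ℝ => G (0, t)) (fderiv ℝ G 0 (0, 1)) 0 :=
      HasFDerivAt.comp_hasDerivAt (l := G)
        (f := fun t : ℝ => ((0, t) : ((ℝ × (Fin m → ℝ)) × (ι → ℝ)) × ℝ)) 0
        (hG.differentiableAt (by simp)).hasFDerivAt h1
    have h3 : HasDerivAt (fun t : ℝ => G (0, t)) (l (Pi.single (Fin.last m) 1)) 0 := by
      refine HasDerivAt.congr_of_eventuallyEq ?_ hline
      simpa using (hasDerivAt_id (0 : ℝ)).mul_const (l (Pi.single (Fin.last m) 1))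
    rwa [h2.unique h3]
  obtain ⟨h, hh, hh0, hhG, -⟩ := hG.exists_implicit (by simp) hG0 hGd
  obtain ⟨c, hc, hcG⟩ := (hG.hasStrictFDerivAt (by simp)).exists_le_abs_sub hGd
  refine ⟨_, ⟨ι, inferInstance, y, h, hy, hh, rfl⟩, ?_, ?_, c, hc, ?_⟩
  · have : ((0, fun i => y i 0) : (ℝ × (Fin m → ℝ)) × (ι → ℝ)) = 0 := by
      ext i
      · rfl
      · rfl
      · exact (hy i).apply_zero
    change h (0, fun i => y i 0) = 0
    rw [this]; exact hh0
  · filter_upwards [(tendsto_atoms hH hy).eventually hhG] with q hq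
    exact hq
  · have h1 : Tendsto (fun v : (ℝ × (Fin m → ℝ)) × ℝ × ℝ => ((v.1, fun i => y i v.1.1), v.2))
        (𝓝 0) (𝓝 0) :=
      ((tendsto_atoms hH hy).comp (continuous_fst.tendsto' (0 : (ℝ × (Fin m → ℝ)) × ℝ × ℝ) 0 rfl)
        ).prodMk_nhds (continuous_snd.tendsto' _ _ rfl)
    filter_upwards [h1.eventually hcG] with v hv
    exact hv

end SimpleImplicit

/-! ### Simple functions of one variable and their quasi-analyticity. -/

section SimpleFun

variable {r : ℕ} {H : ℝ → Fin r → ℝ} {m : ℕ}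

/-- Functions of one variable that are simple near the origin. -/
def IsSimpleFun (H : ℝ → Fin r → ℝ) (u : ℝ → ℝ) : Prop :=
  ∃ g : ℝ × (Fin 0 → ℝ) → ℝ, IsSimple H g ∧ ∀ᶠ x in 𝓝 (0 : ℝ), u x = g (x, 0)

/-- Atoms may carry different orders `k`, whereas `simpleGerms` has a single one; this raises them
all to a common order. -/
theorem exists_jetQuotient_eq (u : ℝ → ℝ) (k d : ℕ) : ∃ α : ℝ × ℝ → ℝ, ContDiff ℝ ω α ∧
    α 0 = 0 ∧ ∀ z, jetQuotient k u z = α (z, jetQuotient (k + d) u z) := by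
  induction d with
  | zero => exact ⟨Prod.snd, contDiff_snd, rfl, fun z => rfl⟩
  | succ d ih =>
    obtain ⟨α, hα, hα0, hαu⟩ := ih
    refine ⟨fun v => α (v.1, v.1 * (v.2 + iteratedDeriv (k + d + 1) u 0 /
      (Nat.factorial (k + d + 1) : ℝ))), hα.comp (by fun_prop), ?_, fun z => ?_⟩
    · simpa using! hα0
    · rw [hαu, jetQuotient_eq_mul]; rfl

theorem IsSimpleFun.mem_simpleGerms {u : ℝ → ℝ} (hu : IsSimpleFun H u) :
    ((u : ℝ → ℝ) : Filter.Germ (𝓝 (0 : ℝ)) ℝ) ∈ simpleGerms H := by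
  obtain ⟨g, ⟨ι, _, y, F, hy, hF, rfl⟩, hug⟩ := hu
  choose k j P hP hyP using hy
  let K := Finset.univ.sup k
  have hk : ∀ i, k i ≤ K := fun i => Finset.le_sup (Finset.mem_univ i)
  choose α hα hα0 hαy using fun i => exists_jetQuotient_eq (fun t => H t (j i)) (k i) (K - k i)
  let e := (Fintype.equivFin ι).symm
  let φ : ℝ × (Fin (Fintype.card ι) → Fin r → ℝ) → (ℝ × (Fin 0 → ℝ)) × (ι → ℝ) :=
    fun q => ((q.1, 0), fun i => α i ((P i).eval q.1, q.2 (e.symm i) (j i)))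
  have hφ : ContDiffAt ℝ ω φ 0 := by
    refine ContDiffAt.prodMk (by fun_prop) (contDiffAt_pi.2 fun i => ?_)
    refine ((hα i).comp (ContDiff.prodMk ?_ ?_)).contDiffAt
    · exact (contDiff_polynomial_eval (P i)).comp contDiff_fst
    · fun_prop
  refine ⟨Fintype.card ι, K, fun q => F (φ q), fun l => P (e l), ?_, fun l => hP _, ?_⟩
  · refine (ContDiffAt.comp_of_eq (g := F) hF hφ ?_).analyticAt
    ext i
    · rfl
    · rfl
    · simpa [φ, hP] using! hα0 i
  · refine Filter.Germ.coe_eq.2 ?_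
    filter_upwards [hug] with x hx
    rw [hx]
    congr 2
    ext i
    simp only [hyP]
    rw [hαy, Nat.add_sub_cancel' (hk i), Equiv.apply_symm_apply]

theorem IsSimpleFun.contDiffAt (hH : ∀ j, ContDiffAt ℝ ∞ (fun t => H t j) 0) {u : ℝ → ℝ}
    (hu : IsSimpleFun H u) : ContDiffAt ℝ ∞ u 0 := by
  obtain ⟨g, hg, hug⟩ := hu
  refine ContDiffAt.congr_of_eventuallyEq ?_ hug
  exact ContDiffAt.comp_of_eq (g := g) (f := fun x : ℝ => ((x, 0) : ℝ × (Fin 0 → ℝ))) (y := 0)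
    (hg.contDiffAt hH) (by fun_prop) rfl

theorem IsSimpleFun.eventually_eq_zero (hS : QuasiAnalytic (simpleGerms H)) {u : ℝ → ℝ} (hu : IsSimpleFun H u)
    (h0 : ∀ n : ℕ, iteratedDeriv n u 0 = 0) : ∀ᶠ x in 𝓝 (0 : ℝ), u x = 0 := by
  refine Filter.Germ.coe_eq.1 (hS _ hu.mem_simpleGerms ⟨u, rfl, fun n => ?_⟩)
  rw [← norm_eq_zero, norm_iteratedFDeriv_eq_norm_iteratedDeriv, h0 n, norm_zero]

theorem IsSimple.comp_simpleFun {g : ℝ × (Fin m → ℝ) → ℝ} (hg : IsSimple H g)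
    {u : ℝ → Fin m → ℝ} (hu : ∀ i, IsSimpleFun H fun x => u x i) (hu0 : u 0 = 0) :
    IsSimpleFun H fun x => g (x, u x) := by
  choose v hv huv using hu
  refine ⟨_, hg.comp hv fun i => ?_, ?_⟩
  · have := (huv i).self_of_nhds
    simp only [hu0, Pi.zero_apply] at this
    exact this.symm
  · filter_upwards [eventually_all.2 huv] with x hx
    congr 2
    ext i
    exact hx i

/-- Since `u - P` is simple and `O(x^N)`, it can be divided by `x^N`. Thus the parameter `w₀(x)`
that describes a simple arc in a blow-up is again simple. -/
theorem IsSimpleFun.exists_remainder (hH : ∀ j, ContDiffAt ℝ ∞ (fun t => H t j) 0) {u w : ℝ → ℝ}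
    (hu : IsSimpleFun H u) {P : Polynomial ℝ} {N : ℕ} (hw : Tendsto w (𝓝[≠] 0) (𝓝 0))
    (huw : ∀ᶠ x in 𝓝[≠] (0 : ℝ), u x = P.eval x + x ^ N * w x) :
    ∃ w', IsSimpleFun H w' ∧ w' 0 = 0 ∧ ∀ᶠ x in 𝓝[≠] (0 : ℝ), w x = w' x := by
  obtain ⟨g, hg, hug⟩ := hu
  have hug' := hug.filter_mono (nhdsWithin_le_nhds (s := {0}ᶜ))
  obtain ⟨g', hg', hgg'⟩ := (hg.sub (IsSimple.poly P)).exists_eq_pow_mul hH N ⟨1, by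
    have h1 : ∀ᶠ x in 𝓝[≠] (0 : ℝ), |w x| < 1 := by
      have := hw.abs
      rw [abs_zero] at this
      exact this.eventually (gt_mem_nhds one_pos)
    filter_upwards [((huw.and hug').and h1).prod_inl (𝓝 (0 : Fin 0 → ℝ))] with q hq
    obtain ⟨⟨hq1, hq2⟩, hq3⟩ := hq
    rw [show q = (q.1, 0) from Prod.ext rfl (Subsingleton.elim _ _), ← hq2, hq1, add_sub_cancel_left,
      abs_mul, abs_pow, mul_comm]
    gcongr⟩
  have hin : Tendsto (fun x : ℝ => ((x, 0) : ℝ × (Fin 0 → ℝ))) (𝓝 0) (𝓝 0) :=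
    Continuous.tendsto' (by fun_prop) _ _ rfl
  have hww : ∀ᶠ x in 𝓝[≠] (0 : ℝ), w x = g' (x, 0) := by
    filter_upwards [huw, hug', self_mem_nhdsWithin,
      (hin.eventually hgg').filter_mono nhdsWithin_le_nhds] with x hx1 hx2 hx0 hx3
    have hx0 : x ≠ 0 := hx0
    refine mul_left_cancel₀ (pow_ne_zero N hx0) ?_
    rw [← hx3, ← hx2, hx1]; ring
  refine ⟨fun x => g' (x, 0), ⟨g', hg', Eventually.of_forall fun _ => rfl⟩, ?_, hww⟩
  have hgc : Tendsto (fun x : ℝ => g' (x, 0)) (𝓝[≠] 0) (𝓝 (g' 0)) :=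
    ((hg'.contDiffAt hH).continuousAt.tendsto.comp hin).mono_left nhdsWithin_le_nhds
  exact tendsto_nhds_unique hgc (hw.congr' hww)

end SimpleFun

/-! ### Expansions of arcs and the associated blow-ups. -/

section Expansion

variable {m n : ℕ}

/-- The filter of the pairs `(x, w)` with `x ≠ 0`, `x → 0` and `w → 0`. -/
abbrev paramFilter (m : ℕ) : Filter (ℝ × (Fin m → ℝ)) := 𝓝[≠] (0 : ℝ) ×ˢ 𝓝 (0 : Fin m → ℝ)

theorem paramFilter_le_nhds : paramFilter m ≤ 𝓝 0 := by
  rw [show (0 : ℝ × (Fin m → ℝ)) = (0, 0) from rfl, nhds_prod_eq]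
  exact prod_mono nhdsWithin_le_nhds le_rfl

theorem eventually_paramFilter_ne : ∀ᶠ q in paramFilter m, q.1 ≠ 0 :=
  (eventually_mem_nhdsWithin (s := {0}ᶜ)).prod_inl _

theorem eventually_paramFilter_abs_le_one : ∀ᶠ q in paramFilter m, |q.1| ≤ 1 := by
  have h : Tendsto (fun x : ℝ => |x|) (𝓝[≠] 0) (𝓝 0) :=
    (Continuous.tendsto' (by fun_prop) _ _ (by simp)).mono_left nhdsWithin_le_nhds
  exact (h.eventually (ge_mem_nhds one_pos)).prod_inl _

/-- The point `P(x) + x^N w`. -/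
noncomputable def curvePoint (P : Fin m → Polynomial ℝ) (N : ℕ) (q : ℝ × (Fin m → ℝ)) : Fin m → ℝ :=
  fun i => (P i).eval q.1 + q.1 ^ N * q.2 i

theorem contDiff_curvePoint (P : Fin m → Polynomial ℝ) (N : ℕ) {k : ℕ∞ω} :
    ContDiff ℝ k (curvePoint P N) := by
  refine contDiff_pi.2 fun i => ?_
  exact ((contDiff_polynomial_eval (P i)).comp contDiff_fst).add (by fun_prop)

theorem curvePoint_zero {P : Fin m → Polynomial ℝ} (hP : ∀ i, (P i).eval 0 = 0) (N : ℕ) :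
    curvePoint P N 0 = 0 := by
  ext i; simp [curvePoint, hP]

theorem tendsto_curvePoint {P : Fin m → Polynomial ℝ} (hP : ∀ i, (P i).eval 0 = 0) (N : ℕ) :
    Tendsto (curvePoint P N) (𝓝 0) (𝓝 0) :=
  (contDiff_curvePoint P N (k := 0)).continuous.tendsto' _ _ (curvePoint_zero hP N)

theorem tendsto_add_curvePoint {P : Fin m → Polynomial ℝ} (hP : ∀ i, (P i).eval 0 = 0) (N : ℕ)
    (a : Fin m → ℝ) : Tendsto (fun q => a + curvePoint P N q) (paramFilter m) (𝓝 a) := by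
  simpa using ((tendsto_curvePoint hP N).mono_left paramFilter_le_nhds).const_add a

theorem curvePoint_sub (P : Fin m → Polynomial ℝ) (N : ℕ) (x : ℝ) (v w : Fin m → ℝ) :
    curvePoint P N (x, v) - curvePoint P N (x, w) = x ^ N • (v - w) := by
  ext i; simp [curvePoint]; ring

theorem isSimple_curvePoint {r : ℕ} (H : ℝ → Fin r → ℝ) (P : Fin m → Polynomial ℝ) (N : ℕ)
    (i : Fin m) : IsSimple H fun q => curvePoint P N q i :=
  IsSimple.of_contDiffAt (contDiff_pi.1 (contDiff_curvePoint P N) i).contDiffAt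

/-- The expansion `σ(x) = P(x) + x^N w(x)`, with `w → 0`, of a curve through the origin. -/
structure IsExpansion (σ : ℝ → Fin m → ℝ) (N : ℕ) (P : Fin m → Polynomial ℝ)
    (w : ℝ → Fin m → ℝ) : Prop where
  eval_zero : ∀ i, (P i).eval 0 = 0
  tendsto : Tendsto w (𝓝[≠] 0) (𝓝 0)
  eq : ∀ᶠ x in 𝓝[≠] (0 : ℝ), σ x = curvePoint P N (x, w x)

theorem exists_isExpansion {σ : ℝ → Fin m → ℝ} (hσ : ContDiffAt ℝ ∞ σ 0) (hσ0 : σ 0 = 0) (N : ℕ) :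
    ∃ P w, IsExpansion σ N P w := by
  have hσi : ∀ i, ContDiffAt ℝ ∞ (fun x => σ x i) 0 := contDiffAt_pi.1 hσ
  let P : Fin m → Polynomial ℝ := fun i => ∑ j ∈ Finset.range (N + 1),
    Polynomial.monomial j (iteratedDeriv j (fun x => σ x i) 0 / (Nat.factorial j : ℝ))
  have hP : ∀ i x, (P i).eval x = jet N (fun x => σ x i) x := by
    intro i x
    simp [P, jet, Polynomial.eval_finsetSum]
  refine ⟨P, fun x i => jetQuotient N (fun x => σ x i) x, fun i => ?_, ?_, ?_⟩
  · rw [hP, jet, Finset.sum_range_succ']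
    simp [hσ0]
  · exact tendsto_pi_nhds.2 fun i => (tendsto_jetQuotient (hσi i) N).mono_left nhdsWithin_le_nhds
  · filter_upwards [self_mem_nhdsWithin] with x hx
    have hx : x ≠ 0 := hx
    ext i
    simp only [curvePoint, hP, jetQuotient]
    field_simp
    ring

theorem IsExpansion.tendsto_paramFilter {σ w : ℝ → Fin m → ℝ} {N : ℕ} {P : Fin m → Polynomial ℝ}
    (h : IsExpansion σ N P w) : Tendsto (fun x => (x, w x)) (𝓝[≠] 0) (paramFilter m) :=
  tendsto_id.prodMk h.tendsto

/-- The polynomials of two expansions of one arc agree modulo `x^N`, even if they are not Taylor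
polynomials. The finer blow-up therefore factors through the coarser one by another blow-up, of
order `N' - N`. -/
theorem IsExpansion.exists_refine {σ w w' : ℝ → Fin m → ℝ} {N N' : ℕ} {P P' : Fin m → Polynomial ℝ}
    (h : IsExpansion σ N P w) (h' : IsExpansion σ N' P' w') (hN : N ≤ N') :
    ∃ R : Fin m → Polynomial ℝ, (∀ i, (R i).eval 0 = 0) ∧
      (∀ q, curvePoint P' N' q = curvePoint P N (q.1, curvePoint R (N' - N) q)) ∧
      ∀ᶠ x in 𝓝[≠] (0 : ℝ), w x = curvePoint R (N' - N) (x, w' x) := by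
  have hpow : ∀ x : ℝ, x ^ N * x ^ (N' - N) = x ^ N' := fun x => by
    rw [← pow_add, Nat.add_sub_cancel' hN]
  have hx : Tendsto (fun x : ℝ => x ^ (N' - N)) (𝓝[≠] 0) (𝓝 (0 ^ (N' - N))) :=
    (Continuous.tendsto (by fun_prop) _).mono_left nhdsWithin_le_nhds
  have key : ∀ i, ∃ R : Polynomial ℝ, P' i - P i = Polynomial.X ^ N * R ∧ R.eval 0 = 0 := by
    intro i
    refine Polynomial.exists_eq_X_pow_mul_of_eventuallyEq N
      (w := fun x => w x i - x ^ (N' - N) * w' x i) ?_ ?_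
    · filter_upwards [h.eq, h'.eq] with x hx hx'
      have := congrFun (hx.symm.trans hx') i
      simp only [curvePoint] at this
      rw [Polynomial.eval_sub, mul_sub, ← mul_assoc, hpow]
      linarith
    · have h1 := (tendsto_pi_nhds.1 h.tendsto i).sub (hx.mul (tendsto_pi_nhds.1 h'.tendsto i))
      simpa using h1
  choose R hR hR0 using key
  have hq : ∀ q, curvePoint P' N' q = curvePoint P N (q.1, curvePoint R (N' - N) q) := by
    intro q
    ext i
    have := congrArg (Polynomial.eval q.1) (hR i)
    simp only [Polynomial.eval_sub, Polynomial.eval_mul, Polynomial.eval_pow,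
      Polynomial.eval_X] at this
    simp only [curvePoint, mul_add, ← this, ← mul_assoc, hpow]
    ring
  refine ⟨R, hR0, hq, ?_⟩
  filter_upwards [h.eq, h'.eq, self_mem_nhdsWithin] with x hx hx' hx0
  have hx0 : x ≠ 0 := hx0
  have h1 := curvePoint_sub P N x (w x) (curvePoint R (N' - N) (x, w' x))
  rw [← hx, ← hq (x, w' x), ← hx', sub_self] at h1
  have h2 := (smul_eq_zero.1 h1.symm).resolve_left (pow_ne_zero _ hx0)
  exact sub_eq_zero.1 h2

end Expansion

/-! ### Estimates relative to the arc in blown-up coordinates. -/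

section SmallAlong

variable {m n : ℕ}

/-- `E(x, w) = O(|x|^L |w - w₀(x)|^k + c |x|^n)` for every `n`. -/
def SmallAlong (c : ℝ) (L k : ℕ) (w : ℝ → Fin m → ℝ) (E : ℝ × (Fin m → ℝ) → ℝ) : Prop :=
  ∀ n : ℕ, ∃ C, ∀ᶠ q in paramFilter m,
    |E q| ≤ C * (|q.1| ^ L * ‖q.2 - w q.1‖ ^ k + c * |q.1| ^ n)

variable {c : ℝ} {L k : ℕ} {w : ℝ → Fin m → ℝ} {E E' : ℝ × (Fin m → ℝ) → ℝ}

theorem SmallAlong.exists_nonneg (hc : 0 ≤ c) (h : SmallAlong c L k w E) (n : ℕ) :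
    ∃ C, 0 ≤ C ∧ ∀ᶠ q in paramFilter m,
      |E q| ≤ C * (|q.1| ^ L * ‖q.2 - w q.1‖ ^ k + c * |q.1| ^ n) := by
  obtain ⟨C, hC⟩ := h n
  refine ⟨max C 0, le_max_right _ _, ?_⟩
  filter_upwards [hC] with q hq
  exact hq.trans (mul_le_mul_of_nonneg_right (le_max_left _ _) (by positivity))

theorem SmallAlong.of_abs_le {K : ℝ} (hK : 0 ≤ K) (h : SmallAlong c L k w E)
    (hE : ∀ᶠ q in paramFilter m, |E' q| ≤ K * |E q|) : SmallAlong c L k w E' := by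
  intro n
  obtain ⟨C, hC⟩ := h n
  refine ⟨K * C, ?_⟩
  filter_upwards [hC, hE] with q hq hq'
  refine hq'.trans ?_
  rw [mul_assoc]
  exact mul_le_mul_of_nonneg_left hq hK

theorem SmallAlong.congr (h : SmallAlong c L k w E) (hE : ∀ᶠ q in paramFilter m, E' q = E q) :
    SmallAlong c L k w E' :=
  h.of_abs_le zero_le_one (hE.mono fun q hq => by rw [hq, one_mul])

theorem SmallAlong.add (h : SmallAlong c L k w E) (h' : SmallAlong c L k w E') : SmallAlong c L k w fun q => E q + E' q := by
  intro n
  obtain ⟨C, hC⟩ := h n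
  obtain ⟨C', hC'⟩ := h' n
  refine ⟨C + C', ?_⟩
  filter_upwards [hC, hC'] with q hq hq'
  rw [add_mul]
  exact (abs_add_le _ _).trans (add_le_add hq hq')

theorem SmallAlong.zero : SmallAlong c L k w fun _ => 0 := by
  intro n
  exact ⟨0, Eventually.of_forall fun q => by simp⟩

theorem eventually_norm_sub_le_one (hw : Tendsto w (𝓝[≠] 0) (𝓝 0)) :
    ∀ᶠ q in paramFilter m, ‖q.2 - w q.1‖ ≤ 1 := by
  have h : Tendsto (fun q : ℝ × (Fin m → ℝ) => ‖q.2 - w q.1‖) (paramFilter m) (𝓝 ‖(0 : Fin m → ℝ) - 0‖) :=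
    (tendsto_snd.sub (hw.comp tendsto_fst)).norm
  rw [sub_zero, norm_zero] at h
  exact h.eventually (ge_mem_nhds one_pos)

theorem SmallAlong.mono (hc : 0 ≤ c) (hw : Tendsto w (𝓝[≠] 0) (𝓝 0)) (h : SmallAlong c L k w E)
    {L' k' : ℕ} (hL : L' ≤ L) (hk : k' ≤ k) : SmallAlong c L' k' w E := by
  intro n
  obtain ⟨C, hC0, hC⟩ := h.exists_nonneg hc n
  refine ⟨C, ?_⟩
  filter_upwards [hC, eventually_norm_sub_le_one hw, eventually_paramFilter_abs_le_one]
    with q hq hq1 hq2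
  refine hq.trans ?_
  have h1 := pow_le_pow_of_le_one (norm_nonneg _) hq1 hk
  have h2 := pow_le_pow_of_le_one (abs_nonneg _) hq2 hL
  gcongr

theorem SmallAlong.exists_le_pow (hc : 0 ≤ c) (hw : Tendsto w (𝓝[≠] 0) (𝓝 0))
    (h : SmallAlong c L k w E) : ∃ C, 0 ≤ C ∧ ∀ᶠ q in paramFilter m, |E q| ≤ C * |q.1| ^ L := by
  obtain ⟨C, hC0, hC⟩ := (h.mono hc hw le_rfl (Nat.zero_le k)).exists_nonneg hc L
  refine ⟨C * (1 + c), by positivity, hC.mono fun q hq => hq.trans (le_of_eq ?_)⟩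
  ring

theorem SmallAlong.of_pow_mul {d : ℕ}
    (h : SmallAlong c (L + d) k w fun q => q.1 ^ d * E q) : SmallAlong c L k w E := by
  intro n
  obtain ⟨C, hC⟩ := h (n + d)
  refine ⟨C, ?_⟩
  filter_upwards [hC, eventually_paramFilter_ne] with q hq hq0
  have h1 : 0 < |q.1| ^ d := by positivity
  rw [abs_mul, abs_pow] at hq
  refine le_of_mul_le_mul_left (hq.trans (le_of_eq ?_)) h1
  rw [pow_add, pow_add]; ring

theorem tendsto_refine {R : Fin m → Polynomial ℝ} (hR : ∀ i, (R i).eval 0 = 0) (M : ℕ) :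
    Tendsto (fun q : ℝ × (Fin m → ℝ) => (q.1, curvePoint R M q)) (paramFilter m) (paramFilter m) :=
  tendsto_fst.prodMk ((tendsto_curvePoint hR M).mono_left paramFilter_le_nhds)

/-- A further blow-up of order `M` multiplies the distance to the arc by `|x|^M`, so vanishing of
order `k` along the arc gains `x^(M k)`. -/
theorem SmallAlong.refine {w' : ℝ → Fin m → ℝ} {R : Fin m → Polynomial ℝ} {M : ℕ}
    (hR : ∀ i, (R i).eval 0 = 0) (hw : ∀ᶠ x in 𝓝[≠] (0 : ℝ), w x = curvePoint R M (x, w' x))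
    (h : SmallAlong c 0 k w E) :
    SmallAlong c (M * k) k w' fun q => E (q.1, curvePoint R M q) := by
  intro n
  obtain ⟨C, hC⟩ := h n
  refine ⟨C, ?_⟩
  filter_upwards [(tendsto_refine hR M).eventually hC, hw.prod_inl _] with q hq hwq
  refine hq.trans (le_of_eq ?_)
  have h1 : curvePoint R M q - curvePoint R M (q.1, w' q.1) = q.1 ^ M • (q.2 - w' q.1) :=
    curvePoint_sub R M q.1 q.2 (w' q.1)
  rw [hwq, h1, norm_smul, norm_pow, Real.norm_eq_abs, pow_zero, one_mul, mul_pow, ← pow_mul]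

end SmallAlong

/-! ### Approximation along a curve by simple functions. -/

section CurveApprox

variable {r : ℕ} {H : ℝ → Fin r → ℝ} {m n : ℕ} {c : ℝ}

/-- Along the curve `a + σ`, to any order, the function `f` is approximated, after the blow-up
`z = a + P(x) + x^N w` and up to a monomial, by simple functions of `x` with parameters `w`. -/
def CurveApprox (H : ℝ → Fin r → ℝ) (c : ℝ) (f : (Fin m → ℝ) → ℝ) (a : Fin m → ℝ)
    (σ : ℝ → Fin m → ℝ) : Prop :=
  ∀ k : ℕ, ∃ (d N : ℕ) (P : Fin m → Polynomial ℝ) (w : ℝ → Fin m → ℝ)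
    (g : ℝ × (Fin m → ℝ) → ℝ), IsExpansion σ N P w ∧ IsSimple H g ∧
    SmallAlong c 0 (k + 1) w fun q => q.1 ^ d * f (a + curvePoint P N q) - g q

theorem CurveApprox.congr {f f' : (Fin m → ℝ) → ℝ} {a : Fin m → ℝ} {σ : ℝ → Fin m → ℝ}
    (h : CurveApprox H c f a σ) (hf : f' =ᶠ[𝓝 a] f) : CurveApprox H c f' a σ := by
  intro k
  obtain ⟨d, N, P, w, g, hw, hg, hs⟩ := h k
  refine ⟨d, N, P, w, g, hw, hg, hs.congr ?_⟩
  filter_upwards [(tendsto_add_curvePoint hw.eval_zero N a).eventually hf] with q hq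
  rw [hq]

/-- Normal form of the approximation. After enough blowing up, the error is so small compared with
`x^d` that boundedness of `f` makes the approximant divisible by `x^d`, so the monomial disappears.
Moreover every expansion of large order `N` is allowed, so several functions can share one. -/
theorem CurveApprox.exists_isSimple (hH : ∀ j, ContDiffAt ℝ ∞ (fun t => H t j) 0) (hc : 0 ≤ c)
    {f : (Fin m → ℝ) → ℝ} {a : Fin m → ℝ} {σ : ℝ → Fin m → ℝ} (h : CurveApprox H c f a σ)
    (hf : ContinuousAt f a) (k L : ℕ) : ∃ N₀, ∀ N ≥ N₀, ∀ P w, IsExpansion σ N P w →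
      ∃ g, IsSimple H g ∧
        SmallAlong c (N + L) (k + 1) w fun q => f (a + curvePoint P N q) - g q := by
  -- The exponent `k + 2 ≥ 2` gives a gain of at least `x^(2(N - N₁))`, which beats `x^(N + L + d)`
  -- once `N ≥ 2 N₁ + d + L`; order `k = 0` itself would only give `x^(N - N₁)`.
  obtain ⟨d, N₁, P₁, w₁, g₁, hw₁, hg₁, hs₁⟩ := h (k + 1)
  refine ⟨2 * N₁ + d + L, fun N hN P w hw => ?_⟩
  obtain ⟨R, hR0, hRP, hRw⟩ := hw₁.exists_refine hw (by omega)
  set M := N - N₁ with hM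
  have hg₂ : IsSimple H fun q : ℝ × (Fin m → ℝ) => g₁ (q.1, curvePoint R M q) :=
    hg₁.comp (fun i => isSimple_curvePoint H R M i) fun i => by rw [curvePoint_zero hR0]; rfl
  have hs₂ := (hs₁.refine hR0 hRw).mono hc hw.tendsto (L' := N + L + d) (k' := k + 1)
    (by nlinarith [Nat.zero_le (M * k), show N + L + d ≤ 2 * M by omega]) (by omega)
  simp only [← hRP] at hs₂
  obtain ⟨C, hC0, hC⟩ := hs₂.exists_le_pow hc hw.tendsto
  have hfb : ∀ᶠ z in 𝓝 a, |f z| ≤ |f a| + 1 :=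
    hf.abs.eventually (ge_mem_nhds (by linarith))
  obtain ⟨g, hg, hgg⟩ := hg₂.exists_eq_pow_mul hH d ⟨(|f a| + 1) + C, by
    filter_upwards [hC, (tendsto_add_curvePoint hw.eval_zero N a).eventually hfb,
      eventually_paramFilter_abs_le_one] with q hq hqf hq1
    have h1 : |q.1| ^ (N + L + d) ≤ |q.1| ^ d :=
      pow_le_pow_of_le_one (abs_nonneg _) hq1 (by omega)
    have h2 : |q.1 ^ d * f (a + curvePoint P N q)| ≤ |q.1| ^ d * (|f a| + 1) := by
      rw [abs_mul, abs_pow]; gcongr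
    have h3 := abs_sub_abs_le_abs_sub (g₁ (q.1, curvePoint R M q))
      (q.1 ^ d * f (a + curvePoint P N q))
    rw [abs_sub_comm] at h3
    have h4 := mul_le_mul_of_nonneg_left h1 hC0
    linarith⟩
  refine ⟨g, hg, SmallAlong.of_pow_mul (d := d) (hs₂.congr ?_)⟩
  filter_upwards [paramFilter_le_nhds hgg] with q hq
  rw [hq, mul_sub]

/-- The function `u` is flat at the origin, and eventually zero if `c = 0`. -/
def FlatMod (c : ℝ) (u : ℝ → ℝ) : Prop :=
  ∀ n : ℕ, ∃ C, ∀ᶠ x in 𝓝[≠] (0 : ℝ), |u x| ≤ C * (c * |x| ^ n)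

/-- Along a simple curve, `f` is simple up to a flat function. -/
theorem CurveApprox.exists_isSimpleFun (hH : ∀ j, ContDiffAt ℝ ∞ (fun t => H t j) 0) (hc : 0 ≤ c)
    {f : (Fin m → ℝ) → ℝ} {a : Fin m → ℝ} {σ : ℝ → Fin m → ℝ} (h : CurveApprox H c f a σ)
    (hf : ContinuousAt f a) (hσ : ∀ i, IsSimpleFun H fun x => σ x i) (hσ0 : σ 0 = 0) :
    ∃ u, IsSimpleFun H u ∧ FlatMod c fun x => f (a + σ x) - u x := by
  have hσs : ContDiffAt ℝ ∞ σ 0 := contDiffAt_pi.2 fun i => (hσ i).contDiffAt hH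
  obtain ⟨N, hN⟩ := h.exists_isSimple hH hc hf 0 0
  obtain ⟨P, w, hw⟩ := exists_isExpansion hσs hσ0 N
  obtain ⟨g, hg, hs⟩ := hN N le_rfl P w hw
  have hwi : ∀ i, ∃ w', IsSimpleFun H w' ∧ w' 0 = 0 ∧ ∀ᶠ x in 𝓝[≠] (0 : ℝ), w x i = w' x :=
    fun i => (hσ i).exists_remainder hH (P := P i) (N := N) (tendsto_pi_nhds.1 hw.tendsto i)
      (hw.eq.mono fun x hx => congrFun hx i)
  choose w' hw' hw0 hww using hwi
  -- On the arc itself `w = w₀(x)`, the main term of the error vanishes and only the flat term, with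
  -- its factor `c`, remains.
  refine ⟨_, hg.comp_simpleFun (u := fun x i => w' i x) hw' (funext hw0), fun n => ?_⟩
  obtain ⟨C, hC⟩ := hs n
  refine ⟨C, ?_⟩
  filter_upwards [hw.tendsto_paramFilter.eventually hC, hw.eq, eventually_all.2 hww]
    with x hx hσx hwx
  simp only [sub_self, norm_zero, zero_add, pow_one, mul_zero] at hx
  rw [← hσx] at hx
  rwa [show (fun i => w' i x) = w x from funext fun i => (hwx i).symm]

theorem IsSimpleFun.congr {u v : ℝ → ℝ} (hu : IsSimpleFun H u) (h : ∀ᶠ x in 𝓝 (0 : ℝ), v x = u x) :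
    IsSimpleFun H v := by
  obtain ⟨g, hg, hug⟩ := hu
  refine ⟨g, hg, ?_⟩
  filter_upwards [hug, h] with x h1 h2
  rw [h2, h1]

theorem eventually_eq_of_punctured {u v : ℝ → ℝ} (hu : ContinuousAt u 0) (hv : ContinuousAt v 0)
    (h : ∀ᶠ x in 𝓝[≠] (0 : ℝ), u x = v x) : ∀ᶠ x in 𝓝 (0 : ℝ), u x = v x := by
  have h0 : u 0 = v 0 := tendsto_nhds_unique ((hu.tendsto.mono_left nhdsWithin_le_nhds).congr' h)
    (hv.tendsto.mono_left nhdsWithin_le_nhds)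
  rw [eventually_nhdsWithin_iff] at h
  filter_upwards [h] with x hx
  by_cases hx0 : x = 0
  · rw [hx0, h0]
  · exact hx hx0

/-- In the exact mode, the composition with a simple curve is simple. -/
theorem CurveApprox.isSimpleFun (hH : ∀ j, ContDiffAt ℝ ∞ (fun t => H t j) 0)
    {f : (Fin m → ℝ) → ℝ} {a : Fin m → ℝ} {σ : ℝ → Fin m → ℝ} (h : CurveApprox H 0 f a σ)
    (hf : ContinuousAt f a) (hσ : ∀ i, IsSimpleFun H fun x => σ x i) (hσ0 : σ 0 = 0) :
    IsSimpleFun H fun x => f (a + σ x) := by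
  obtain ⟨u, hu, hfu⟩ := h.exists_isSimpleFun hH le_rfl hf hσ hσ0
  obtain ⟨C, hC⟩ := hfu 0
  have hσs : ContDiffAt ℝ ∞ σ 0 := contDiffAt_pi.2 fun i => (hσ i).contDiffAt hH
  refine hu.congr (eventually_eq_of_punctured ?_ (hu.contDiffAt hH).continuousAt ?_)
  · refine ContinuousAt.comp_of_eq (g := f) hf (continuousAt_const.add hσs.continuousAt) ?_
    rw [hσ0, add_zero]
  · filter_upwards [hC] with x hx
    rw [zero_mul, mul_zero] at hx
    exact sub_eq_zero.1 (abs_nonpos_iff.1 hx)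

end CurveApprox

/-! ### Lifting smooth maps to blow-ups. -/

section Lift

variable {r : ℕ} {H : ℝ → Fin r → ℝ} {m n : ℕ} {c : ℝ}

theorem ContDiffAt.exists_norm_sub_le {X Y : Type*} [NormedAddCommGroup X] [NormedSpace ℝ X]
    [NormedAddCommGroup Y] [NormedSpace ℝ Y] {f : X → Y} {z : X} {k : ℕ∞ω} (hf : ContDiffAt ℝ k f z)
    (hk : k ≠ 0) : ∃ C, 0 ≤ C ∧ ∀ᶠ p in 𝓝 (z, z), ‖f p.1 - f p.2‖ ≤ C * ‖p.1 - p.2‖ := by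
  obtain ⟨C, hC0, hC⟩ := (hf.hasStrictFDerivAt hk).isBigO_sub.exists_nonneg
  exact ⟨C, hC0, hC.bound⟩

theorem SmallAlong.sum_abs {L k : ℕ} {w : ℝ → Fin n → ℝ} {E : Fin m → ℝ × (Fin n → ℝ) → ℝ}
    (h : ∀ i, SmallAlong c L k w (E i)) : SmallAlong c L k w fun q => ∑ i, |E i q| := by
  classical
  have : ∀ s : Finset (Fin m), SmallAlong c L k w fun q => ∑ i ∈ s, |E i q| := by
    intro s
    induction s using Finset.induction_on with
    | empty => simpa using SmallAlong.zero
    | insert i s hi ih =>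
      simp only [Finset.sum_insert hi]
      exact ((h i).of_abs_le zero_le_one (Eventually.of_forall fun q => by simp)).add ih
  exact this _

theorem norm_pi_le_sum (v : Fin m → ℝ) : ‖v‖ ≤ ∑ i, |v i| :=
  (pi_norm_le_iff_of_nonneg (Finset.sum_nonneg fun _ _ => abs_nonneg _)).2 fun i =>
    Finset.single_le_sum (f := fun i => |v i|) (fun _ _ => abs_nonneg _) (Finset.mem_univ i)

theorem tendsto_prodMk_of_norm_sub_le {w : ℝ → Fin n → ℝ} {w' : ℝ → Fin m → ℝ}
    (hw : Tendsto w (𝓝[≠] 0) (𝓝 0)) (hw' : Tendsto w' (𝓝[≠] 0) (𝓝 0))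
    {v : ℝ × (Fin n → ℝ) → Fin m → ℝ} {C : ℝ}
    (hv : ∀ᶠ q in paramFilter n, ‖v q - w' q.1‖ ≤ C * ‖q.2 - w q.1‖) :
    Tendsto (fun q => (q.1, v q)) (paramFilter n) (paramFilter m) := by
  refine tendsto_fst.prodMk ?_
  have h1 : Tendsto (fun q : ℝ × (Fin n → ℝ) => q.2 - w q.1) (paramFilter n) (𝓝 0) := by
    simpa using tendsto_snd.sub (hw.comp tendsto_fst)
  have h2 : Tendsto (fun q : ℝ × (Fin n → ℝ) => C * ‖q.2 - w q.1‖) (paramFilter n) (𝓝 0) := by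
    simpa using h1.norm.const_mul C
  simpa using (squeeze_zero_norm' hv h2).add (hw'.comp tendsto_fst)

/-- A smooth map sends the blow-up along a curve to the blow-up along its image. -/
theorem exists_lift {G : (Fin n → ℝ) → Fin m → ℝ} {a : Fin n → ℝ} (hG : ContDiffAt ℝ ∞ G a)
    {σ w : ℝ → Fin n → ℝ} {N : ℕ} {P : Fin n → Polynomial ℝ} (hw : IsExpansion σ N P w)
    {N' : ℕ} {Q : Fin m → Polynomial ℝ} {w' : ℝ → Fin m → ℝ}
    (hw' : IsExpansion (fun x => G (a + σ x) - G a) N' Q w') (hN : N' ≤ N) :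
    ∃ (v : ℝ × (Fin n → ℝ) → Fin m → ℝ) (C : ℝ), 0 ≤ C ∧
      (∀ᶠ q in paramFilter n, G (a + curvePoint P N q) = G a + curvePoint Q N' (q.1, v q)) ∧
      (∀ᶠ q in paramFilter n, ‖v q - w' q.1‖ ≤ C * ‖q.2 - w q.1‖) ∧
      Tendsto (fun q => (q.1, v q)) (paramFilter n) (paramFilter m) := by
  obtain ⟨C, hC0, hC⟩ := hG.exists_norm_sub_le (by simp)
  let v : ℝ × (Fin n → ℝ) → Fin m → ℝ := fun q i =>
    (G (a + curvePoint P N q) i - G a i - (Q i).eval q.1) / q.1 ^ N'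
  have h1 : ∀ᶠ q in paramFilter n, G (a + curvePoint P N q) = G a + curvePoint Q N' (q.1, v q) := by
    filter_upwards [eventually_paramFilter_ne] with q hq
    ext i
    simp only [Pi.add_apply, curvePoint, v]
    field_simp
    ring
  have ht : Tendsto (fun q : ℝ × (Fin n → ℝ) => (a + curvePoint P N q, a + curvePoint P N (q.1, w q.1)))
      (paramFilter n) (𝓝 (a, a)) := by
    refine (tendsto_add_curvePoint hw.eval_zero N a).prodMk_nhds ?_
    exact (tendsto_add_curvePoint hw.eval_zero N a).comp (hw.tendsto_paramFilter.comp tendsto_fst)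
  have h2 : ∀ᶠ q in paramFilter n, ‖v q - w' q.1‖ ≤ C * ‖q.2 - w q.1‖ := by
    filter_upwards [h1, ht.eventually hC, hw.eq.prod_inl _, hw'.eq.prod_inl _,
      eventually_paramFilter_ne, eventually_paramFilter_abs_le_one] with q hq hqC hqσ hqσ' hq0 hq1
    rw [← hqσ, hq] at hqC
    have e1 : G (a + σ q.1) = G a + curvePoint Q N' (q.1, w' q.1) := by rw [← hqσ']; abel
    have e2 : a + curvePoint P N q - (a + σ q.1) = q.1 ^ N • (q.2 - w q.1) := by
      rw [hqσ, add_sub_add_left_eq_sub]; exact curvePoint_sub P N q.1 q.2 _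
    rw [e1, add_sub_add_left_eq_sub, curvePoint_sub, e2, norm_smul, norm_smul, norm_pow, norm_pow,
      Real.norm_eq_abs] at hqC
    have h3 : 0 < |q.1| ^ N' := by positivity
    refine le_of_mul_le_mul_left (hqC.trans ?_) h3
    have h4 := pow_le_pow_of_le_one (abs_nonneg q.1) hq1 hN
    calc C * (|q.1| ^ N * ‖q.2 - w q.1‖) ≤ C * (|q.1| ^ N' * ‖q.2 - w q.1‖) := by gcongr
      _ = _ := by ring
  exact ⟨v, C, hC0, h1, h2, tendsto_prodMk_of_norm_sub_le hw.tendsto hw'.tendsto h2⟩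

theorem SmallAlong.comp_lift {L k : ℕ} {w : ℝ → Fin n → ℝ} {w' : ℝ → Fin m → ℝ}
    {E : ℝ × (Fin m → ℝ) → ℝ} (hc : 0 ≤ c) (h : SmallAlong c L k w' E)
    {v : ℝ × (Fin n → ℝ) → Fin m → ℝ} {C : ℝ} (hC : 0 ≤ C)
    (hv : ∀ᶠ q in paramFilter n, ‖v q - w' q.1‖ ≤ C * ‖q.2 - w q.1‖)
    (ht : Tendsto (fun q => (q.1, v q)) (paramFilter n) (paramFilter m)) :
    SmallAlong c L k w fun q => E (q.1, v q) := by
  intro N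
  obtain ⟨B, hB0, hB⟩ := h.exists_nonneg hc N
  refine ⟨B * (C ^ k + 1), ?_⟩
  filter_upwards [ht.eventually hB, hv] with q hq hqv
  refine hq.trans ?_
  have h1 : ‖v q - w' q.1‖ ^ k ≤ C ^ k * ‖q.2 - w q.1‖ ^ k := by
    rw [← mul_pow]; gcongr
  rw [mul_assoc]
  refine mul_le_mul_of_nonneg_left ?_ hB0
  have h2 : 0 ≤ |q.1| ^ L * ‖q.2 - w q.1‖ ^ k := by positivity
  have h3 : 0 ≤ C ^ k * (c * |q.1| ^ N) := by positivity
  have h4 : |q.1| ^ L * ‖v q - w' q.1‖ ^ k ≤ |q.1| ^ L * (C ^ k * ‖q.2 - w q.1‖ ^ k) := by gcongr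
  nlinarith

end Lift

/-! ### Stability under composition and under implicit equations. -/

section Composition

variable {r : ℕ} {H : ℝ → Fin r → ℝ} {m n : ℕ} {c : ℝ}

/-- In blown-up coordinates `G` becomes a map `v(x, w)` that is Lipschitz relative to the arcs, so
the error of `f` pulls back. The approximants of `G` give a simple `u` close to `v`, and the
approximant of `f` is Lipschitz in its parameters, so `u` may replace `v` in it. -/
theorem CurveApprox.comp (hH : ∀ j, ContDiffAt ℝ ∞ (fun t => H t j) 0) (hc : 0 ≤ c)
    {f : (Fin m → ℝ) → ℝ} {G : (Fin n → ℝ) → Fin m → ℝ} {a : Fin n → ℝ} {σ : ℝ → Fin n → ℝ}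
    (hσ : ContDiffAt ℝ ∞ σ 0) (hσ0 : σ 0 = 0) (hG : ContDiffAt ℝ ∞ G a)
    (hGa : ∀ i, CurveApprox H c (fun z => G z i) a σ)
    (hf : CurveApprox H c f (G a) fun x => G (a + σ x) - G a) :
    CurveApprox H c (fun z => f (G z)) a σ := by
  intro k
  obtain ⟨d, N', Q, w', g', hw', hg', hs'⟩ := hf k
  have hGi : ∀ i, ContDiffAt ℝ ∞ (fun z => G z i) a := contDiffAt_pi.1 hG
  -- The extra power `L = 1` leaves `v - u = O(x)` after division by `x^N'`. Hence `u` vanishes at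
  -- the origin and can be substituted into a simple function.
  choose N₀ hN₀ using fun i => (hGa i).exists_isSimple hH hc (hGi i).continuousAt k 1
  let N := max N' (Finset.univ.sup N₀)
  have hNN : N' ≤ N := le_max_left _ _
  have hN₀N : ∀ i, N₀ i ≤ N := fun i => (Finset.le_sup (Finset.mem_univ i)).trans (le_max_right _ _)
  obtain ⟨P, w, hw⟩ := exists_isExpansion hσ hσ0 N
  choose g hg hs using fun i => hN₀ i N (hN₀N i) P w hw
  obtain ⟨v, C, hC0, hv, hvw, hvt⟩ := exists_lift hG hw hw' hNN
  have hGv : ∀ i, ∀ᶠ q in paramFilter n,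
      G (a + curvePoint P N q) i = G a i + ((Q i).eval q.1 + q.1 ^ N' * v q i) :=
    fun i => hv.mono fun q hq => congrFun hq i
  have hv1 : ∀ i, ∀ᶠ q in paramFilter n, |v q i| ≤ 1 := by
    intro i
    have h1 := (tendsto_pi_nhds.1 (tendsto_snd.comp hvt) i).abs
    rw [Pi.zero_apply, abs_zero] at h1
    exact h1.eventually (ge_mem_nhds one_pos)
  have hvS : ∀ i, ∃ u, IsSimple H u ∧
      ∀ᶠ q in 𝓝 0, g i q - G a i - (Q i).eval q.1 = q.1 ^ N' * u q := by
    intro i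
    obtain ⟨B, hB0, hB⟩ := (hs i).exists_le_pow hc hw.tendsto
    refine (((hg i).sub_const (G a i)).sub (IsSimple.poly (Q i))).exists_eq_pow_mul hH N'
      ⟨1 + B, ?_⟩
    filter_upwards [hB, hGv i, hv1 i, eventually_paramFilter_abs_le_one] with q hq hqG hq1 hqx
    have e1 : g i q - G a i - (Q i).eval q.1 = q.1 ^ N' * v q i - (G (a + curvePoint P N q) i - g i q) := by
      rw [hqG]; ring
    have h2 : |q.1| ^ (N + 1) ≤ |q.1| ^ N' := pow_le_pow_of_le_one (abs_nonneg _) hqx (by omega)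
    rw [e1]
    refine (abs_sub _ _).trans ?_
    rw [abs_mul, abs_pow, add_mul, mul_comm]
    gcongr
    exact hq.trans (by gcongr)
  choose u hu hgu using hvS
  have hdiff : ∀ i, ∀ᶠ q in paramFilter n,
      q.1 ^ N' * (v q i - u i q) = G (a + curvePoint P N q) i - g i q := by
    intro i
    filter_upwards [hGv i, paramFilter_le_nhds (hgu i)] with q hq1 hq2
    rw [mul_sub, ← hq2, hq1]; ring
  have hvu : ∀ i, SmallAlong c 1 (k + 1) w fun q => v q i - u i q := fun i =>
    SmallAlong.of_pow_mul (d := N') (((hs i).mono hc hw.tendsto (by omega) le_rfl).congr (hdiff i))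
  have hu0 : ∀ i, u i 0 = 0 := by
    intro i
    obtain ⟨B, hB0, hB⟩ := (hvu i).exists_le_pow hc hw.tendsto
    have h1 : Tendsto (fun q => v q i - u i q) (paramFilter n) (𝓝 0) := by
      refine squeeze_zero_norm' hB ?_
      have : Tendsto (fun q : ℝ × (Fin n → ℝ) => B * |q.1| ^ 1) (𝓝 0) (𝓝 0) :=
        Continuous.tendsto' (by fun_prop) _ _ (by simp)
      exact this.mono_left paramFilter_le_nhds
    have h2 := (tendsto_pi_nhds.1 (tendsto_snd.comp hvt) i).sub h1
    have h3 : Tendsto (u i) (paramFilter n) (𝓝 (u i 0)) :=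
      ((hu i).contDiffAt hH).continuousAt.tendsto.mono_left paramFilter_le_nhds
    refine tendsto_nhds_unique h3 (by simpa using h2)
  refine ⟨d, N, P, w, _, hw, hg'.comp hu hu0, ?_⟩
  have hA := hs'.comp_lift hc hC0 hvw hvt
  obtain ⟨B, hB0, hB⟩ := (hg'.contDiffAt hH).exists_norm_sub_le (by simp)
  have hut : Tendsto (fun q => (q.1, fun i => u i q)) (paramFilter n) (𝓝 0) := by
    refine Tendsto.mono_left ?_ paramFilter_le_nhds
    refine (continuous_fst.tendsto' _ _ rfl).prodMk_nhds (tendsto_pi_nhds.2 fun i => ?_)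
    have := ((hu i).contDiffAt hH).continuousAt.tendsto
    rwa [hu0] at this
  have hBv : ∀ᶠ q in paramFilter n,
      |g' (q.1, v q) - g' (q.1, fun i => u i q)| ≤ B * abs (∑ i, |v q i - u i q|) := by
    filter_upwards [((hvt.mono_right paramFilter_le_nhds).prodMk_nhds hut).eventually hB] with q hq
    refine hq.trans (mul_le_mul_of_nonneg_left ?_ hB0)
    refine (norm_prod_le_iff.2 ⟨?_, ?_⟩ : _ ≤ ∑ i, |v q i - u i q|).trans (le_abs_self _)
    · simpa using Finset.sum_nonneg fun i _ => abs_nonneg _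
    · exact norm_pi_le_sum _
  have hD := (SmallAlong.sum_abs hvu).mono hc hw.tendsto (Nat.zero_le 1) le_rfl
  refine (hA.add (hD.of_abs_le hB0 hBv)).congr ?_
  filter_upwards [hv] with q hq
  rw [hq]
  ring

/-- Approximation along curves passes to functions defined by an implicit equation. -/
theorem CurveApprox.implicit (hH : ∀ j, ContDiffAt ℝ ∞ (fun t => H t j) 0) (hc : 0 ≤ c)
    {f : (Fin (m + 1) → ℝ) → ℝ} {h : (Fin m → ℝ) → ℝ} {a : Fin m → ℝ} {γ : ℝ → Fin m → ℝ}
    (hγ : ContDiffAt ℝ ∞ γ 0) (hγ0 : γ 0 = 0) (hh : ContDiffAt ℝ ∞ h a)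
    (hf : ContDiffAt ℝ ∞ f (Fin.snoc a (h a) : Fin (m + 1) → ℝ))
    (hd : fderiv ℝ f (Fin.snoc a (h a) : Fin (m + 1) → ℝ) (Pi.single (Fin.last m) 1) ≠ 0)
    (hfh : ∀ᶠ z in 𝓝 a, f (Fin.snoc z (h z) : Fin (m + 1) → ℝ) = 0)
    (hfa : CurveApprox H c f (Fin.snoc a (h a) : Fin (m + 1) → ℝ) fun x =>
      (Fin.snoc (a + γ x) (h (a + γ x)) : Fin (m + 1) → ℝ) - (Fin.snoc a (h a) : Fin (m + 1) → ℝ)) :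
    CurveApprox H c h a γ := by
  intro k
  let G : (Fin m → ℝ) → Fin (m + 1) → ℝ := fun z => Fin.snoc z (h z)
  have hG : ContDiffAt ℝ ∞ G a := contDiff_snoc.contDiffAt.comp a (contDiffAt_id.prodMk hh)
  let σ : ℝ → Fin (m + 1) → ℝ := fun x => G (a + γ x) - G a
  have hσ : ContDiffAt ℝ ∞ σ 0 := by
    refine ContDiffAt.sub (ContDiffAt.comp_of_eq (g := G) hG (contDiffAt_const.add hγ) ?_)
      contDiffAt_const
    simp [hγ0]
  have hσ0 : σ 0 = 0 := by simp [σ, hγ0]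
  obtain ⟨N₀, hN₀⟩ := hfa.exists_isSimple hH hc hf.continuousAt k 1
  -- `N ≥ 1` ensures that, for fixed `w`, the blown-up point tends to `G a` as `x → 0`.
  set N := max N₀ 1
  have hN1 : N ≠ 0 := by have := le_max_right N₀ 1; omega
  obtain ⟨Q, w', hw'⟩ := exists_isExpansion hσ hσ0 N
  obtain ⟨g, hg, hs⟩ := hN₀ N (le_max_left _ _) Q w' hw'
  let P : Fin m → Polynomial ℝ := fun i => Q i.castSucc
  let w : ℝ → Fin m → ℝ := fun x i => w' x i.castSucc
  have hw : IsExpansion γ N P w := by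
    refine ⟨fun i => hw'.eval_zero _, tendsto_pi_nhds.2 fun i => tendsto_pi_nhds.1 hw'.tendsto _, ?_⟩
    filter_upwards [hw'.eq] with x hx
    ext i
    have h1 := congrFun hx i.castSucc
    have h2 : γ x i = curvePoint Q N (x, w' x) i.castSucc := by simpa [σ, G] using h1
    exact h2
  obtain ⟨v, C, hC0, hv, hvw, hvt⟩ := exists_lift hG hw hw' le_rfl
  have hsw : ∀ᶠ x in 𝓝[≠] (0 : ℝ), f (G a + curvePoint Q N (x, w' x)) = 0 := by
    have h1 : Tendsto (fun x => a + γ x) (𝓝 0) (𝓝 a) := by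
      simpa [hγ0] using hγ.continuousAt.tendsto.const_add a
    filter_upwards [hw'.eq, (h1.eventually hfh).filter_mono nhdsWithin_le_nhds] with x hx hx'
    rw [← hx]
    simpa [σ, G] using hx'
  have hvz : ∀ᶠ q in paramFilter m, f (G a + curvePoint Q N (q.1, v q)) = 0 := by
    filter_upwards [hv, (tendsto_add_curvePoint hw.eval_zero N a).eventually hfh] with q hq hq'
    rw [← hq]; exact hq'
  have hvs : ∀ᶠ q in paramFilter m, v q = Fin.snoc q.2 (v q (Fin.last m)) := by
    filter_upwards [hv, eventually_paramFilter_ne] with q hq hq0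
    ext i
    refine Fin.lastCases (by simp) (fun j => ?_) i
    have := congrFun hq j.castSucc
    simp only [G, Fin.snoc_castSucc, Pi.add_apply, curvePoint, P, add_right_inj] at this
    rw [Fin.snoc_castSucc]
    exact (mul_left_cancel₀ (pow_ne_zero N hq0) this).symm
  have hpt : Tendsto (fun z : ℝ × (Fin (m + 1) → ℝ) =>
      (G a + curvePoint Q N z, G a + curvePoint Q N (z.1, w' z.1))) (paramFilter (m + 1))
      (𝓝 (G a, G a)) :=
    (tendsto_add_curvePoint hw'.eval_zero N (G a)).prodMk_nhds
      ((tendsto_add_curvePoint hw'.eval_zero N (G a)).comp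
        (hw'.tendsto_paramFilter.comp tendsto_fst))
  have hsub : ∀ x z, G a + curvePoint Q N (x, z) - (G a + curvePoint Q N (x, w' x)) =
      x ^ N • (z - w' x) := fun x z => by rw [add_sub_add_left_eq_sub, curvePoint_sub]
  -- As `f` vanishes on the graph arc, it is `O(x^N)` in the blow-up, hence so is `g`. The quotient
  -- tends to the differential of `f` at `G a`, which is `hlim`; here the error `O(x^(N+1))` is
  -- needed.
  obtain ⟨g₁, hg₁, hgg₁⟩ : ∃ g₁, IsSimple H g₁ ∧ ∀ᶠ z in 𝓝 0, g z = z.1 ^ N * g₁ z := by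
    obtain ⟨B, hB0, hB⟩ := hs.exists_le_pow hc hw'.tendsto
    obtain ⟨K, hK0, hK⟩ := hf.exists_norm_sub_le (by simp)
    refine hg.exists_eq_pow_mul hH N ⟨K + B, ?_⟩
    filter_upwards [hB, hpt.eventually hK, hsw.prod_inl _, eventually_paramFilter_abs_le_one,
      eventually_norm_sub_le_one hw'.tendsto] with z hz hzK hz0 hz1 hzw
    rw [hz0, sub_zero, hsub z.1 z.2, norm_smul, norm_pow, Real.norm_eq_abs, Real.norm_eq_abs] at hzK
    have e1 : g z = f (G a + curvePoint Q N z) - (f (G a + curvePoint Q N z) - g z) := by ring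
    have h2 : |z.1| ^ (N + 1) ≤ |z.1| ^ N := pow_le_pow_of_le_one (abs_nonneg _) hz1 (by omega)
    rw [e1]
    refine (abs_sub _ _).trans ?_
    rw [add_mul]
    refine add_le_add (hzK.trans ?_) (hz.trans ?_)
    · have h3 : |z.1| ^ N * ‖z.2 - w' z.1‖ ≤ |z.1| ^ N * 1 := by gcongr
      rw [mul_one] at h3
      exact mul_le_mul_of_nonneg_left h3 hK0
    · gcongr
  have hlim : ∀ᶠ z in 𝓝 (0 : Fin (m + 1) → ℝ),
      Tendsto (fun x => g₁ (x, z)) (𝓝[≠] 0) (𝓝 (fderiv ℝ f (G a) z)) := by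
    obtain ⟨B, hB0, hB⟩ := hs.exists_le_pow hc hw'.tendsto
    have hB' := (eventually_swap_iff.1 (hB.and (paramFilter_le_nhds hgg₁))).curry
    filter_upwards [hB'] with z hz
    have h1 : Tendsto (fun x => (G a + curvePoint Q N (x, z), G a + curvePoint Q N (x, w' x)))
        (𝓝[≠] 0) (𝓝 (G a, G a)) := by
      refine Tendsto.prodMk_nhds ?_
        ((tendsto_add_curvePoint hw'.eval_zero N (G a)).comp hw'.tendsto_paramFilter)
      have hcont : Continuous fun x : ℝ => G a + curvePoint Q N (x, z) :=
        continuous_const.add ((contDiff_curvePoint Q N (k := 0)).continuous.comp (by fun_prop))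
      refine (hcont.tendsto' _ _ ?_).mono_left nhdsWithin_le_nhds
      ext i
      simp [curvePoint, hw'.eval_zero, hN1]
    have h2 := ((hf.hasStrictFDerivAt (by simp)).isLittleO.comp_tendsto h1)
    have h3 : (fun x => f (G a + curvePoint Q N (x, z)) - x ^ N * fderiv ℝ f (G a) (z - w' x))
        =o[𝓝[≠] 0] fun x => x ^ N := by
      refine (h2.congr' (g₂ := fun x => x ^ N • (z - w' x)) ?_ ?_).trans_isBigO ?_
      · filter_upwards [hsw] with x hx
        simp only [Function.comp_apply, hsub, hx, sub_zero, map_smul, smul_eq_mul]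
        rfl
      · filter_upwards with x
        simp only [Function.comp_apply, hsub]
      · have h4 : (fun x => z - w' x) =O[𝓝[≠] 0] fun _ => (1 : ℝ) :=
          (tendsto_const_nhds.sub hw'.tendsto).isBigO_one ℝ
        simpa using (Asymptotics.isBigO_refl (fun x : ℝ => x ^ N) (𝓝[≠] 0)).smul h4
    have h5 := h3.tendsto_div_nhds_zero
    have h6 : Tendsto (fun x => fderiv ℝ f (G a) (z - w' x)) (𝓝[≠] 0)
        (𝓝 (fderiv ℝ f (G a) z)) := by
      have h7 : Tendsto (fun x => z - w' x) (𝓝[≠] 0) (𝓝 (z - 0)) :=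
        tendsto_const_nhds.sub hw'.tendsto
      rw [sub_zero] at h7
      exact ((fderiv ℝ f (G a)).continuous.tendsto z).comp h7
    have h8 : Tendsto (fun x : ℝ => B * |x|) (𝓝[≠] 0) (𝓝 0) :=
      (Continuous.tendsto' (by fun_prop) _ _ (by simp)).mono_left nhdsWithin_le_nhds
    have h9 : Tendsto (fun x => f (G a + curvePoint Q N (x, z)) / x ^ N - g₁ (x, z)) (𝓝[≠] 0)
        (𝓝 0) := by
      refine squeeze_zero_norm' ?_ h8
      filter_upwards [hz, self_mem_nhdsWithin] with x hx hx0
      have hx0 : x ≠ 0 := hx0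
      obtain ⟨hx1, hx2⟩ := hx
      simp only [Prod.swap_prod_mk] at hx1 hx2
      have hp : 0 < |x| ^ N := by positivity
      refine le_of_mul_le_mul_left (le_trans (le_of_eq ?_) (hx1.trans (le_of_eq ?_))) hp
      · change _ = |f (G a + curvePoint Q N (x, z)) - g (x, z)|
        rw [hx2, Real.norm_eq_abs, ← abs_pow, ← abs_mul]
        congr 1
        field_simp
      · rw [pow_succ]; ring
    have h10 := (h5.add h6).sub h9
    rw [zero_add, sub_zero] at h10
    refine h10.congr' ?_
    filter_upwards [self_mem_nhdsWithin] with x hx0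
    have hx0 : x ≠ 0 := hx0
    field_simp
    ring
  -- The simple solution `h₁` of `g₁ = 0` is compared with the last coordinate of the true lift `v`,
  -- where `f = 0`: the lower Lipschitz bound gives `c₀ |x|^N |v_last - h₁| ≤ |f - g|`.
  obtain ⟨h₁, hh₁, hh₁0, hz₁, c₀, hc₀, hlow⟩ := hg₁.exists_implicit hH _ hlim hd
  let gh : ℝ × (Fin m → ℝ) → ℝ := fun q =>
    (q.1 ^ N * h₁ q + (Q (Fin.last m)).eval q.1) - (- h a)
  have hgh : IsSimple H gh := by
    have hX : IsSimple H fun q : ℝ × (Fin m → ℝ) => q.1 ^ N :=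
      IsSimple.of_contDiffAt (by fun_prop)
    exact ((hX.mul hh₁).add (IsSimple.poly _)).sub_const _
  refine ⟨0, N, P, w, gh, hw, hgh, ?_⟩
  have hE := ((hs.comp_lift hc hC0 hvw hvt).mono hc hw.tendsto (Nat.zero_le _) le_rfl)
  refine hE.of_abs_le (K := c₀⁻¹) (by positivity) ?_
  have hlt : Tendsto (fun q : ℝ × (Fin m → ℝ) => (q, v q (Fin.last m), h₁ q)) (paramFilter m)
      (𝓝 0) := by
    refine (tendsto_id.mono_left paramFilter_le_nhds).prodMk_nhds (Tendsto.prodMk_nhds ?_ ?_)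
    · exact tendsto_pi_nhds.1 (tendsto_snd.comp hvt) (Fin.last m)
    · have := ((hh₁.contDiffAt hH).continuousAt.tendsto).mono_left (paramFilter_le_nhds (m := m))
      rwa [hh₁0] at this
  filter_upwards [hv, hvs, hvz, hlt.eventually hlow, paramFilter_le_nhds hz₁,
    (hvt.mono_right paramFilter_le_nhds).eventually hgg₁, eventually_paramFilter_ne]
    with q hq hqs hqz hqlow hqz₁ hqg hq0
  rw [hqz₁, sub_zero, ← hqs] at hqlow
  have e1 : h (a + curvePoint P N q) - gh q = q.1 ^ N * (v q (Fin.last m) - h₁ q) := by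
    have := congrFun hq (Fin.last m)
    simp only [G, Fin.snoc_last, Pi.add_apply, curvePoint] at this
    simp only [gh]
    rw [this]; ring
  simp only [pow_zero, one_mul]
  rw [e1]
  change _ ≤ c₀⁻¹ * |f (G a + curvePoint Q N (q.1, v q)) - g (q.1, v q)|
  rw [hqz, hqg, zero_sub, abs_neg, abs_mul, abs_mul, abs_pow]
  rw [← div_eq_inv_mul, le_div_iff₀ hc₀]
  have hp : 0 ≤ |q.1| ^ N := by positivity
  nlinarith [mul_le_mul_of_nonneg_left hqlow hp]

end Composition

/-! ### Arcs with a flat component and division of estimates by the corresponding parameter. -/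

section FlatMod

variable {m : ℕ} {c : ℝ}

theorem FlatMod.exists_one_le (hc : 0 ≤ c) {u : ℝ → ℝ} (h : FlatMod c u) (n : ℕ) :
    ∃ C, 1 ≤ C ∧ ∀ᶠ x in 𝓝[≠] (0 : ℝ), |u x| ≤ C * (c * |x| ^ n) := by
  obtain ⟨C, hC⟩ := h n
  refine ⟨max C 1, le_max_right _ _, hC.mono fun x hx => hx.trans ?_⟩
  exact mul_le_mul_of_nonneg_right (le_max_left _ _) (by positivity)

/-- A flat component can be put entirely into the remainder, since it stays flat after division by
`x^N`. The coordinate then becomes exactly `x^N w_i` in the blow-up. -/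
theorem IsExpansion.exists_of_flat {σ w : ℝ → Fin m → ℝ} {N : ℕ} {P : Fin m → Polynomial ℝ}
    (h : IsExpansion σ N P w) {i : Fin m} (hi : FlatMod c fun x => σ x i) :
    ∃ P' w', IsExpansion σ N P' w' ∧ P' i = 0 ∧ FlatMod c fun x => w' x i := by
  classical
  have hf : FlatMod c fun x => σ x i / x ^ N := by
    intro n
    obtain ⟨C, hC⟩ := hi (n + N)
    refine ⟨C, ?_⟩
    filter_upwards [hC, self_mem_nhdsWithin] with x hx hx0
    have hx0 : x ≠ 0 := hx0
    have h1 : 0 < |x| ^ N := by positivity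
    rw [abs_div, abs_pow, div_le_iff₀ h1]
    refine hx.trans (le_of_eq ?_)
    rw [pow_add]; ring
  have ht : Tendsto (fun x => σ x i / x ^ N) (𝓝[≠] 0) (𝓝 0) := by
    obtain ⟨C, hC⟩ := hf 1
    refine squeeze_zero_norm' hC ?_
    exact (Continuous.tendsto' (by fun_prop) _ _ (by simp)).mono_left nhdsWithin_le_nhds
  refine ⟨Function.update P i 0, fun x => Function.update (w x) i (σ x i / x ^ N),
    ⟨fun j => ?_, tendsto_pi_nhds.2 fun j => ?_, ?_⟩, by simp, by simpa using hf⟩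
  · by_cases hj : j = i
    · subst hj; simp
    · simpa [hj] using h.eval_zero j
  · by_cases hj : j = i
    · subst hj; simpa using ht
    · simpa [hj] using tendsto_pi_nhds.1 h.tendsto j
  · filter_upwards [h.eq, self_mem_nhdsWithin] with x hx hx0
    have hx0 : x ≠ 0 := hx0
    ext j
    by_cases hj : j = i
    · subst hj
      simp [curvePoint]
      field_simp
    · have := congrFun hx j
      simpa [curvePoint, hj] using this

theorem exists_add_mul_pow_le {K : ℝ} (hK : 0 ≤ K) (k : ℕ) : ∃ C, 0 ≤ C ∧ ∀ ρ η : ℝ, 0 ≤ ρ → 0 ≤ η →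
    η ≤ 1 → (ρ + K * η) ^ (k + 1) ≤ C * (ρ ^ (k + 1) + η) := by
  refine ⟨2 ^ k * (1 + K ^ (k + 1)), by positivity, fun ρ η hρ hη hη1 => ?_⟩
  refine (add_pow_le hρ (by positivity) (k + 1)).trans ?_
  rw [Nat.add_sub_cancel, mul_assoc]
  refine mul_le_mul_of_nonneg_left ?_ (by positivity)
  have h1 : η ^ (k + 1) ≤ η := pow_le_of_le_one hη hη1 (by omega)
  have h2 : 0 ≤ K ^ (k + 1) * ρ ^ (k + 1) := by positivity
  have h3 : K ^ (k + 1) * η ^ (k + 1) ≤ K ^ (k + 1) * η := by gcongr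
  rw [mul_pow]
  nlinarith

theorem mul_abs_pow_le_one {c : ℝ} (hcc : c * c = c) {x : ℝ} (hx : |x| ≤ 1) (n : ℕ) :
    0 ≤ c * |x| ^ n ∧ c * |x| ^ n ≤ 1 := by
  have h0 : 0 ≤ c := by nlinarith
  have h1 : c ≤ 1 := by nlinarith
  exact ⟨by positivity, mul_le_one₀ h1 (by positivity) (pow_le_one₀ (abs_nonneg _) hx)⟩

/-- Projection to `w_i = 0` moves the parameter away from the arc by at most a flat amount, because
the arc itself has flat `i`-th parameter. -/
theorem SmallAlong.update_zero (hcc : c * c = c) {k : ℕ} {w : ℝ → Fin m → ℝ}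
    {E : ℝ × (Fin m → ℝ) → ℝ} {i : Fin m} (hi : FlatMod c fun x => w x i)
    (h : SmallAlong c 0 (k + 1) w E) :
    SmallAlong c 0 (k + 1) w fun q => E (q.1, Function.update q.2 i 0) := by
  have hc : 0 ≤ c := by nlinarith
  intro n
  obtain ⟨B, hB0, hB⟩ := h.exists_nonneg hc n
  obtain ⟨K, hK1, hK⟩ := hi.exists_one_le hc n
  obtain ⟨C, hC0, hC⟩ := exists_add_mul_pow_le (zero_le_one.trans hK1) k
  have ht : Tendsto (fun q : ℝ × (Fin m → ℝ) => (q.1, Function.update q.2 i 0)) (paramFilter m)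
      (paramFilter m) := by
    have h0 : Tendsto (fun z : Fin m → ℝ => Function.update z i 0) (𝓝 0) (𝓝 0) :=
      Continuous.tendsto' (continuous_id.update i continuous_const) _ _ (by simp)
    exact tendsto_fst.prodMk (h0.comp tendsto_snd)
  refine ⟨B * (C + 1), ?_⟩
  filter_upwards [ht.eventually hB, hK.prod_inl _, eventually_paramFilter_abs_le_one]
    with q hq hqK hq1
  obtain ⟨hη0, hη1⟩ := mul_abs_pow_le_one hcc hq1 n
  refine hq.trans ?_
  rw [mul_assoc]
  refine mul_le_mul_of_nonneg_left ?_ hB0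
  have h1 : ‖Function.update q.2 i 0 - w q.1‖ ≤ ‖q.2 - w q.1‖ + K * (c * |q.1| ^ n) := by
    refine (pi_norm_le_iff_of_nonneg (by positivity)).2 fun j => ?_
    by_cases hj : j = i
    · subst hj
      simp only [Pi.sub_apply, Function.update_self, zero_sub, norm_neg, Real.norm_eq_abs]
      exact hqK.trans (le_add_of_nonneg_left (norm_nonneg _))
    · have := norm_le_pi_norm (q.2 - w q.1) j
      simp only [Pi.sub_apply, Function.update_of_ne hj] at this ⊢
      exact this.trans (le_add_of_nonneg_right (by positivity))
  have h2 : ‖Function.update q.2 i 0 - w q.1‖ ^ (k + 1) ≤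
      C * (‖q.2 - w q.1‖ ^ (k + 1) + c * |q.1| ^ n) :=
    (pow_le_pow_left₀ (norm_nonneg _) h1 _).trans (hC _ _ (norm_nonneg _) hη0 hη1)
  simp only [pow_zero, one_mul]
  have h3 : 0 ≤ ‖q.2 - w q.1‖ ^ (k + 1) := by positivity
  linarith

/-- Division of an estimate by the coordinate `w_i`, for a curve with flat `i`-th component. -/
theorem SmallAlong.of_coord_mul (hcc : c * c = c) {k : ℕ} {w : ℝ → Fin m → ℝ}
    (hw : Tendsto w (𝓝[≠] 0) (𝓝 0)) {D : ℝ × (Fin m → ℝ) → ℝ} (hD : ContDiffAt ℝ (k + 1 : ℕ) D 0)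
    {i : Fin m} (hi : FlatMod c fun x => w x i)
    (h : SmallAlong c 0 (k + 2) w fun q => q.2 i * D q) : SmallAlong c 0 (k + 1) w D := by
  have hc : 0 ≤ c := by nlinarith
  intro n
  -- The doubled exponent makes the flat term `η²` with `η = c |x|^(n+1)` (using `c * c = c`), so it
  -- can be divided by the step `s ≥ η`. The shift from `n` to `n + 1` makes `η` tend to `0`.
  obtain ⟨B, hB0, hB⟩ := h.exists_nonneg hc ((n + 1) + (n + 1))
  obtain ⟨K, hK1, hK⟩ := hi.exists_one_le hc (n + 1)
  have hK0 : 0 ≤ K := zero_le_one.trans hK1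
  obtain ⟨C, hC0, hC⟩ := exists_add_mul_pow_le hK0 k
  obtain ⟨M, hM⟩ := hD.exists_abs_le_sum_shift (0, Pi.single i 1) (k + 1)
  let ρ : ℝ × (Fin m → ℝ) → ℝ := fun q => ‖q.2 - w q.1‖
  let η : ℝ × (Fin m → ℝ) → ℝ := fun q => c * |q.1| ^ (n + 1)
  -- Direct division fails where `w_i` is small. The step is chosen so that `|w_i| ≤ s/2`; at the
  -- points shifted by `j s` with `j ≥ 1` the coordinate is then at least `s/2`, division is
  -- possible there, and finite differences recover `D` at the original point. The summand `v.2 > 0`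
  -- keeps `s` positive and is sent to `0` at the end.
  let s : (ℝ × (Fin m → ℝ)) × ℝ → ℝ := fun v => 2 * (ρ v.1 + K * η v.1) + v.2
  let F : Filter ((ℝ × (Fin m → ℝ)) × ℝ) := paramFilter m ×ˢ 𝓝[>] 0
  have hF1 : Tendsto (fun v : (ℝ × (Fin m → ℝ)) × ℝ => v.1) F (paramFilter m) := tendsto_fst
  have hF2 : Tendsto (fun v : (ℝ × (Fin m → ℝ)) × ℝ => v.2) F (𝓝 0) :=
    tendsto_snd.mono_right nhdsWithin_le_nhds
  have hρt : Tendsto ρ (paramFilter m) (𝓝 0) := by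
    have h1 : Tendsto (fun q : ℝ × (Fin m → ℝ) => q.2 - w q.1) (paramFilter m) (𝓝 0) := by
      simpa using tendsto_snd.sub (hw.comp tendsto_fst)
    simpa using h1.norm
  have hηt : Tendsto η (paramFilter m) (𝓝 0) :=
    (Continuous.tendsto' (by fun_prop) _ _ (by simp [η])).mono_left paramFilter_le_nhds
  have hst : Tendsto s F (𝓝 0) := by
    simpa using (((hρt.comp hF1).add ((hηt.comp hF1).const_mul K)).const_mul 2).add hF2
  have ht1 : Tendsto (fun v => (v.1, s v)) F (𝓝 0) :=
    (hF1.mono_right paramFilter_le_nhds).prodMk_nhds hst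
  have ht2 : ∀ j : ℕ, Tendsto (fun v => (v.1.1, v.1.2 + ((j : ℝ) * s v) • Pi.single i (1 : ℝ))) F
      (paramFilter m) := by
    intro j
    refine (tendsto_fst.comp hF1).prodMk ?_
    have h1 := (hst.const_mul (j : ℝ)).smul_const (Pi.single i (1 : ℝ) : Fin m → ℝ)
    simpa using (tendsto_snd.comp hF1).add h1
  have hev : ∀ᶠ v in F, |D v.1| ≤ |M| * s v ^ (k + 1) +
      2 ^ (k + 1) * (2 * B * ((k + 2 : ℝ) ^ (k + 2) * s v ^ (k + 1) + η v.1)) := by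
    have hj := (Finset.eventually_all (Finset.range (k + 2))).2 fun j _ => (ht2 j).eventually hB
    filter_upwards [ht1.eventually hM, hj, hF1.eventually (hK.prod_inl _),
      hF1.eventually eventually_paramFilter_abs_le_one,
      tendsto_snd.eventually (self_mem_nhdsWithin : Set.Ioi (0 : ℝ) ∈ 𝓝[>] 0)]
      with v hvM hvj hvK hv1 hv0
    have hv0 : 0 < v.2 := hv0
    obtain ⟨hη0, hη1⟩ := mul_abs_pow_le_one hcc hv1 (n + 1)
    change 0 ≤ η v.1 at hη0
    have hρ0 : 0 ≤ ρ v.1 := norm_nonneg _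
    have hKη : 0 ≤ K * η v.1 := by positivity
    have hs0 : 0 < s v := by simp only [s]; linarith
    have hsρ : ρ v.1 ≤ s v := by simp only [s]; linarith
    have hsη : η v.1 ≤ s v := by simp only [s]; nlinarith
    have hvi : |v.1.2 i| ≤ s v / 2 := by
      have h1 : |v.1.2 i - w v.1.1 i| ≤ ρ v.1 := norm_le_pi_norm (v.1.2 - w v.1.1) i
      have h2 : |w v.1.1 i| ≤ K * η v.1 := hvK
      have h3 := abs_add_le (v.1.2 i - w v.1.1 i) (w v.1.1 i)
      rw [sub_add_cancel] at h3
      simp only [s]; linarith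
    have hB' : 0 ≤ 2 * B * ((k + 2 : ℝ) ^ (k + 2) * s v ^ (k + 1) + η v.1) := by positivity
    refine (hvM _ hB' fun j hj1 hjk => ?_).trans ?_
    · have h1 := hvj j (Finset.mem_range.2 (by omega))
      have hj1' : (1 : ℝ) ≤ j := by exact_mod_cast hj1
      have hjk' : (j : ℝ) ≤ k + 1 := by exact_mod_cast hjk
      set z : Fin m → ℝ := v.1.2 + ((j : ℝ) * s v) • Pi.single i (1 : ℝ) with hz
      have hz' : v.1 + ((j : ℝ) * s v) • ((0, Pi.single i 1) : ℝ × (Fin m → ℝ)) = (v.1.1, z) := by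
        ext <;> simp [hz]
      rw [hz']
      have hzi : s v / 2 ≤ |z i| := by
        have h2 : z i = v.1.2 i + j * s v := by simp [hz]
        have h3 := neg_abs_le (v.1.2 i)
        rw [h2]
        refine le_trans ?_ (le_abs_self _)
        nlinarith
      have hzρ : ‖z - w v.1.1‖ ≤ (k + 2) * s v := by
        have h2 : z - w v.1.1 = (v.1.2 - w v.1.1) + ((j : ℝ) * s v) • Pi.single i (1 : ℝ) := by
          rw [hz]; abel
        have h3 : ‖((j : ℝ) * s v) • (Pi.single i (1 : ℝ) : Fin m → ℝ)‖ ≤ (k + 1) * s v := by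
          rw [norm_smul, Pi.norm_single, norm_one, mul_one, Real.norm_eq_abs,
            abs_of_nonneg (by positivity)]
          gcongr
        rw [h2]
        refine (norm_add_le _ _).trans ?_
        change ρ v.1 + _ ≤ _
        linarith
      have h4 : s v / 2 * |D (v.1.1, z)| ≤
          s v / 2 * (2 * B * ((k + 2 : ℝ) ^ (k + 2) * s v ^ (k + 1) + η v.1)) := by
        have h5 : ‖z - w v.1.1‖ ^ (k + 2) ≤ ((k + 2) * s v) ^ (k + 2) := by gcongr
        have h6 : c * |v.1.1| ^ ((n + 1) + (n + 1)) ≤ s v * η v.1 := by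
          calc c * |v.1.1| ^ ((n + 1) + (n + 1)) = (c * c) * |v.1.1| ^ ((n + 1) + (n + 1)) := by
                rw [hcc]
            _ = η v.1 * η v.1 := by simp only [η]; rw [pow_add]; ring
            _ ≤ _ := by gcongr
        calc s v / 2 * |D (v.1.1, z)| ≤ |z i| * |D (v.1.1, z)| := by gcongr
          _ = |z i * D (v.1.1, z)| := (abs_mul _ _).symm
          _ ≤ _ := h1
          _ ≤ B * (((k + 2) * s v) ^ (k + 2) + s v * η v.1) := by
            rw [pow_zero, one_mul]
            gcongr
          _ = _ := by rw [mul_pow, pow_succ (s v) (k + 1)]; ring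
      exact le_of_mul_le_mul_left h4 (by positivity)
    · rw [abs_of_pos hs0]
      gcongr
      exact le_abs_self M
  refine ⟨(|M| + 2 ^ (k + 1) * (2 * B * ((k + 2 : ℝ) ^ (k + 2)))) * (2 ^ (k + 1) * C) +
    2 ^ (k + 1) * (2 * B), ?_⟩
  filter_upwards [hev.curry, eventually_paramFilter_abs_le_one] with q hq hq1
  obtain ⟨hη0, hη1⟩ := mul_abs_pow_le_one hcc hq1 (n + 1)
  change 0 ≤ η q at hη0
  change η q ≤ 1 at hη1
  have hρ0 : 0 ≤ ρ q := norm_nonneg _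
  have h1 : |D q| ≤ |M| * s (q, 0) ^ (k + 1) +
      2 ^ (k + 1) * (2 * B * ((k + 2 : ℝ) ^ (k + 2) * s (q, 0) ^ (k + 1) + η q)) := by
    refine ge_of_tendsto (Tendsto.mono_left ?_ (nhdsWithin_le_nhds (s := Set.Ioi (0 : ℝ)))) hq
    exact Continuous.tendsto (by simp only [s]; fun_prop) 0
  have h2 : s (q, 0) ^ (k + 1) ≤ 2 ^ (k + 1) * (C * (ρ q ^ (k + 1) + η q)) := by
    simp only [s, add_zero, mul_pow]
    exact mul_le_mul_of_nonneg_left (hC _ _ hρ0 hη0 hη1) (by positivity)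
  have h3 : η q ≤ c * |q.1| ^ n :=
    mul_le_mul_of_nonneg_left (pow_le_pow_of_le_one (abs_nonneg _) hq1 (Nat.le_succ n)) hc
  rw [pow_zero, one_mul]
  change |D q| ≤ _ * (ρ q ^ (k + 1) + _)
  have h4 : 0 ≤ ρ q ^ (k + 1) := by positivity
  calc |D q| ≤ _ := h1
    _ = (|M| + 2 ^ (k + 1) * (2 * B * ((k + 2 : ℝ) ^ (k + 2)))) * s (q, 0) ^ (k + 1) +
        2 ^ (k + 1) * (2 * B) * η q := by ring
    _ ≤ (|M| + 2 ^ (k + 1) * (2 * B * ((k + 2 : ℝ) ^ (k + 2)))) *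
          (2 ^ (k + 1) * (C * (ρ q ^ (k + 1) + η q))) +
        2 ^ (k + 1) * (2 * B) * (ρ q ^ (k + 1) + η q) := by
      gcongr
      linarith
    _ = ((|M| + 2 ^ (k + 1) * (2 * B * ((k + 2 : ℝ) ^ (k + 2)))) * (2 ^ (k + 1) * C) +
        2 ^ (k + 1) * (2 * B)) * (ρ q ^ (k + 1) + η q) := by ring
    _ ≤ _ := by gcongr

end FlatMod

/-! ### The dichotomy flat or monomial, in both modes. -/

section Resolved

variable {r : ℕ} {H : ℝ → Fin r → ℝ} {c : ℝ}

/-- The function `u` is flat (zero if `c = 0`) or equivalent to a monomial at the origin. -/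
def Resolved (c : ℝ) (u : ℝ → ℝ) : Prop :=
  FlatMod c u ∨ ∃ (d : ℕ) (s : ℝ), s ≠ 0 ∧ Tendsto (fun x => u x / x ^ d) (𝓝[≠] 0) (𝓝 s)

theorem FlatMod.isBigO {u : ℝ → ℝ} (h : FlatMod c u) (n : ℕ) :
    u =O[𝓝[≠] 0] fun x => x ^ n := by
  obtain ⟨C, hC⟩ := h n
  refine Asymptotics.IsBigO.of_bound (C * c) (hC.mono fun x hx => ?_)
  rw [norm_pow, Real.norm_eq_abs, Real.norm_eq_abs, mul_assoc]
  exact hx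

theorem FlatMod.iteratedDeriv_eq_zero {u : ℝ → ℝ} (h : FlatMod c u) (hu : ContDiffAt ℝ ∞ u 0)
    (n : ℕ) : iteratedDeriv n u 0 = 0 :=
  hu.isBigO_pow_iff.1 h.isBigO n

theorem ContDiffAt.resolved {u : ℝ → ℝ} (hu : ContDiffAt ℝ ∞ u 0) : Resolved 1 u := by
  refine hu.flat_or_exists_tendsto.imp_left fun h n => ?_
  obtain ⟨C, hC⟩ := (hu.isBigO_pow_iff.2 h n).bound
  refine ⟨C, hC.mono fun x hx => ?_⟩
  rwa [norm_pow, Real.norm_eq_abs, Real.norm_eq_abs, ← one_mul (|x| ^ n)] at hx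

theorem IsSimpleFun.resolved (hH : ∀ j, ContDiffAt ℝ ∞ (fun t => H t j) 0)
    (hS : QuasiAnalytic (simpleGerms H)) {u : ℝ → ℝ} (hu : IsSimpleFun H u) : Resolved 0 u := by
  refine (hu.contDiffAt hH).flat_or_exists_tendsto.imp_left fun h n => ⟨0, ?_⟩
  filter_upwards [(hu.eventually_eq_zero hS h).filter_mono nhdsWithin_le_nhds] with x hx
  simp [hx]

end Resolved

/-! ### Analytic functions and the components of `H`. -/

section BaseCases

variable {r : ℕ} {H : ℝ → Fin r → ℝ} {c : ℝ} {m : ℕ}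

theorem CurveApprox.of_contDiffAt {f : (Fin m → ℝ) → ℝ} {a : Fin m → ℝ} (hf : ContDiffAt ℝ ω f a)
    {σ : ℝ → Fin m → ℝ} (hσ : ContDiffAt ℝ ∞ σ 0) (hσ0 : σ 0 = 0) : CurveApprox H c f a σ := by
  intro k
  obtain ⟨P, w, hw⟩ := exists_isExpansion hσ hσ0 1
  refine ⟨0, 1, P, w, fun q => f (a + curvePoint P 1 q), hw, IsSimple.of_contDiffAt ?_,
    SmallAlong.zero.congr (Eventually.of_forall fun q => by simp)⟩
  refine ContDiffAt.comp_of_eq (g := f) hf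
    (contDiffAt_const.add (contDiff_curvePoint P 1).contDiffAt) ?_
  rw [curvePoint_zero hw.eval_zero, add_zero]

/-- For fixed `z ≠ 0`, the substitution `s = (y - z) / z^(p+1)` in the flow identity expresses `H`
near `z` by an analytic function of `y`. -/
theorem eventually_contDiffAt_of_flow {p : ℕ} {F : ℝ × ℝ × (Fin r → ℝ) → Fin r → ℝ}
    (hF : AnalyticAt ℝ F 0) (hH0 : H 0 = 0) (hHc : ContinuousAt H 0)
    (hHF : ∀ᶠ q in 𝓝 (0 : ℝ × ℝ), H (q.1 + q.1 ^ (p + 1) * q.2) = F (q.1, q.2, H q.1)) :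
    ∀ᶠ z in 𝓝 (0 : ℝ), z ≠ 0 → ContDiffAt ℝ ω H z := by
  rw [show (0 : ℝ × ℝ) = (0, 0) from rfl, nhds_prod_eq] at hHF
  have h1 : Tendsto (fun z => ((z, 0, H z) : ℝ × ℝ × (Fin r → ℝ))) (𝓝 0) (𝓝 0) := by
    have := hHc.tendsto
    rw [hH0] at this
    exact tendsto_id.prodMk_nhds (tendsto_const_nhds.prodMk_nhds this)
  filter_upwards [hHF.curry, h1.eventually hF.eventually_analyticAt] with z hz hFz hz0
  have h2 : ContDiffAt ℝ ω (fun y => F (z, (y - z) / z ^ (p + 1), H z)) z := by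
    refine ContDiffAt.comp_of_eq (g := F) (f := fun y : ℝ => (z, (y - z) / z ^ (p + 1), H z))
      hFz.contDiffAt (by fun_prop) (by simp)
  refine h2.congr_of_eventuallyEq ?_
  have h3 : Tendsto (fun y => (y - z) / z ^ (p + 1)) (𝓝 z) (𝓝 0) :=
    Continuous.tendsto' (by fun_prop) _ _ (by simp)
  filter_upwards [h3.eventually hz] with y hy
  rw [← hy]
  congr 1
  field_simp
  ring

theorem abs_sub_jet_le {u : ℝ → ℝ} (hu : ContDiffAt ℝ ∞ u 0) (k : ℕ) :
    ∃ C, 0 ≤ C ∧ ∀ᶠ z in 𝓝 (0 : ℝ), |u z - jet k u z| ≤ C * |z| ^ (k + 1) := by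
  have h1 : (fun z => u z - jet (k + 1) u z) =O[𝓝 0] fun z => z ^ (k + 1) :=
    (hu.sub_jet_isLittleO (k + 1)).isBigO
  have h2 : (fun z => u z - jet k u z) =O[𝓝 0] fun z : ℝ => z ^ (k + 1) := by
    refine (h1.add ((Asymptotics.isBigO_refl (fun z : ℝ => z ^ (k + 1)) (𝓝 0)).const_mul_left
      (iteratedDeriv (k + 1) u 0 / (Nat.factorial (k + 1) : ℝ)))).congr_left fun z => ?_
    rw [jet, jet, Finset.sum_range_succ _ (k + 1)]
    ring
  obtain ⟨C, hC0, hC⟩ := h2.exists_nonneg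
  exact ⟨C, hC0, by simpa using hC.bound⟩

theorem contDiff_jet (k : ℕ) (u : ℝ → ℝ) {n : ℕ∞ω} : ContDiff ℝ n (jet k u) := by
  unfold jet
  exact ContDiff.sum fun i _ => by fun_prop

/-- With `P = 0` the blown-up point is bounded by `|w|`, which is at most the distance to the arc
plus a flat term. The Taylor polynomial of degree `k` is then accurate enough. -/
theorem CurveApprox.component_of_flat (hH : ∀ j, ContDiffAt ℝ ∞ (fun t => H t j) 0)
    (hcc : c * c = c) (j : Fin r) {σ : ℝ → Fin 1 → ℝ} (hσ : ContDiffAt ℝ ∞ σ 0) (hσ0 : σ 0 = 0)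
    (hi : FlatMod c fun x => σ x 0) : CurveApprox H c (fun z : Fin 1 → ℝ => H (z 0) j) 0 σ := by
  have hc : 0 ≤ c := by nlinarith
  intro k
  obtain ⟨P₀, w₀, hw₀⟩ := exists_isExpansion hσ hσ0 1
  obtain ⟨P, w, hw, hP, hwf⟩ := hw₀.exists_of_flat hi
  obtain ⟨A, hA0, hA⟩ := abs_sub_jet_le (hH j) k
  have hzt : Tendsto (fun q => curvePoint P 1 q 0) (paramFilter 1) (𝓝 0) :=
    tendsto_pi_nhds.1 ((tendsto_curvePoint hw.eval_zero 1).mono_left paramFilter_le_nhds) 0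
  refine ⟨0, 1, P, w, fun q => jet k (fun t => H t j) (curvePoint P 1 q 0), hw,
    IsSimple.of_contDiffAt ((contDiff_jet k _).comp
      (contDiff_pi.1 (contDiff_curvePoint P 1) 0)).contDiffAt, fun n => ?_⟩
  obtain ⟨K, hK1, hK⟩ := hwf.exists_one_le hc n
  obtain ⟨C, hC0, hC⟩ := exists_add_mul_pow_le (zero_le_one.trans hK1) k
  refine ⟨A * C, ?_⟩
  filter_upwards [hzt.eventually hA, hK.prod_inl _, eventually_paramFilter_abs_le_one]
    with q hq hqK hq1
  obtain ⟨hη0, hη1⟩ := mul_abs_pow_le_one hcc hq1 n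
  have h1 : |curvePoint P 1 q 0| ≤ ‖q.2 - w q.1‖ + K * (c * |q.1| ^ n) := by
    have h2 : curvePoint P 1 q 0 = q.1 * q.2 0 := by simp [curvePoint, hP]
    have h3 : |q.2 0 - w q.1 0| ≤ ‖q.2 - w q.1‖ := norm_le_pi_norm (q.2 - w q.1) 0
    have h4 := abs_add_le (q.2 0 - w q.1 0) (w q.1 0)
    rw [sub_add_cancel] at h4
    rw [h2, abs_mul]
    nlinarith [abs_nonneg (q.2 0)]
  simp only [pow_zero, one_mul, zero_add]
  refine hq.trans ?_
  rw [mul_assoc]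
  refine mul_le_mul_of_nonneg_left ?_ hA0
  exact (pow_le_pow_left₀ (abs_nonneg _) h1 _).trans (hC _ _ (norm_nonneg _) hη0 hη1)

theorem IsExpansion.exists_eq_X_pow_mul {σ w : ℝ → Fin m → ℝ} {N : ℕ} {P : Fin m → Polynomial ℝ}
    (h : IsExpansion σ N P w) {i : Fin m} {d : ℕ} {s : ℝ} (hd : d < N)
    (hs : Tendsto (fun x => σ x i / x ^ d) (𝓝[≠] 0) (𝓝 s)) :
    ∃ R : Polynomial ℝ, P i = Polynomial.X ^ d * R ∧ R.eval 0 = s := by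
  refine Polynomial.exists_eq_X_pow_mul_of_eventuallyEq d
    (w := fun x => σ x i / x ^ d - x ^ (N - d) * w x i) ?_ ?_
  · filter_upwards [h.eq, self_mem_nhdsWithin] with x hx hx0
    have hx0 : x ≠ 0 := hx0
    have h1 := congrFun hx i
    simp only [curvePoint] at h1
    rw [mul_sub, ← mul_assoc, ← pow_add, Nat.add_sub_cancel' hd.le, h1]
    field_simp
    ring
  · have hx : Tendsto (fun x : ℝ => x ^ (N - d)) (𝓝[≠] 0) (𝓝 0) :=
      (Continuous.tendsto' (by fun_prop) _ _ (by simp; omega)).mono_left nhdsWithin_le_nhds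
    simpa using hs.sub (hx.mul (tendsto_pi_nhds.1 h.tendsto i))

theorem CurveApprox.component_of_tendsto {p : ℕ} {F : ℝ × ℝ × (Fin r → ℝ) → Fin r → ℝ}
    (hF : AnalyticAt ℝ F 0) (hH0 : H 0 = 0)
    (hHF : ∀ᶠ q in 𝓝 (0 : ℝ × ℝ), H (q.1 + q.1 ^ (p + 1) * q.2) = F (q.1, q.2, H q.1))
    (j : Fin r) {σ : ℝ → Fin 1 → ℝ} (hσ : ContDiffAt ℝ ∞ σ 0) (hσ0 : σ 0 = 0)
    {d : ℕ} {s : ℝ} (hs0 : s ≠ 0) (hs : Tendsto (fun x => σ x 0 / x ^ d) (𝓝[≠] 0) (𝓝 s)) :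
    CurveApprox H c (fun z : Fin 1 → ℝ => H (z 0) j) 0 σ := by
  intro k
  obtain ⟨P, w, hw⟩ := exists_isExpansion hσ hσ0 (d * (p + 1) + 1)
  obtain ⟨R, hPR, hR⟩ := hw.exists_eq_X_pow_mul (by nlinarith) hs
  -- With `P = x^d R` and `N = d(p+1) + 1`, the blown-up point is `P + P^(p+1) b`. The flow identity
  -- at `z = P(x)`, `s = b` then gives an exact simple expression; the additional `+ 1` in `N` makes
  -- `b` vanish at the origin.
  let b : ℝ × (Fin 1 → ℝ) → ℝ := fun q => q.1 * q.2 0 / R.eval q.1 ^ (p + 1)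
  have hR0 : ∀ᶠ q in 𝓝 (0 : ℝ × (Fin 1 → ℝ)), R.eval q.1 ≠ 0 := by
    have h1 : Tendsto (fun q : ℝ × (Fin 1 → ℝ) => R.eval q.1) (𝓝 0) (𝓝 s) :=
      Continuous.tendsto' (by fun_prop) _ _ (by simpa using hR)
    exact h1.eventually_ne hs0
  have hb : ContDiffAt ℝ ω b 0 := by
    refine ContDiffAt.div (by fun_prop) ?_ (pow_ne_zero _ (by simpa [hR] using hs0))
    exact ((contDiff_polynomial_eval R).comp contDiff_fst).contDiffAt.pow _
  let v : Fin (r + 2) → ℝ × (Fin 1 → ℝ) → ℝ := Fin.cons (fun q => (P 0).eval q.1)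
    (Fin.cons b fun i q => jetQuotient 0 (fun t => H t i) ((P 0).eval q.1))
  have hv : ∀ i, IsSimple H (v i) := by
    refine Fin.cases (IsSimple.poly _) (Fin.cases (IsSimple.of_contDiffAt hb) fun i => ?_)
    exact IsJetAtom.isSimple (y := fun x => jetQuotient 0 (fun t => H t i) ((P 0).eval x))
      ⟨0, i, P 0, hw.eval_zero 0, rfl⟩
  have hv0 : (fun i => v i 0) = 0 := by
    ext i
    refine Fin.cases ?_ (Fin.cases ?_ fun i => ?_) i
    · exact hw.eval_zero 0
    · simp [v, b]
    · change jetQuotient 0 (fun t => H t i) ((P 0).eval 0) = 0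
      rw [hw.eval_zero, jetQuotient_zero_right]
  let F' : (Fin (r + 2) → ℝ) → ℝ := fun y => F (y 0, y 1, fun i => y i.succ.succ) j
  have hF' : ContDiffAt ℝ ω F' fun i => v i 0 := by
    rw [hv0]
    exact ContDiffAt.comp_of_eq (g := fun y => F y j)
      (f := fun y : Fin (r + 2) → ℝ => (y 0, y 1, fun i : Fin r => y i.succ.succ))
      (contDiffAt_pi.1 hF.contDiffAt j) (by fun_prop) rfl
  refine ⟨0, _, P, w, _, hw, IsSimple.contDiffAt_comp hv hF', SmallAlong.zero.congr ?_⟩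
  have ht : Tendsto (fun q : ℝ × (Fin 1 → ℝ) => ((P 0).eval q.1, b q)) (𝓝 0) (𝓝 0) := by
    refine Tendsto.prodMk_nhds (Continuous.tendsto' (by fun_prop) _ _ (by simpa using hw.eval_zero 0)) ?_
    simpa [b] using hb.continuousAt.tendsto
  filter_upwards [paramFilter_le_nhds (ht.eventually hHF), paramFilter_le_nhds hR0] with q hq hqR
  have h1 : ∀ i, jetQuotient 0 (fun t => H t i) ((P 0).eval q.1) = H ((P 0).eval q.1) i := by
    intro i; simp [jetQuotient_zero_left, hH0]
  have h2 : ((0 : Fin 1 → ℝ) + curvePoint P (d * (p + 1) + 1) q) 0 =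
      (P 0).eval q.1 + (P 0).eval q.1 ^ (p + 1) * b q := by
    simp only [Pi.add_apply, Pi.zero_apply, curvePoint, zero_add, b, add_right_inj]
    rw [hPR]
    simp only [Polynomial.eval_mul, Polynomial.eval_pow, Polynomial.eval_X]
    rw [mul_pow, ← pow_mul]
    field_simp
    ring
  rw [pow_zero, one_mul, h2, hq]
  simp only [F', v, Fin.cons_zero, Fin.cons_succ, h1]
  exact sub_self _

end BaseCases

/-! ### Stability under division by a coordinate. -/

section Division

variable {r : ℕ} {H : ℝ → Fin r → ℝ} {c : ℝ} {m : ℕ}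

theorem CurveApprox.div_of_tendsto (hH : ∀ j, ContDiffAt ℝ ∞ (fun t => H t j) 0) (hc : 0 ≤ c)
    {f g : (Fin m → ℝ) → ℝ} {a : Fin m → ℝ} {σ : ℝ → Fin m → ℝ} {i : Fin m}
    (hσ : ContDiffAt ℝ ∞ σ 0) (hσ0 : σ 0 = 0) (hai : a i = 0) (hfc : ContinuousAt f a)
    (hfg : ∀ᶠ y in 𝓝 a, f y = y i * g y) (hf : CurveApprox H c f a σ)
    {d : ℕ} {s : ℝ} (hs0 : s ≠ 0) (hs : Tendsto (fun x => σ x i / x ^ d) (𝓝[≠] 0) (𝓝 s)) :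
    CurveApprox H c g a σ := by
  intro k
  obtain ⟨N₀, hN₀⟩ := hf.exists_isSimple hH hc hfc k 0
  let N := max N₀ (d + 1)
  have hdN : d < N := le_max_right N₀ (d + 1)
  obtain ⟨P, w, hw⟩ := exists_isExpansion hσ hσ0 N
  obtain ⟨gf, hgf, hs'⟩ := hN₀ N (le_max_left _ _) P w hw
  obtain ⟨R, hPR, hR⟩ := hw.exists_eq_X_pow_mul hdN hs
  -- In the blow-up the coordinate `y_i` equals `x^d b` with `b` a unit, so `gf / b` approximates
  -- `x^d g`.
  let b : ℝ × (Fin m → ℝ) → ℝ := fun q => R.eval q.1 + q.1 ^ (N - d) * q.2 i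
  have hb : ContDiffAt ℝ ω b 0 :=
    ((contDiff_polynomial_eval R).comp contDiff_fst).contDiffAt.add (by fun_prop)
  have hNd : N - d ≠ 0 := by omega
  have hb0 : b 0 = s := by simp [b, hNd, hR]
  refine ⟨d, N, P, w, _, hw, hgf.div (IsSimple.of_contDiffAt hb) (by rwa [hb0]), ?_⟩
  refine (hs'.mono hc hw.tendsto (Nat.zero_le _) le_rfl).of_abs_le (K := 2 / |s|) (by positivity) ?_
  have h1 : ∀ᶠ q in 𝓝 (0 : ℝ × (Fin m → ℝ)), |s| / 2 < |b q| := by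
    have h2 := hb.continuousAt.tendsto.abs
    rw [hb0] at h2
    exact h2.eventually (lt_mem_nhds (by have := abs_pos.2 hs0; linarith))
  filter_upwards [paramFilter_le_nhds h1, (tendsto_add_curvePoint hw.eval_zero N a).eventually hfg]
    with q hq hqf
  have hs1 := abs_pos.2 hs0
  have hb1 : b q ≠ 0 := by
    intro h; rw [h, abs_zero] at hq; linarith
  have h3 : (a + curvePoint P N q) i = q.1 ^ d * b q := by
    simp only [Pi.add_apply, hai, curvePoint, hPR, Polynomial.eval_mul, Polynomial.eval_pow,
      Polynomial.eval_X, b]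
    rw [mul_add, ← mul_assoc (q.1 ^ d) (q.1 ^ (N - d)), ← pow_add, Nat.add_sub_cancel' hdN.le]
    ring
  have h4 : q.1 ^ d * g (a + curvePoint P N q) - gf q / b q =
      (f (a + curvePoint P N q) - gf q) / b q := by
    rw [hqf, h3]; field_simp
  rw [h4, abs_div, div_eq_inv_mul]
  refine mul_le_mul_of_nonneg_right ?_ (abs_nonneg _)
  rw [inv_le_comm₀ (by linarith) (by positivity), inv_div]
  exact hq.le

theorem CurveApprox.div_of_flat (hH : ∀ j, ContDiffAt ℝ ∞ (fun t => H t j) 0) (hcc : c * c = c)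
    {f g : (Fin m → ℝ) → ℝ} {a : Fin m → ℝ} {σ : ℝ → Fin m → ℝ} {i : Fin m}
    (hσ : ContDiffAt ℝ ∞ σ 0) (hσ0 : σ 0 = 0) (hai : a i = 0) (hfc : ContinuousAt f a)
    (hg : ContDiffAt ℝ ∞ g a) (hfg : ∀ᶠ y in 𝓝 a, f y = y i * g y) (hf : CurveApprox H c f a σ)
    (hi : FlatMod c fun x => σ x i) : CurveApprox H c g a σ := by
  have hc : 0 ≤ c := by nlinarith
  intro k
  obtain ⟨N, hN⟩ := hf.exists_isSimple hH hc hfc (k + 1) 0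
  obtain ⟨P₀, w₀, hw₀⟩ := exists_isExpansion hσ hσ0 N
  obtain ⟨P, w, hw, hP, hwf⟩ := hw₀.exists_of_flat hi
  obtain ⟨gf, hgf, hs⟩ := hN N le_rfl P w hw
  obtain ⟨g', hg', hgg'⟩ := hgf.exists_slope hH i
  refine ⟨N, N, P, w, g', hw, hg', ?_⟩
  have hD : ContDiffAt ℝ ∞ (fun q => q.1 ^ N * g (a + curvePoint P N q) - g' q) 0 := by
    refine ContDiffAt.sub (ContDiffAt.mul (by fun_prop) ?_) (hg'.contDiffAt hH)
    refine ContDiffAt.comp_of_eq (g := g) hg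
      (contDiffAt_const.add (contDiff_curvePoint P N).contDiffAt) ?_
    rw [curvePoint_zero hw.eval_zero, add_zero]
  have hs0 := hs.mono hc hw.tendsto (Nat.zero_le _) le_rfl
  -- Here `y_i = x^N w_i`, so `f` vanishes on `w_i = 0`. The error of `f` minus its restriction to
  -- `w_i = 0` is therefore `w_i (x^N g - g')` with `g'` the slope of `gf`, and
  -- `SmallAlong.of_coord_mul` removes `w_i` at the cost of one order.
  have hs1 := hs0.update_zero hcc hwf
  refine SmallAlong.of_coord_mul hcc hw.tendsto (contDiffAt_infty.1 hD (k + 1)) hwf ?_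
  refine (hs0.add (hs1.of_abs_le (K := 1) (E' := fun q => -(f (a + curvePoint P N
    (q.1, Function.update q.2 i 0)) - gf (q.1, Function.update q.2 i 0))) zero_le_one
    (Eventually.of_forall fun q => by rw [abs_neg, one_mul]))).congr ?_
  have ht : Tendsto (fun q : ℝ × (Fin m → ℝ) => a + curvePoint P N (q.1, Function.update q.2 i 0))
      (paramFilter m) (𝓝 a) := by
    refine Tendsto.mono_left (Continuous.tendsto' ?_ _ _ ?_) paramFilter_le_nhds
    · refine continuous_const.add ((contDiff_curvePoint P N (k := 0)).continuous.comp
        (continuous_fst.prodMk (continuous_snd.update i continuous_const)))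
    · have : ((0 : ℝ × (Fin m → ℝ)).1, Function.update (0 : ℝ × (Fin m → ℝ)).2 i 0) = 0 := by
        ext <;> simp
      rw [this, curvePoint_zero hw.eval_zero, add_zero]
  filter_upwards [(tendsto_add_curvePoint hw.eval_zero N a).eventually hfg, ht.eventually hfg,
    paramFilter_le_nhds hgg'] with q hq1 hq2 hq3
  have e1 : (a + curvePoint P N q) i = q.1 ^ N * q.2 i := by simp [hai, curvePoint, hP]
  have e2 : (a + curvePoint P N (q.1, Function.update q.2 i 0)) i = 0 := by
    simp [hai, curvePoint, hP]
  rw [e1] at hq1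
  rw [e2, zero_mul] at hq2
  rw [hq1, hq2, mul_sub, ← hq3]
  ring

theorem CurveApprox.div (hH : ∀ j, ContDiffAt ℝ ∞ (fun t => H t j) 0) (hcc : c * c = c)
    {f g : (Fin m → ℝ) → ℝ} {a : Fin m → ℝ} {σ : ℝ → Fin m → ℝ} {i : Fin m}
    (hσ : ContDiffAt ℝ ∞ σ 0) (hσ0 : σ 0 = 0) (hai : a i = 0) (hfc : ContinuousAt f a)
    (hg : ContDiffAt ℝ ∞ g a) (hfg : ∀ᶠ y in 𝓝 a, f y = y i * g y) (hf : CurveApprox H c f a σ)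
    (hi : Resolved c fun x => σ x i) : CurveApprox H c g a σ := by
  rcases hi with hi | ⟨d, s, hs0, hs⟩
  · exact hf.div_of_flat hH hcc hσ hσ0 hai hfc hg hfg hi
  · exact hf.div_of_tendsto hH (by nlinarith) hσ hσ0 hai hfc hfg hs0 hs

end Division

/-! ### The local property `ArcSimpleAt` and its stability. -/

section Arcs

variable {r : ℕ} {H : ℝ → Fin r → ℝ} {c : ℝ} {m n : ℕ}

/-- The arcs through the origin: the smooth ones, with `c = 1`, and the simple ones, with
`c = 0`. -/
def IsArc (H : ℝ → Fin r → ℝ) (c : ℝ) (σ : ℝ → Fin m → ℝ) : Prop :=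
  σ 0 = 0 ∧ (c = 1 ∧ ContDiffAt ℝ ∞ σ 0 ∨ c = 0 ∧ ∀ i, IsSimpleFun H fun x => σ x i)

theorem IsArc.contDiffAt (hH : ∀ j, ContDiffAt ℝ ∞ (fun t => H t j) 0) {σ : ℝ → Fin m → ℝ}
    (h : IsArc H c σ) : ContDiffAt ℝ ∞ σ 0 := by
  obtain ⟨-, ⟨-, h⟩ | ⟨-, h⟩⟩ := h
  · exact h
  · exact contDiffAt_pi.2 fun i => (h i).contDiffAt hH

theorem IsArc.mul_self {σ : ℝ → Fin m → ℝ} (h : IsArc H c σ) : c * c = c := by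
  obtain ⟨-, ⟨rfl, -⟩ | ⟨rfl, -⟩⟩ := h <;> simp

theorem IsArc.nonneg {σ : ℝ → Fin m → ℝ} (h : IsArc H c σ) : 0 ≤ c := by
  nlinarith [h.mul_self]

theorem IsArc.resolved (hH : ∀ j, ContDiffAt ℝ ∞ (fun t => H t j) 0)
    (hS : QuasiAnalytic (simpleGerms H)) {σ : ℝ → Fin m → ℝ} (h : IsArc H c σ) (i : Fin m) :
    Resolved c fun x => σ x i := by
  obtain ⟨-, ⟨rfl, h⟩ | ⟨rfl, h⟩⟩ := h
  · exact (contDiffAt_pi.1 h i).resolved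
  · exact (h i).resolved hH hS

/-- The smooth function `f` is approximated by simple functions along all arcs through `a`. -/
def ArcSimpleAt (H : ℝ → Fin r → ℝ) (f : (Fin m → ℝ) → ℝ) (a : Fin m → ℝ) : Prop :=
  ContDiffAt ℝ ∞ f a ∧ ∀ c σ, IsArc H c σ → CurveApprox H c f a σ

theorem ArcSimpleAt.congr {f f' : (Fin m → ℝ) → ℝ} {a : Fin m → ℝ} (h : ArcSimpleAt H f a)
    (hf : f' =ᶠ[𝓝 a] f) : ArcSimpleAt H f' a :=
  ⟨h.1.congr_of_eventuallyEq hf, fun c σ hσ => (h.2 c σ hσ).congr hf⟩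

theorem ArcSimpleAt.of_contDiffAt (hH : ∀ j, ContDiffAt ℝ ∞ (fun t => H t j) 0)
    {f : (Fin m → ℝ) → ℝ} {a : Fin m → ℝ} (hf : ContDiffAt ℝ ω f a) : ArcSimpleAt H f a :=
  ⟨hf.of_le le_top, fun _ _ hσ => CurveApprox.of_contDiffAt hf (hσ.contDiffAt hH) hσ.1⟩

theorem ArcSimpleAt.isSimpleFun (hH : ∀ j, ContDiffAt ℝ ∞ (fun t => H t j) 0)
    {f : (Fin m → ℝ) → ℝ} {a : Fin m → ℝ} (hf : ArcSimpleAt H f a) {σ : ℝ → Fin m → ℝ}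
    (hσ : ∀ i, IsSimpleFun H fun x => σ x i) (hσ0 : σ 0 = 0) :
    IsSimpleFun H fun x => f (a + σ x) :=
  (hf.2 0 σ ⟨hσ0, Or.inr ⟨rfl, hσ⟩⟩).isSimpleFun hH hf.1.continuousAt hσ hσ0

theorem IsSimpleFun.sub_const {u : ℝ → ℝ} (hu : IsSimpleFun H u) (b : ℝ) :
    IsSimpleFun H fun x => u x - b := by
  obtain ⟨g, hg, hug⟩ := hu
  exact ⟨_, hg.sub_const b, hug.mono fun x hx => congrArg (· - b) hx⟩

theorem IsArc.map (hH : ∀ j, ContDiffAt ℝ ∞ (fun t => H t j) 0) {σ : ℝ → Fin n → ℝ}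
    (hσ : IsArc H c σ) {G : (Fin n → ℝ) → Fin m → ℝ} {a : Fin n → ℝ}
    (hG : ∀ i, ArcSimpleAt H (fun z => G z i) a) : IsArc H c fun x => G (a + σ x) - G a := by
  refine ⟨by simp [hσ.1], hσ.2.imp (And.imp_right fun h => ?_) (And.imp_right fun h i => ?_)⟩
  · refine ContDiffAt.sub (ContDiffAt.comp_of_eq (g := G) (contDiffAt_pi.2 fun i => (hG i).1)
      (contDiffAt_const.add h) ?_) contDiffAt_const
    rw [hσ.1, add_zero]
  · exact ((hG i).isSimpleFun hH h hσ.1).sub_const _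

theorem ArcSimpleAt.comp (hH : ∀ j, ContDiffAt ℝ ∞ (fun t => H t j) 0) {f : (Fin m → ℝ) → ℝ}
    {G : (Fin n → ℝ) → Fin m → ℝ} {a : Fin n → ℝ} (hG : ∀ i, ArcSimpleAt H (fun z => G z i) a)
    (hf : ArcSimpleAt H f (G a)) : ArcSimpleAt H (fun z => f (G z)) a := by
  have hGs : ContDiffAt ℝ ∞ G a := contDiffAt_pi.2 fun i => (hG i).1
  exact ⟨ContDiffAt.comp_of_eq (g := f) hf.1 hGs rfl, fun c σ hσ =>
    CurveApprox.comp hH hσ.nonneg (hσ.contDiffAt hH) hσ.1 hGs (fun i => (hG i).2 c σ hσ)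
      (hf.2 c _ (hσ.map hH hG))⟩

theorem ArcSimpleAt.comp₂ (hH : ∀ j, ContDiffAt ℝ ∞ (fun t => H t j) 0) {f g : (Fin m → ℝ) → ℝ}
    {a : Fin m → ℝ} (hf : ArcSimpleAt H f a) (hg : ArcSimpleAt H g a) {F : ℝ × ℝ → ℝ}
    (hF : ContDiffAt ℝ ω F (f a, g a)) : ArcSimpleAt H (fun z => F (f z, g z)) a := by
  refine ArcSimpleAt.comp hH (f := fun y : Fin 2 → ℝ => F (y 0, y 1)) (G := fun z => ![f z, g z]) ?_ ?_
  · simpa [Fin.forall_fin_two] using ⟨hf, hg⟩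
  · refine ArcSimpleAt.of_contDiffAt hH ?_
    exact ContDiffAt.comp_of_eq (g := F) (f := fun y : Fin 2 → ℝ => (y 0, y 1)) hF (by fun_prop)
      (by simp)

theorem ArcSimpleAt.div_coord (hH : ∀ j, ContDiffAt ℝ ∞ (fun t => H t j) 0)
    (hS : QuasiAnalytic (simpleGerms H)) {f g : (Fin m → ℝ) → ℝ} {a : Fin m → ℝ} {i : Fin m}
    (hf : ArcSimpleAt H f a) (hg : ContDiffAt ℝ ∞ g a) (hfg : ∀ᶠ y in 𝓝 a, f y = y i * g y) :
    ArcSimpleAt H g a := by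
  by_cases hai : a i = 0
  · exact ⟨hg, fun c σ hσ => (hf.2 c σ hσ).div hH hσ.mul_self (hσ.contDiffAt hH) hσ.1 hai
      hf.1.continuousAt hg hfg (hσ.resolved hH hS i)⟩
  · have h1 : ArcSimpleAt H (fun z : Fin m → ℝ => z i) a := ArcSimpleAt.of_contDiffAt hH (by fun_prop)
    refine (hf.comp₂ hH h1 (F := fun y => y.1 / y.2)
      (ContDiffAt.div (by fun_prop) (by fun_prop) hai)).congr ?_
    filter_upwards [hfg, (continuous_apply i).continuousAt.eventually_ne hai] with y hy hy0
    rw [hy]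
    exact (mul_div_cancel_left₀ _ hy0).symm

/-- An implicit function is simple along simple arcs. -/
theorem ArcSimpleAt.isSimpleFun_implicit (hH : ∀ j, ContDiffAt ℝ ∞ (fun t => H t j) 0)
    (hS : QuasiAnalytic (simpleGerms H))
    {f : (Fin (m + 1) → ℝ) → ℝ} {h : (Fin m → ℝ) → ℝ} {a : Fin m → ℝ} (hh : ContDiffAt ℝ ∞ h a)
    (hf : ArcSimpleAt H f (Fin.snoc a (h a) : Fin (m + 1) → ℝ))
    (hfh : ∀ᶠ z in 𝓝 a, f (Fin.snoc z (h z) : Fin (m + 1) → ℝ) = 0)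
    (hu : ∀ᶠ v in 𝓝 (a, h a), f (Fin.snoc v.1 v.2 : Fin (m + 1) → ℝ) = 0 → h v.1 = v.2)
    {γ : ℝ → Fin m → ℝ} (hγ : ∀ i, IsSimpleFun H fun x => γ x i) (hγ0 : γ 0 = 0)
    (hha : CurveApprox H 1 h a γ) : IsSimpleFun H fun x => h (a + γ x) := by
  have hγs : ContDiffAt ℝ ∞ γ 0 := contDiffAt_pi.2 fun i => (hγ i).contDiffAt hH
  -- Only the flat mode is assumed for `h`, so `u` agrees with `h ∘ γ` up to a flat function. It
  -- remains to show that `u` solves the equation exactly.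
  obtain ⟨u, hus, hhu⟩ := hha.exists_isSimpleFun hH zero_le_one hh.continuousAt hγ hγ0
  have hc : ContDiffAt ℝ ∞ (fun x => h (a + γ x)) 0 :=
    ContDiffAt.comp_of_eq (g := h) hh (contDiffAt_const.add hγs) (by rw [hγ0, add_zero])
  have huc := hus.contDiffAt hH
  have hu0 : u 0 = h a := by
    have h1 := hhu.iteratedDeriv_eq_zero (hc.sub huc) 0
    simp only [iteratedDeriv_zero, hγ0, add_zero] at h1
    linarith
  let b : Fin (m + 1) → ℝ := Fin.snoc a (h a)
  let σ : ℝ → Fin (m + 1) → ℝ := fun x => Fin.snoc (γ x) (u x - h a)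
  have hσ : ∀ i, IsSimpleFun H fun x => σ x i := by
    refine Fin.lastCases ?_ fun i => ?_
    · simpa [σ] using hus.sub_const (h a)
    · simpa [σ] using hγ i
  have hσ0 : σ 0 = 0 := by
    ext i
    refine Fin.lastCases ?_ (fun i => ?_) i
    · simp [σ, hu0]
    · simp [σ, hγ0]
  have hbσ : ∀ x, b + σ x = Fin.snoc (a + γ x) (u x) := by
    intro x
    ext i
    refine Fin.lastCases ?_ (fun i => ?_) i <;> simp [σ, b]
  have hfs := hf.isSimpleFun hH hσ hσ0
  have h1 : Tendsto (fun x => a + γ x) (𝓝 0) (𝓝 a) := by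
    simpa [hγ0] using hγs.continuousAt.tendsto.const_add a
  have hflat : ∀ n : ℕ, (fun x => f (b + σ x)) =O[𝓝[≠] 0] fun x => x ^ n := by
    intro n
    obtain ⟨C, hC0, hC⟩ := hf.1.exists_norm_sub_le (by simp)
    have h2 : Tendsto (fun x => (b + σ x, (Fin.snoc (a + γ x) (h (a + γ x)) : Fin (m + 1) → ℝ)))
        (𝓝 0) (𝓝 (b, b)) := by
      refine Tendsto.prodMk_nhds ?_ ?_
      · have h3 : ContDiffAt ℝ ∞ σ 0 := contDiffAt_pi.2 fun i => (hσ i).contDiffAt hH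
        simpa [hσ0] using h3.continuousAt.tendsto.const_add b
      · have h3 : Tendsto (fun z => (Fin.snoc z (h z) : Fin (m + 1) → ℝ)) (𝓝 a) (𝓝 b) :=
          (contDiff_snoc (k := 0)).continuous.continuousAt.tendsto.comp
            (tendsto_id.prodMk_nhds hh.continuousAt.tendsto)
        exact h3.comp h1
    refine (Asymptotics.IsBigO.of_bound C ?_).trans (hhu.isBigO n)
    filter_upwards [(h2.eventually hC).filter_mono nhdsWithin_le_nhds,
      (h1.eventually hfh).filter_mono nhdsWithin_le_nhds] with x hx hx'
    rw [hx', sub_zero] at hx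
    refine hx.trans (mul_le_mul_of_nonneg_left ?_ hC0)
    rw [hbσ]
    refine (pi_norm_le_iff_of_nonneg (norm_nonneg _)).2 (Fin.lastCases ?_ fun i => ?_)
    · simp [abs_sub_comm]
    · simp
  -- Quasi-analyticity of the simple functions turns the approximate solution into an exact one, and
  -- `hu` identifies it with `h ∘ γ`.
  have hz := hfs.eventually_eq_zero hS ((hfs.contDiffAt hH).isBigO_pow_iff.1 hflat)
  refine hus.congr ?_
  have h4 : Tendsto (fun x => (a + γ x, u x)) (𝓝 0) (𝓝 (a, h a)) := by
    have := huc.continuousAt.tendsto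
    rw [hu0] at this
    exact h1.prodMk_nhds this
  filter_upwards [hz, h4.eventually hu] with x hx hx'
  rw [hbσ] at hx
  exact hx' hx

/-- For smooth arcs the graph arc is automatically smooth, which settles `c = 1`. That case makes
the graph arc of a simple arc simple, and only then is `c = 0` accessible. -/
theorem ArcSimpleAt.implicit (hH : ∀ j, ContDiffAt ℝ ∞ (fun t => H t j) 0)
    (hS : QuasiAnalytic (simpleGerms H))
    {f : (Fin (m + 1) → ℝ) → ℝ} {h : (Fin m → ℝ) → ℝ} {a : Fin m → ℝ} (hh : ContDiffAt ℝ ∞ h a)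
    (hf : ArcSimpleAt H f (Fin.snoc a (h a) : Fin (m + 1) → ℝ))
    (hd : fderiv ℝ f (Fin.snoc a (h a) : Fin (m + 1) → ℝ) (Pi.single (Fin.last m) 1) ≠ 0)
    (hfh : ∀ᶠ z in 𝓝 a, f (Fin.snoc z (h z) : Fin (m + 1) → ℝ) = 0)
    (hu : ∀ᶠ v in 𝓝 (a, h a), f (Fin.snoc v.1 v.2 : Fin (m + 1) → ℝ) = 0 → h v.1 = v.2) :
    ArcSimpleAt H h a := by
  have key : ∀ c γ, IsArc H c γ → IsArc H c (fun x =>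
      (Fin.snoc (a + γ x) (h (a + γ x)) : Fin (m + 1) → ℝ) -
        (Fin.snoc a (h a) : Fin (m + 1) → ℝ)) → CurveApprox H c h a γ := fun c γ hγ hγ' =>
    CurveApprox.implicit hH hγ.nonneg (hγ.contDiffAt hH) hγ.1 hh hf.1 hd hfh (hf.2 c _ hγ')
  have key1 : ∀ γ : ℝ → Fin m → ℝ, ContDiffAt ℝ ∞ γ 0 → γ 0 = 0 → CurveApprox H 1 h a γ := by
    intro γ hγ hγ0
    have h1 : ContDiffAt ℝ ∞ (fun x => a + γ x) 0 := contDiffAt_const.add hγ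
    have h2 : ContDiffAt ℝ ∞ (fun x => h (a + γ x)) 0 :=
      ContDiffAt.comp_of_eq (g := h) hh h1 (by rw [hγ0, add_zero])
    refine key 1 γ ⟨hγ0, Or.inl ⟨rfl, hγ⟩⟩ ⟨by simp [hγ0], Or.inl ⟨rfl, ?_⟩⟩
    exact (contDiff_snoc.contDiffAt.comp 0 (h1.prodMk h2)).sub contDiffAt_const
  refine ⟨hh, ?_⟩
  rintro c γ ⟨hγ0, ⟨rfl, hγ⟩ | ⟨rfl, hγ⟩⟩
  · exact key1 γ hγ hγ0
  · have hγs : ContDiffAt ℝ ∞ γ 0 := contDiffAt_pi.2 fun i => (hγ i).contDiffAt hH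
    have h1 := hf.isSimpleFun_implicit hH hS hh hfh hu hγ hγ0 (key1 γ hγs hγ0)
    refine key 0 γ ⟨hγ0, Or.inr ⟨rfl, hγ⟩⟩ ⟨by simp [hγ0], Or.inr ⟨rfl, Fin.lastCases ?_ fun i => ?_⟩⟩
    · simpa using h1.sub_const (h a)
    · simpa using hγ i

end Arcs

/-! ### The class of germs and its admissibility. -/

section Germs

variable {r : ℕ} {H : ℝ → Fin r → ℝ}

/-- The algebra of the germs of the functions that are approximated by simple functions along all
arcs near the origin. -/
def arcClass (H : ℝ → Fin r → ℝ) (hH : ∀ j, ContDiffAt ℝ ∞ (fun t => H t j) 0) (m : ℕ) :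
    Subring (OriginGerm m) where
  carrier := {φ | ∃ f : (Fin m → ℝ) → ℝ, (f : OriginGerm m) = φ ∧ ∀ᶠ a in 𝓝 0, ArcSimpleAt H f a}
  zero_mem' := ⟨0, rfl, Eventually.of_forall fun _ =>
    ArcSimpleAt.of_contDiffAt hH (contDiffAt_const (c := (0 : ℝ)))⟩
  one_mem' := ⟨1, rfl, Eventually.of_forall fun _ =>
    ArcSimpleAt.of_contDiffAt hH (contDiffAt_const (c := (1 : ℝ)))⟩
  add_mem' := by
    rintro _ _ ⟨f, rfl, hf⟩ ⟨g, rfl, hg⟩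
    refine ⟨fun z => f z + g z, rfl, ?_⟩
    filter_upwards [hf, hg] with a hfa hga
    exact hfa.comp₂ hH hga (F := fun y => y.1 + y.2) (by fun_prop)
  mul_mem' := by
    rintro _ _ ⟨f, rfl, hf⟩ ⟨g, rfl, hg⟩
    refine ⟨fun z => f z * g z, rfl, ?_⟩
    filter_upwards [hf, hg] with a hfa hga
    exact hfa.comp₂ hH hga (F := fun y => y.1 * y.2) (by fun_prop)
  neg_mem' := by
    rintro _ ⟨f, rfl, hf⟩
    refine ⟨fun z => - f z, rfl, ?_⟩
    filter_upwards [hf] with a hfa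
    exact hfa.comp₂ hH hfa (F := fun y => - y.1) (by fun_prop)

theorem coe_mem_arcClass (hH : ∀ j, ContDiffAt ℝ ∞ (fun t => H t j) 0)
    {m : ℕ} {f : (Fin m → ℝ) → ℝ} :
    (f : OriginGerm m) ∈ arcClass H hH m ↔ ∀ᶠ a in 𝓝 0, ArcSimpleAt H f a := by
  refine ⟨?_, fun h => ⟨f, rfl, h⟩⟩
  rintro ⟨g, hg, h⟩
  filter_upwards [h, (Filter.Germ.coe_eq.1 hg).eventuallyEq_nhds] with a ha hga
  exact ha.congr hga.symm

theorem arcClass_implicit (hH : ∀ j, ContDiffAt ℝ ∞ (fun t => H t j) 0)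
    (hS : QuasiAnalytic (simpleGerms H)) {m : ℕ} {f : (Fin (m + 1) → ℝ) → ℝ}
    (hf : ∀ᶠ a in 𝓝 0, ArcSimpleAt H f a) (hf0 : f 0 = 0)
    (hd : fderiv ℝ f 0 (Pi.single (Fin.last m) 1) ≠ 0) :
    ∃ g : (Fin m → ℝ) → ℝ, (∀ᶠ a in 𝓝 0, ArcSimpleAt H g a) ∧ g 0 = 0 ∧
      ∀ᶠ x in 𝓝 (0 : Fin m → ℝ), f (Fin.snoc x (g x) : Fin (m + 1) → ℝ) = 0 := by
  let F : (Fin m → ℝ) × ℝ → ℝ := fun v => f (Fin.snoc v.1 v.2)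
  have hs0 : (Fin.snoc (0 : Fin m → ℝ) (0 : ℝ) : Fin (m + 1) → ℝ) = 0 := by
    rw [snoc_zero_eq_smul_single, zero_smul]
  have hF : ∀ v : (Fin m → ℝ) × ℝ, ContDiffAt ℝ ∞ f (Fin.snoc v.1 v.2 : Fin (m + 1) → ℝ) →
      ContDiffAt ℝ ∞ F v := fun v hv =>
    ContDiffAt.comp_of_eq (g := f) hv contDiff_snoc.contDiffAt rfl
  have hFd : ∀ v : (Fin m → ℝ) × ℝ, ContDiffAt ℝ ∞ f (Fin.snoc v.1 v.2 : Fin (m + 1) → ℝ) →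
      fderiv ℝ F v (0, 1) =
        fderiv ℝ f (Fin.snoc v.1 v.2 : Fin (m + 1) → ℝ) (Pi.single (Fin.last m) 1) := by
    intro v hv
    have h1 := (hF v hv).differentiableAt (by simp)
    have h2 := hv.differentiableAt (by simp)
    have h3 : HasDerivAt (fun t : ℝ => v + t • ((0, 1) : (Fin m → ℝ) × ℝ)) (0, 1) 0 := by
      simpa using ((hasDerivAt_id (0 : ℝ)).smul_const ((0, 1) : (Fin m → ℝ) × ℝ)).const_add v
    have h4 : HasDerivAt (fun t : ℝ => (Fin.snoc v.1 v.2 : Fin (m + 1) → ℝ) +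
        t • (Pi.single (Fin.last m) 1 : Fin (m + 1) → ℝ)) (Pi.single (Fin.last m) 1) 0 := by
      simpa using ((hasDerivAt_id (0 : ℝ)).smul_const
        (Pi.single (Fin.last m) 1 : Fin (m + 1) → ℝ)).const_add (Fin.snoc v.1 v.2 : Fin (m + 1) → ℝ)
    have h5 := HasFDerivAt.comp_hasDerivAt_of_eq 0 h1.hasFDerivAt h3 (by simp)
    have h6 := HasFDerivAt.comp_hasDerivAt_of_eq 0 h2.hasFDerivAt h4 (by simp)
    refine h5.unique (h6.congr_of_eventuallyEq (Eventually.of_forall fun t => ?_))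
    simp only [Function.comp_apply, F]
    congr 1
    ext i
    refine Fin.lastCases ?_ (fun i => ?_) i
    · simp
    · simp [Fin.castSucc_ne_last]
  have hfs := hf.self_of_nhds.1
  have hfs' : ContDiffAt ℝ ∞ f (Fin.snoc (0 : (Fin m → ℝ) × ℝ).1 (0 : (Fin m → ℝ) × ℝ).2 :
      Fin (m + 1) → ℝ) := by
    change ContDiffAt ℝ ∞ f (Fin.snoc (0 : Fin m → ℝ) (0 : ℝ) : Fin (m + 1) → ℝ)
    rwa [hs0]
  obtain ⟨h, hh, hh0, hfh, hu⟩ := ContDiffAt.exists_implicit (n := ∞) (by simp) (hF 0 hfs')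
    (by change f (Fin.snoc (0 : Fin m → ℝ) (0 : ℝ) : Fin (m + 1) → ℝ) = 0; rwa [hs0])
    (by
      rw [hFd 0 hfs']
      change fderiv ℝ f (Fin.snoc (0 : Fin m → ℝ) (0 : ℝ) : Fin (m + 1) → ℝ) _ ≠ 0
      rwa [hs0])
  change ContDiffAt ℝ ∞ h 0 at hh
  change h 0 = 0 at hh0
  change ∀ᶠ x in 𝓝 0, F (x, h x) = 0 at hfh
  refine ⟨h, ?_, hh0, hfh⟩
  have ht : Tendsto (fun a => ((a, h a) : (Fin m → ℝ) × ℝ)) (𝓝 0) (𝓝 0) := by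
    have := hh.continuousAt.tendsto
    rw [hh0] at this
    exact tendsto_id.prodMk_nhds this
  have ht' : Tendsto (fun a => (Fin.snoc a (h a) : Fin (m + 1) → ℝ)) (𝓝 0) (𝓝 0) := by
    have := ((contDiff_snoc (m := m) (k := 0)).continuous.tendsto 0).comp ht
    have h0 : (Fin.snoc (0 : (Fin m → ℝ) × ℝ).1 (0 : (Fin m → ℝ) × ℝ).2 : Fin (m + 1) → ℝ) = 0 := hs0
    rwa [h0] at this
  have hd' : ∀ᶠ z in 𝓝 0, fderiv ℝ f z (Pi.single (Fin.last m) 1) ≠ 0 := by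
    have h1 : ContinuousAt (fderiv ℝ f) 0 := (hfs.fderiv_right (m := 0) (by simp)).continuousAt
    exact (h1.clm_apply continuousAt_const).eventually_ne hd
  have hcont : ∀ᶠ a in 𝓝 0, ContDiffAt ℝ 1 h a :=
    (hh.of_le (by exact_mod_cast le_top)).eventually (by simp)
  filter_upwards [ht'.eventually hf, ht'.eventually hd', hcont, eventually_eventually_nhds.2 hfh,
    ht.eventually (eventually_eventually_nhds.2 hu)] with a haf had hac hafh hau
  -- Smoothness at `0` in the sense of `ContDiffAt ℝ ∞` gives a neighbourhood depending on the
  -- order. The implicit function theorem is therefore applied again at each nearby point, and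
  -- uniqueness identifies the two solutions.
  have hha : ContDiffAt ℝ ∞ h a := by
    obtain ⟨h', hh', hha', -, hu'⟩ := ContDiffAt.exists_implicit (n := ∞) (by simp)
      (hF (a, h a) haf.1) hafh.self_of_nhds (by rw [hFd (a, h a) haf.1]; exact had)
    refine ContDiffAt.congr_of_eventuallyEq hh' ?_
    have h1 : Tendsto (fun x => (x, h x)) (𝓝 a) (𝓝 (a, h a)) :=
      tendsto_id.prodMk_nhds hac.continuousAt.tendsto
    filter_upwards [h1.eventually hu', hafh] with x hx hx'
    exact (hx hx').symm
  exact ArcSimpleAt.implicit hH hS hha haf had hafh hau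

theorem arcClass_division (hH : ∀ j, ContDiffAt ℝ ∞ (fun t => H t j) 0)
    (hS : QuasiAnalytic (simpleGerms H)) {m : ℕ} {f : (Fin (m + 1) → ℝ) → ℝ}
    (hf : ∀ᶠ a in 𝓝 0, ArcSimpleAt H f a)
    (hf0 : ∀ᶠ y in 𝓝 (0 : Fin m → ℝ), f (Fin.cons 0 y : Fin (m + 1) → ℝ) = 0) :
    ∃ g : (Fin (m + 1) → ℝ) → ℝ, (∀ᶠ a in 𝓝 0, ArcSimpleAt H g a) ∧
      ∀ᶠ x in 𝓝 (0 : Fin (m + 1) → ℝ), f x = x 0 * g x := by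
  obtain ⟨f', hf', hff'⟩ := ContDiffOn.exists_contDiff_eventuallyEq (n := ⊤) hf
    (fun a ha => ha.1.contDiffWithinAt)
  obtain ⟨g, hg, hfg⟩ := (hf'.of_le (m := 1) (by exact_mod_cast le_top)).exists_slope
    (ContinuousLinearMap.proj 0) (Pi.single 0 1)
  have hg' : ContDiff ℝ ∞ g :=
    contDiff_infty.2 fun n => hg n (hf'.of_le (by exact_mod_cast le_top))
  have hfg' : ∀ᶠ x in 𝓝 (0 : Fin (m + 1) → ℝ), f x = x 0 * g x := by
    have h1 : Tendsto (fun x : Fin (m + 1) → ℝ => x - x 0 • (Pi.single 0 1 : Fin (m + 1) → ℝ))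
        (𝓝 0) (𝓝 0) := Continuous.tendsto' (by fun_prop) _ _ (by simp)
    have h2 : Tendsto (fun x : Fin (m + 1) → ℝ => fun i : Fin m => x i.succ) (𝓝 0) (𝓝 0) :=
      Continuous.tendsto' (by fun_prop) _ _ rfl
    filter_upwards [hff', h1.eventually hff', h2.eventually hf0] with x hx hx' hx0
    have h3 : x - x 0 • (Pi.single 0 1 : Fin (m + 1) → ℝ) = Fin.cons 0 fun i => x i.succ := by
      ext i
      refine Fin.cases ?_ (fun i => ?_) i
      · simp
      · simp [Fin.succ_ne_zero]
    have h4 := hfg x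
    simp only [ContinuousLinearMap.proj_apply] at h4
    rw [hx, hx', h3, hx0, sub_zero] at h4
    exact h4
  refine ⟨g, ?_, hfg'⟩
  filter_upwards [hf, eventually_eventually_nhds.2 hfg'] with a ha hafg
  exact ha.div_coord hH hS hg'.contDiffAt hafg

theorem isAdmissibleClass_arcClass (hH : ∀ j, ContDiffAt ℝ ∞ (fun t => H t j) 0)
    (hS : QuasiAnalytic (simpleGerms H))
    (hcomp : ∀ j, ∀ᶠ a in 𝓝 0, ArcSimpleAt H (fun x : Fin 1 → ℝ => H (x 0) j) a) :
    IsAdmissibleClass H (arcClass H hH) where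
  smooth := by
    rintro m _ ⟨f, rfl, hf⟩
    exact ⟨f, rfl, _, hf, fun a ha => ha.1.contDiffWithinAt⟩
  analytic := fun m f hf => (coe_mem_arcClass hH).2 <|
    hf.eventually_analyticAt.mono fun a ha => ArcSimpleAt.of_contDiffAt hH ha.contDiffAt
  component := fun j => (coe_mem_arcClass hH).2 (hcomp j)
  comp := by
    intro m n f g hf hg hg0
    rw [coe_mem_arcClass] at hf ⊢
    have hg' : ∀ i, ∀ᶠ a in 𝓝 0, ArcSimpleAt H (g i) a := fun i => (coe_mem_arcClass hH).1 (hg i)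
    have ht : Tendsto (fun x => fun i => g i x) (𝓝 0) (𝓝 (0 : Fin m → ℝ)) := by
      refine tendsto_pi_nhds.2 fun i => ?_
      have := (hg' i).self_of_nhds.1.continuousAt.tendsto
      rwa [hg0 i] at this
    filter_upwards [eventually_all.2 hg', ht.eventually hf] with a hga hfa
    exact ArcSimpleAt.comp hH (G := fun x i => g i x) hga hfa
  implicit := by
    intro m f hf hf0 hd
    obtain ⟨g, hg, hg0, hfg⟩ := arcClass_implicit hH hS ((coe_mem_arcClass hH).1 hf) hf0 hd
    exact ⟨g, (coe_mem_arcClass hH).2 hg, hg0, hfg⟩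
  division := by
    intro m f hf hf0
    obtain ⟨g, hg, hfg⟩ := arcClass_division hH hS ((coe_mem_arcClass hH).1 hf) hf0
    exact ⟨g, (coe_mem_arcClass hH).2 hg, hfg⟩

end Germs

/-! ### The identity theorem along lines and the conclusion. -/

section QuasiAnalyticity

variable {r : ℕ} {H : ℝ → Fin r → ℝ}

theorem iteratedDeriv_comp_smul_eq_zero {m : ℕ} {f : (Fin m → ℝ) → ℝ} {U : Set (Fin m → ℝ)}
    (hU : U ∈ 𝓝 0) (hf : ContDiffOn ℝ ∞ f U) (h0 : ∀ n : ℕ, iteratedFDeriv ℝ n f 0 = 0)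
    (b : Fin m → ℝ) (n : ℕ) : iteratedDeriv n (fun x : ℝ => f (x • b)) 0 = 0 := by
  obtain ⟨g, hg, hgf⟩ := ContDiffOn.exists_contDiff_eventuallyEq (n := ⊤) hU hf
  let L : ℝ →L[ℝ] (Fin m → ℝ) := (ContinuousLinearMap.id ℝ ℝ).smulRight b
  have h1 : (fun x : ℝ => f (x • b)) =ᶠ[𝓝 0] g ∘ L := by
    have ht : Tendsto (fun x : ℝ => x • b) (𝓝 0) (𝓝 0) :=
      Continuous.tendsto' (by fun_prop) _ _ (by simp)
    filter_upwards [ht.eventually hgf] with x hx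
    exact hx.symm
  have h2 : iteratedFDeriv ℝ n (g ∘ L) 0 = 0 := by
    rw [L.iteratedFDeriv_comp_right (hg.of_le (by exact_mod_cast le_top)) 0 le_rfl, map_zero,
      (hgf.iteratedFDeriv ℝ n).self_of_nhds, h0 n]
    rfl
  rw [(h1.iteratedDeriv_eq n), ← norm_eq_zero, ← norm_iteratedFDeriv_eq_norm_iteratedDeriv, h2,
    norm_zero]

theorem ArcSimpleAt.eventually_eq_zero (hH : ∀ j, ContDiffAt ℝ ∞ (fun t => H t j) 0)
    (hS : QuasiAnalytic (simpleGerms H)) {m : ℕ} {f : (Fin m → ℝ) → ℝ}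
    (hf : ∀ᶠ a in 𝓝 0, ArcSimpleAt H f a) (h0 : ∀ n : ℕ, iteratedFDeriv ℝ n f 0 = 0) :
    ∀ᶠ a in 𝓝 0, f a = 0 := by
  obtain ⟨δ, hδ, hball⟩ := Metric.eventually_nhds_iff_ball.1 hf
  filter_upwards [Metric.ball_mem_nhds 0 hδ] with b hb
  let I : Set ℝ := (fun t : ℝ => t • b) ⁻¹' Metric.ball 0 δ
  have hI : IsPreconnected I :=
    ((convex_ball 0 δ).linear_preimage (LinearMap.toSpanSingleton ℝ _ b)).isPreconnected
  let S : Set ℝ := {t | ∀ᶠ s in 𝓝 t, f (s • b) = 0}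
  have hline : ∀ t ∈ I, IsSimpleFun H fun x => f ((t + x) • b) := by
    intro t ht
    have h1 : ∀ i, IsSimpleFun H fun x : ℝ => (x • b) i := fun i =>
      ⟨fun q => q.1 * b i, IsSimple.of_contDiffAt (by fun_prop), Eventually.of_forall fun x => rfl⟩
    simpa only [add_smul] using (hball _ ht).isSimpleFun hH h1 (zero_smul ℝ b)
  have hshift : ∀ t : ℝ, Tendsto (fun s => s - t) (𝓝 t) (𝓝 0) := fun t =>
    Continuous.tendsto' (by fun_prop) _ _ (by simp)
  have hmem : ∀ t, (∀ᶠ x in 𝓝 (0 : ℝ), f ((t + x) • b) = 0) → t ∈ S := by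
    intro t ht
    filter_upwards [(hshift t).eventually ht] with s hs
    rwa [add_sub_cancel] at hs
  have h0S : (0 : ℝ) ∈ S := by
    refine hmem 0 ((hline 0 (by simpa [I] using hδ)).eventually_eq_zero hS fun n => ?_)
    simpa only [zero_add] using iteratedDeriv_comp_smul_eq_zero (Metric.ball_mem_nhds 0 hδ)
      (fun a ha => (hball a ha).1.contDiffWithinAt) h0 b n
  have hsub : I ⊆ S := by
    refine hI.subset_of_closure_inter_subset isOpen_setOfPred_eventually_nhds
      ⟨0, by simpa [I] using hδ, h0S⟩ ?_
    rintro t ⟨htS, htI⟩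
    -- At a limit point of `S` the restriction is either flat, hence zero by quasi-analyticity, or
    -- nonzero on a punctured neighbourhood, which contradicts the vanishing near points of `S`.
    rcases ((hline t htI).contDiffAt hH).flat_or_exists_tendsto with h | ⟨d, s, hs0, hs⟩
    · exact hmem t ((hline t htI).eventually_eq_zero hS h)
    · have h1 : ∀ᶠ x in 𝓝 (0 : ℝ), x ≠ 0 → f ((t + x) • b) ≠ 0 := by
        have := eventually_nhdsWithin_iff.1 (hs.eventually_ne hs0)
        filter_upwards [this] with x hx hx0 hfx
        exact hx hx0 (by rw [hfx, zero_div])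
      obtain ⟨t', ht', hne⟩ := ((mem_closure_iff_frequently.1 htS).and_eventually
        ((hshift t).eventually h1)).exists
      by_cases htt : t' = t
      · exact htt ▸ ht'
      · refine absurd ht'.self_of_nhds ?_
        have := hne (sub_ne_zero.2 htt)
        rwa [add_sub_cancel] at this
  have h1 : (1 : ℝ) ∈ I := by simpa [I] using hb
  simpa using (hsub h1).self_of_nhds

end QuasiAnalyticity

theorem mainTheorem8 {r p : ℕ} (hp : 1 ≤ p)
    (U : Set (ℝ × (Fin r → ℝ))) (hU : IsOpen U) (hU0 : (0 : ℝ × (Fin r → ℝ)) ∈ U)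
    (A : ℝ × (Fin r → ℝ) → Fin r → ℝ) (hA : AnalyticOnNhd ℝ A U) (hA0 : A 0 = 0)
    (ε : ℝ) (hε : 0 < ε) (H : ℝ → Fin r → ℝ)
    (hH : ContDiffOn ℝ ∞ H (Set.Icc (-ε) ε)) (hH0 : H 0 = 0)
    (hHU : ∀ x ∈ Set.Icc (-ε) ε, (x, H x) ∈ U)
    (hode : ∀ x ∈ Set.Icc (-ε) ε,
      x ^ (p + 1) • derivWithin H (Set.Icc (-ε) ε) x = A (x, H x))
    (hS : QuasiAnalytic (simpleGerms H)) :
    ∀ m : ℕ, 1 ≤ m → QuasiAnalytic (classA H m : Set (OriginGerm m)) := by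
  have hnhds : ∀ᶠ x in 𝓝 (0 : ℝ), Set.Icc (-ε) ε ∈ 𝓝 x :=
    eventually_mem_nhds_iff.2 (Icc_mem_nhds (by linarith) hε)
  have hHs : ContDiffAt ℝ ∞ H 0 := hH.contDiffAt hnhds.self_of_nhds
  have hHj : ∀ j, ContDiffAt ℝ ∞ (fun t => H t j) 0 := contDiffAt_pi.1 hHs
  obtain ⟨F, hF, hHF⟩ := exists_analytic_flow (p := p) (H' := derivWithin H (Set.Icc (-ε) ε))
    (hA 0 hU0) hH0
    (hnhds.mono fun x hx => by
      rw [derivWithin_of_mem_nhds hx]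
      exact ((hH.contDiffAt hx).differentiableAt (by simp)).hasDerivAt)
    (hnhds.mono fun x hx => hode x (mem_of_mem_nhds hx))
  have hcomp : ∀ j, ∀ᶠ a in 𝓝 0, ArcSimpleAt H (fun x : Fin 1 → ℝ => H (x 0) j) a := by
    intro j
    have ht : Tendsto (fun a : Fin 1 → ℝ => a 0) (𝓝 0) (𝓝 0) :=
      (continuous_apply 0).tendsto' _ _ rfl
    filter_upwards [ht.eventually (eventually_contDiffAt_of_flow hF hH0 hHs.continuousAt hHF)]
      with a ha
    -- Only the base point `0` needs the two cases flat and monomial; at the other points near it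
    -- `H` is analytic.
    by_cases ha0 : a 0 = 0
    · obtain rfl : a = 0 := by ext i; rw [Subsingleton.elim i 0, ha0]; rfl
      refine ⟨ContDiffAt.comp_of_eq (g := fun t => H t j) (hHj j) (by fun_prop) rfl,
        fun c σ hσ => ?_⟩
      rcases hσ.resolved hHj hS 0 with h | ⟨d, s, hs0, hs⟩
      · exact CurveApprox.component_of_flat hHj hσ.mul_self j (hσ.contDiffAt hHj) hσ.1 h
      · exact CurveApprox.component_of_tendsto hF hH0 hHF j (hσ.contDiffAt hHj) hσ.1 hs0 hs
    · exact ArcSimpleAt.of_contDiffAt hHj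
        (ContDiffAt.comp_of_eq (g := fun t => H t j) (contDiffAt_pi.1 (ha ha0) j) (by fun_prop) rfl)
  intro m _ φ hφ ⟨f, hfφ, hf0⟩
  subst hfφ
  have hle : classA H ≤ arcClass H hHj := sInf_le (isAdmissibleClass_arcClass hHj hS hcomp)
  have hf := (coe_mem_arcClass hHj).1 (hle m hφ)
  exact Filter.Germ.coe_eq.2 (ArcSimpleAt.eventually_eq_zero hHj hS hf hf0)
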